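/- **Conventions.** Let $R$ be a Dedekind domain (fields are allowed) with fraction field $K$, and let $\mathfrak a$ be a nonzero fractional ideal of $R$. A *lattice of rank 2* is a finitely generated torsion-free $R$-module of rank $2$. An *oriented quadratic algebra of type $\mathfrak a$* is a commutative $R$-algebra $S$ which is a lattice of rank 2, with an isomorphism $\alpha:\Lambda^2 S\to\mathfrak a$; write $S_K=S\otimes_R K$, extend $\alpha$ to $S_K$, and let $\xi\in S_K$ denote an element with $\alpha(1\wedge\xi)=1$. $\operatorname{Pic} S$ is the group of invertible fractional ideals of $S$ (invertible $S$-submodules of $S_K$) modulo scaling by $S_K^\times$. A triple $(I_1,I_2,I_3)$ of fractional ideals is *balanced* if $I_1I_2I_3\subseteq S$ and the image of $\Lambda^2I_1\otimes\Lambda^2I_2\otimes\Lambda^2I_3$ in $(\Lambda^2S_K)^{\otimes3}$ is $(\Lambda^2S)^{\otimes3}$. A *form of type $\mathfrak a$* is a rank-2 lattice $M$ with a quadratic map $\phi:M\to\mathfrak a^{-1}\cdot\Lambda^2M$; it is *primitive* if it does not factor through a proper sublattice of $\mathfrak a^{-1}\cdot\Lambda^2M$. A *Bhargava box of type $\mathfrak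 a$* consists of rank-2 lattices $M_1,M_2,M_3$, an isomorphism $\theta:\Lambda^2M_1\otimes\Lambda^2M_2\otimes\Lambda^2M_3\to\mathfrak a^3$ and a trilinear map $\beta:M_1\times M_2\times M_3\to\mathfrak a$ whose three partial duals $M_j\otimes M_k\to\mathfrak aM_i^*$ have image of full rank. Its three quadratic forms $\phi_i:M_i\to\mathfrak a^{-1}\cdot\Lambda^2M_i$ send $\omega$ to the element corresponding under $-\theta$ to the determinant of $\beta(\omega):M_j\to\mathfrak aM_k^*$. The box is *primitive* if $\phi_1,\phi_2,\phi_3$ are. Isomorphisms of forms and boxes are $R$-linear isomorphisms of the lattices respecting $\phi$, respectively $\theta$ and $\beta$. The quadratic algebra of a box is given as follows: if $(\eta_{i1},\eta_{i2})$ are $K$-bases of $M_i\otimes K$ with $\theta\big(\bigotimes_i\eta_{i1}\wedge\eta_{i2}\big)=1$ and $a,b,\dots,h$ are the values of $\beta$ at $(\eta_{1i},\eta_{2j},\eta_{3k})$ in lexicographic order, then the *ring of the box is $(S,\alpha)$* if some $\xi\in S_K$ with $\alpha(1\wedge\xi)=1$ is a root of $$x^2-(ah+bg+cf+de)x+abgh+acfh+adeh+bcfg+bdeg+cdef-adfg-bceh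 .$$ A form *belongs to* $(S,\alpha)$ when $M$ carries an $S$-module structure, extending the $R$-module structure, with $\phi(\omega)=\omega\wedge\xi\omega$ (equivalently $\omega\wedge s\omega=\alpha(1\wedge s)\phi(\omega)$ for $s\in S$). A box *belongs to* $(S,\alpha)$ when $M_1,M_2,M_3$ carry such $S$-module structures with $\phi_i(\omega)=\omega\wedge\xi\omega$ and $\beta(sx,y,z)=\beta(x,sy,z)=\beta(x,y,sz)$ for $s\in S$. These module structures are part of the datum, and isomorphisms of forms or boxes belonging to $S$ are required to be $S$-linear. **Statement.** Fix an oriented quadratic algebra $(S,\alpha)$ of type $\mathfrak a$. 1. *Boxes.* Every primitive box belonging to $S$ is isomorphic to the box of a balanced triple of invertible ideals of $S$, namely $M_i=I_i$, $\beta(x,y,z)=\alpha(1\wedge xyz)$, $\theta=\alpha^{\otimes3}$; and every balanced triple of invertible ideals gives a primitive box belonging to $S$. The set of isomorphism classes of primitive boxes belonging to $S$ has an abelian group structure and a group isomorphism onto $(\operatorname{Pic}S)^2$ that sends the box of $(I_1,I_2,I_3)$ to $([I_1],[I_2])$. 2. *Relation to bare boxes.* A primitive box of type $\mathfrak a$ admits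 $S$-module structures making it a box belonging to $S$ if and only if its ring is $(S,\alpha)$. Every isomorphism of the underlying boxes of two primitive boxes belonging to $S$ is semilinear over an orientation-preserving $R$-algebra automorphism of $S$. If $2\neq0$ in $R$, primitive boxes belonging to $S$ with isomorphic underlying boxes are isomorphic over $S$; so in this case the group of 1. is the set of isomorphism classes of primitive boxes of type $\mathfrak a$ with ring $(S,\alpha)$. 3. *Forms (companion statement).* The set of isomorphism classes of primitive forms belonging to $S$ has an abelian group structure and a group isomorphism onto $\operatorname{Pic}S$ that sends a form whose lattice $M$ is $S$-isomorphic to an invertible ideal $I$ to $[I]$, and every invertible ideal occurs. In this group $\phi_1\phi_2\phi_3=1$ if and only if $(\phi_1,\phi_2,\phi_3)$ are, up to isomorphism, the three forms of a primitive box belonging to $S$, and $\phi=1$ if and only if $\mathfrak a^{-1}\cdot\Lambda^2M$ is generated by a value of $\phi$. 4. *Disjoint union.* Every primitive form of type $\mathfrak a$ belongs to some oriented quadratic algebra of type $\mathfrak a$. Every isomorphism of the underlying forms of a primitive form belonging to $(S,\alpha)$ and one belonging to $(S',\alpha')$ is semilinear over an orientation-preserving $R$-algebra isomorphism $S\cong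 S'$. If $2\ne0$ in $R$, primitive forms belonging to $S$ with isomorphic underlying forms are isomorphic over $S$. Thus, if $2\neq 0$ in $R$, the set of isomorphism classes of primitive forms of type $\mathfrak a$ is the disjoint union of the groups $\operatorname{Pic}S$ over the isomorphism classes of oriented quadratic algebras of type $\mathfrak a$. -/

import Mathlib

open scoped TensorProduct nonZeroDivisors

universe u

namespace BhargavaBox

noncomputable section

section Lattices

variable (R : Type u) [CommRing R]

/-- A lattice of rank `2` over a domain `R`: a finitely generated torsion-free module of rank
`2`. A quadratic algebra over `R` is a commutative `R`-algebra which is such a lattice. -/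
class IsRankTwoLattice (M : Type u) [AddCommGroup M] [Module R M] : Prop where
  finite : Module.Finite R M
  torsionFree : Module.IsTorsionFree R M
  finrank_eq : Module.finrank R M = 2

variable {M : Type u} [AddCommGroup M] [Module R M]

/-- The element `x ∧ y` of `Λ² M`. -/
def wedge (x y : M) : ⋀[R]^2 M := exteriorPower.ιMulti R 2 ![x, y]

end Lattices

section Ideals

variable {R K : Type u} [CommRing R] [Field K] [Algebra R K]

/-- An invertible fractional ideal (over a Dedekind domain: a nonzero fractional ideal), as an
`R`-submodule of `K`. -/
abbrev idealModule (𝔞 : (FractionalIdeal R⁰ K)ˣ) : Submodule R K :=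
  ((𝔞 : FractionalIdeal R⁰ K) : Submodule R K)

/-- The lattice `𝔞⁻¹ · Λ² M` inside `(Λ² M)_K = K ⊗ Λ² M`. -/
def twist (𝔞 : (FractionalIdeal R⁰ K)ˣ) (M : Type u) [AddCommGroup M] [Module R M] :
    Submodule R (K ⊗[R] ⋀[R]^2 M) :=
  Submodule.span R {v | ∃ c ∈ idealModule 𝔞⁻¹, ∃ w : ⋀[R]^2 M, v = c ⊗ₜ[R] w}

/-- A quadratic map `φ : M → 𝔞⁻¹ · Λ² M` is primitive if it does not factor through a proper
sublattice of `𝔞⁻¹ · Λ² M`. -/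
def IsPrimitive {𝔞 : (FractionalIdeal R⁰ K)ˣ} {M : Type u} [AddCommGroup M] [Module R M]
    (φ : QuadraticMap R M (twist 𝔞 M)) : Prop :=
  ∀ N : Submodule R (twist 𝔞 M), (∀ x, φ x ∈ N) → N = ⊤

/-- A quadratic form of type `𝔞`: a rank-`2` lattice `M` with a quadratic map
`φ : M → 𝔞⁻¹ · Λ² M`. -/
structure Form (𝔞 : (FractionalIdeal R⁰ K)ˣ) where
  /-- the lattice -/
  M : Type u
  [addCommGroup : AddCommGroup M]
  [module : Module R M]
  [lattice : IsRankTwoLattice R M]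
  /-- the form -/
  φ : QuadraticMap R M (twist 𝔞 M)

attribute [instance] Form.addCommGroup Form.module Form.lattice

/-- A Bhargava box of type `𝔞`: three rank-`2` lattices, an orientation isomorphism
`θ : Λ² M₁ ⊗ Λ² M₂ ⊗ Λ² M₃ → 𝔞³` and a trilinear map `β : M₁ × M₂ × M₃ → 𝔞` such that each of
the partial duals `M_j ⊗ M_k → Hom(M_i, 𝔞) = 𝔞 M_i^*` has image of full rank `2`. (In
`β.toLinearMap x i : M_i → 𝔞` the coordinate `x i` is irrelevant.) -/
structure Box (𝔞 : (FractionalIdeal R⁰ K)ˣ) where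
  /-- the three lattices -/
  M : Fin 3 → Type u
  [addCommGroup : ∀ i, AddCommGroup (M i)]
  [module : ∀ i, Module R (M i)]
  [lattice : ∀ i, IsRankTwoLattice R (M i)]
  /-- the orientation isomorphism -/
  θ : (⨂[R] i, ⋀[R]^2 (M i)) ≃ₗ[R] idealModule (𝔞 ^ 3)
  /-- the trilinear map -/
  β : MultilinearMap R M (idealModule 𝔞)
  nondegenerate : ∀ i, Module.finrank R
    (Submodule.span R (Set.range fun x : ∀ j, M j => β.toLinearMap x i)) = 2

attribute [instance] Box.addCommGroup Box.module Box.lattice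

variable {𝔞 : (FractionalIdeal R⁰ K)ˣ}

/-- An isomorphism of forms: a linear isomorphism `f` with `φ' (f x) = (Λ² f)_K (φ x)`. -/
def Form.IsIso (F G : Form 𝔞) (f : F.M ≃ₗ[R] G.M) : Prop :=
  ∀ x, (G.φ (f x) : K ⊗[R] ⋀[R]^2 G.M) =
    (exteriorPower.map 2 (f : F.M →ₗ[R] G.M)).lTensor K (F.φ x : K ⊗[R] ⋀[R]^2 F.M)

theorem Form.IsIso.refl (F : Form 𝔞) : F.IsIso F (LinearEquiv.refl R F.M) := fun x => by
  rw [LinearEquiv.refl_toLinearMap, exteriorPower.map_id, LinearMap.lTensor_id]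
  rfl

theorem Form.IsIso.symm {F G : Form 𝔞} {f : F.M ≃ₗ[R] G.M} (h : F.IsIso G f) :
    G.IsIso F f.symm := fun x => by
  have h1 := h (f.symm x)
  rw [f.apply_symm_apply] at h1
  rw [h1, ← LinearMap.comp_apply, ← LinearMap.lTensor_comp, ← exteriorPower.map_comp,
    LinearEquiv.symm_comp, exteriorPower.map_id, LinearMap.lTensor_id]
  rfl

theorem Form.IsIso.trans {F G H : Form 𝔞} {f : F.M ≃ₗ[R] G.M} {g : G.M ≃ₗ[R] H.M}
    (h : F.IsIso G f) (h' : G.IsIso H g) : F.IsIso H (f.trans g) := fun x => by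
  rw [LinearEquiv.coe_trans, exteriorPower.map_comp, LinearMap.lTensor_comp,
    LinearMap.comp_apply, ← h x]
  exact h' (f x)

namespace Box

/-- An isomorphism of boxes: linear isomorphisms of the three lattices compatible with `β` and
`θ`. -/
def IsIso (B C : Box 𝔞) (f : ∀ i, B.M i ≃ₗ[R] C.M i) : Prop :=
  (∀ x : ∀ i, B.M i, C.β (fun i => f i (x i)) = B.β x) ∧
  ∀ w : ∀ i, ⋀[R]^2 (B.M i),
    C.θ (⨂ₜ[R] i, exteriorPower.map 2 (f i : B.M i →ₗ[R] C.M i) (w i)) = B.θ (⨂ₜ[R] i, w i)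

theorem IsIso.refl (B : Box 𝔞) : B.IsIso B fun i => LinearEquiv.refl R (B.M i) :=
  ⟨fun _ => rfl, fun w => by
    simp only [LinearEquiv.refl_toLinearMap, exteriorPower.map_id, LinearMap.id_apply]⟩

theorem IsIso.symm {B C : Box 𝔞} {f : ∀ i, B.M i ≃ₗ[R] C.M i} (h : B.IsIso C f) :
    C.IsIso B fun i => (f i).symm := by
  refine ⟨fun x => ?_, fun w => ?_⟩
  · have h1 := h.1 fun i => (f i).symm (x i)
    simp only [LinearEquiv.apply_symm_apply] at h1
    exact h1.symm
  · have h1 := h.2 fun i => exteriorPower.map 2 ((f i).symm : C.M i →ₗ[R] B.M i) (w i)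
    simp only [← LinearMap.comp_apply, ← exteriorPower.map_comp, LinearEquiv.comp_symm,
      exteriorPower.map_id, LinearMap.id_apply] at h1
    exact h1.symm

theorem IsIso.trans {B C D : Box 𝔞} {f : ∀ i, B.M i ≃ₗ[R] C.M i} {g : ∀ i, C.M i ≃ₗ[R] D.M i}
    (h : B.IsIso C f) (h' : C.IsIso D g) : B.IsIso D fun i => (f i).trans (g i) := by
  refine ⟨fun x => (h'.1 fun i => f i (x i)).trans (h.1 x), fun w => ?_⟩
  simp only [LinearEquiv.coe_trans, exteriorPower.map_comp, LinearMap.comp_apply]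
  exact (h'.2 _).trans (h.2 w)

/-- `θ` as a function of its `i`-th argument, the other two being those of `w`, extended to a
`K`-linear map on `(Λ² M_i)_K`. -/
def thetaAt (B : Box 𝔞) (i : Fin 3) (w : ∀ j, ⋀[R]^2 (B.M j)) :
    K ⊗[R] ⋀[R]^2 (B.M i) →ₗ[K] K :=
  LinearMap.liftBaseChange K
    ((idealModule (𝔞 ^ 3)).subtype ∘ₗ (B.θ : _ →ₗ[R] idealModule (𝔞 ^ 3)) ∘ₗ
      (PiTensorProduct.tprod R).toLinearMap w i)

/-- `φ : M_i → 𝔞⁻¹ · Λ² M_i` is the `i`-th quadratic form of the box. With `{i, j, k} = {1, 2, 3}`,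
`β` sends `ω ∈ M_i` to an element of `Hom(M_j, 𝔞 M_k^*)`, whose determinant is the map
`(y ∧ y', z ∧ z') ↦ β(ω,y,z) β(ω,y',z') - β(ω,y',z) β(ω,y,z')`, and `φ ω` is the element of
`𝔞⁻¹ · Λ² M_i` that corresponds to it under `-θ`. Below `ω = x i = y i`, the pairs are
`(x j, y j)` and `(x k, y k)`, and the wedge product at the place `i` itself is replaced by `φ ω`.
The equation determines `φ`, because `θ` is an isomorphism. -/
def HasForm (B : Box 𝔞) (i : Fin 3) (φ : QuadraticMap R (B.M i) (twist 𝔞 (B.M i))) : Prop :=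
  ∀ x y : ∀ j, B.M j, x i = y i → ∀ j, j ≠ i →
    B.thetaAt i (fun k => wedge R (x k) (y k)) (φ (x i) : K ⊗[R] ⋀[R]^2 (B.M i)) =
      -((B.β x : K) * (B.β y : K) -
        (B.β (Function.update x j (y j)) : K) * (B.β (Function.update y j (x j)) : K))

/-- A box is primitive if all three of its quadratic forms are. -/
def Primitive (B : Box 𝔞) : Prop := ∀ i, ∃ φ, B.HasForm i φ ∧ IsPrimitive φ

end Box

end Ideals

section QuadraticAlgebra

variable {R K : Type u} [CommRing R] [Field K] [Algebra R K]
variable {𝔞 : (FractionalIdeal R⁰ K)ˣ}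
variable {S : Type u} [CommRing S] [Algebra R S]

theorem vec_update_zero {T : Type u} (s t u : T) : Function.update ![s, t] 0 u = ![u, t] := by
  ext i
  fin_cases i <;> rfl

theorem vec_update_one {T : Type u} (s t u : T) : Function.update ![s, t] 1 u = ![s, u] := by
  ext i
  fin_cases i <;> rfl

/-- For an orientation `α : Λ² S → 𝔞`, the alternating form `(s, t) ↦ α (s ∧ t)` on `S`. -/
def vol (α : ⋀[R]^2 S ≃ₗ[R] idealModule 𝔞) : S →ₗ[R] S →ₗ[R] K :=
  LinearMap.mk₂ R (fun s t => (α (wedge R s t) : K))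
    (fun s s' t => by
      have h := (exteriorPower.ιMulti R 2 (M := S)).map_update_add ![s, t] 0 s s'
      rw [vec_update_zero, vec_update_zero, vec_update_zero] at h
      rw [wedge, h, map_add, Submodule.coe_add]
      rfl)
    (fun c s t => by
      have h := (exteriorPower.ιMulti R 2 (M := S)).map_update_smul ![s, t] 0 c s
      rw [vec_update_zero, vec_update_zero] at h
      rw [wedge, h, map_smul, Submodule.coe_smul]
      rfl)
    (fun s t t' => by
      have h := (exteriorPower.ιMulti R 2 (M := S)).map_update_add ![s, t] 1 t t'
      rw [vec_update_one, vec_update_one, vec_update_one] at h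
      rw [wedge, h, map_add, Submodule.coe_add]
      rfl)
    (fun c s t => by
      have h := (exteriorPower.ιMulti R 2 (M := S)).map_update_smul ![s, t] 1 c t
      rw [vec_update_one, vec_update_one] at h
      rw [wedge, h, map_smul, Submodule.coe_smul]
      rfl)

variable (S K) in
/-- The total algebra `S_K = S ⊗ K`. -/
abbrev Total : Type u := S ⊗[R] K

/-- The extension of the orientation to `S_K`: `(s ⊗ c, t ⊗ d) ↦ c d α(s ∧ t)`; it stands for
the isomorphism `α_K : Λ² S_K → K`, through which elements of `Λ² S_K` are read off in `K`. -/
def volK (α : ⋀[R]^2 S ≃ₗ[R] idealModule 𝔞) :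
    Total (R := R) K S →ₗ[R] Total (R := R) K S →ₗ[R] K :=
  (TensorProduct.map₂ (vol α) (LinearMap.mul R K)).compr₂ (LinearMap.mul' R K)

variable (R K S) in
/-- The invertible fractional ideals of `S`: the invertible elements of the monoid of
`S`-submodules of `S_K`. Such a submodule is automatically finitely generated and spans `S_K`
over `K`. -/
abbrev InvIdeal : Type u := (Submodule S (Total (R := R) K S))ˣ

variable (R K S) in
/-- The class group of `S`: invertible fractional ideals modulo scaling by units of `S_K`. -/
abbrev Pic : Type u :=
  InvIdeal R K S ⧸
    (Units.map (Submodule.spanSingleton S (A := Total (R := R) K S)).toMonoidHom).range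

/-- The invertible fractional ideals form a group under multiplication. -/
instance instInvIdeal (R K S : Type u) [CommRing R] [Field K] [Algebra R K] [CommRing S]
    [Algebra R S] : CommGroup (InvIdeal R K S) := inferInstance

/-- The class group is a group: the quotient of the group of invertible fractional ideals. -/
instance instPic (R K S : Type u) [CommRing R] [Field K] [Algebra R K] [CommRing S]
    [Algebra R S] : CommGroup (Pic R K S) := inferInstance

/-- The class of an invertible fractional ideal. -/
def Pic.mk (I : InvIdeal R K S) : Pic R K S := QuotientGroup.mk I

/-- A triple of fractional ideals is balanced if `I₁ I₂ I₃ ⊆ S` and the image of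
`Λ² I₁ ⊗ Λ² I₂ ⊗ Λ² I₃` in `(Λ² S_K)^{⊗ 3}` is that of `(Λ² S)^{⊗ 3}`; here `(Λ² S_K)^{⊗ 3}` is
identified with `K` by the orientation. -/
def IsBalanced (α : ⋀[R]^2 S ≃ₗ[R] idealModule 𝔞)
    (I : Fin 3 → Submodule S (Total (R := R) K S)) : Prop :=
  (∏ i, I i) ≤ 1 ∧
  Submodule.span R {c : K | ∃ x y : ∀ i, I i,
      c = ∏ i, volK α (x i : Total (R := R) K S) (y i : Total (R := R) K S)} =
    Submodule.span R {c : K | ∃ s t : Fin 3 → S, c = ∏ i, volK α (s i ⊗ₜ 1) (t i ⊗ₜ 1)}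

/-- An isomorphism of oriented quadratic algebras. -/
def PreservesOrientation {S' : Type u} [CommRing S'] [Algebra R S']
    (α : ⋀[R]^2 S ≃ₗ[R] idealModule 𝔞) (α' : ⋀[R]^2 S' ≃ₗ[R] idealModule 𝔞)
    (σ : S ≃ₐ[R] S') : Prop :=
  ∀ s t, vol α' (σ s) (σ t) = vol α s t

/-- The quadratic algebra of a box `B` is the oriented algebra `(S, α)`. Take vectors
`η_{i1}, η_{i2} ∈ M_i` with `d = θ(⨂ η_{i1} ∧ η_{i2}) ≠ 0`, and let `a, …, h` be the eight
values of `β` on them. After scaling the vectors so that `d = 1`, the algebra of `B` is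
`R[𝔞ξ]` with `α(1 ∧ ξ) = 1` and `F(ξ) = 0`, for the quadratic polynomial
`F(x) = x² - (ah + bg + cf + de) x + (abgh + ⋯ - bceh)`. Without scaling, the same is said by
`ζ = d ξ`, i.e. `α(1 ∧ ζ) = d` and `F(ζ) = 0`. -/
def Box.BelongsTo (B : Box 𝔞) (α : ⋀[R]^2 S ≃ₗ[R] idealModule 𝔞) : Prop :=
  ∃ η : ∀ i, Fin 2 → B.M i,
    (B.θ (⨂ₜ[R] i, wedge R (η i 0) (η i 1)) : K) ≠ 0 ∧
    ∃ ζ : Total (R := R) K S,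
      volK α 1 ζ = B.θ (⨂ₜ[R] i, wedge R (η i 0) (η i 1)) ∧
      (let A : Fin 2 → Fin 2 → Fin 2 → K := fun i j k => B.β fun t => η t (![i, j, k] t)
       let a := A 0 0 0
       let b := A 0 0 1
       let c := A 0 1 0
       let d := A 0 1 1
       let e := A 1 0 0
       let f := A 1 0 1
       let g := A 1 1 0
       let h := A 1 1 1
       ζ ^ 2 - ((1 : S) ⊗ₜ[R] (a * h + b * g + c * f + d * e)) * ζ +
         (1 : S) ⊗ₜ[R] (a * b * g * h + a * c * f * h + a * d * e * h + b * c * f * g +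
           b * d * e * g + c * d * e * f - a * d * f * g - b * c * e * h) = 0)

/-- A form belonging to the oriented quadratic algebra `(S, α)`: a form together with an
`S`-module structure on `M` such that `φ(ω) = ω ∧ ξ ω`, where `ξ ∈ S_K` is such that
`α(1 ∧ ξ) = 1`; in terms of elements of `S`, `ω ∧ s ω = α(1 ∧ s) φ(ω)` for all `s ∈ S`. -/
structure FormOver (α : ⋀[R]^2 S ≃ₗ[R] idealModule 𝔞) extends Form 𝔞 where
  [moduleS : Module S M]
  [tower : IsScalarTower R S M]
  wedge_smul : ∀ (s : S) (ω : M),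
    (1 : K) ⊗ₜ[R] wedge R ω (s • ω) = vol α 1 s • (φ ω : K ⊗[R] ⋀[R]^2 M)

attribute [instance] FormOver.moduleS FormOver.tower

/-- A Bhargava box belonging to the oriented quadratic algebra `(S, α)`: a box together with
`S`-module structures on the three lattices such that `β` is `S`-balanced (it depends only on the
tensor over `S`) and the three quadratic forms of the box are `φ_i(ω) = ω ∧ ξ ω`. -/
structure BoxOver (α : ⋀[R]^2 S ≃ₗ[R] idealModule 𝔞) extends Box 𝔞 where
  [moduleS : ∀ i, Module S (M i)]
  [tower : ∀ i, IsScalarTower R S (M i)]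
  smul_balanced : ∀ (s : S) (x : ∀ i, M i) (i j : Fin 3),
    β (Function.update x i (s • x i)) = β (Function.update x j (s • x j))
  /-- the three quadratic forms of the box -/
  form : ∀ i, QuadraticMap R (M i) (twist 𝔞 (M i))
  hasForm : ∀ i, toBox.HasForm i (form i)
  wedge_smul : ∀ (i : Fin 3) (s : S) (ω : M i),
    (1 : K) ⊗ₜ[R] wedge R ω (s • ω) = vol α 1 s • (form i ω : K ⊗[R] ⋀[R]^2 (M i))

attribute [instance] BoxOver.moduleS BoxOver.tower

variable {α : ⋀[R]^2 S ≃ₗ[R] idealModule 𝔞}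

/-- The `i`-th quadratic form of a box belonging to `S`, as a form belonging to `S`. -/
def BoxOver.formOver (B : BoxOver α) (i : Fin 3) : FormOver α where
  M := B.M i
  φ := B.form i
  wedge_smul := B.wedge_smul i

/-- Isomorphism of forms belonging to `S`: an `S`-linear isomorphism of forms. -/
def FormOver.Isomorphic (F G : FormOver α) : Prop :=
  ∃ f : F.M ≃ₗ[S] G.M, Form.IsIso F.toForm G.toForm (f.restrictScalars R)

/-- Isomorphism of boxes belonging to `S`: an `S`-linear isomorphism of boxes. -/
def BoxOver.Isomorphic (B C : BoxOver α) : Prop :=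
  ∃ f : ∀ i, B.M i ≃ₗ[S] C.M i, Box.IsIso B.toBox C.toBox fun i => (f i).restrictScalars R

variable (α) in
/-- The primitive forms belonging to `(S, α)`. -/
abbrev PrimFormOver : Type (u + 1) := {F : FormOver α // IsPrimitive F.φ}

variable (α) in
/-- The primitive boxes belonging to `(S, α)`. -/
abbrev PrimBoxOver : Type (u + 1) := {B : BoxOver α // ∀ i, IsPrimitive (B.form i)}

/-- Isomorphism as an equivalence relation on the primitive forms belonging to `S`. -/
instance formSetoid : Setoid (PrimFormOver α) where
  r F G := F.1.Isomorphic G.1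
  iseqv :=
    { refl := fun F => ⟨LinearEquiv.refl S _, Form.IsIso.refl F.1.toForm⟩
      symm := fun ⟨f, hf⟩ => ⟨f.symm, hf.symm⟩
      trans := fun ⟨f, hf⟩ ⟨g, hg⟩ => ⟨f.trans g, hf.trans hg⟩ }

/-- Isomorphism as an equivalence relation on the primitive boxes belonging to `S`. -/
instance boxSetoid : Setoid (PrimBoxOver α) where
  r B C := B.1.Isomorphic C.1
  iseqv :=
    { refl := fun B => ⟨fun _ => LinearEquiv.refl S _, Box.IsIso.refl B.1.toBox⟩
      symm := fun ⟨f, hf⟩ => ⟨fun i => (f i).symm, hf.symm⟩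
      trans := fun ⟨f, hf⟩ ⟨g, hg⟩ => ⟨fun i => (f i).trans (g i), hf.trans hg⟩ }

variable (α) in
/-- Isomorphism classes of primitive forms belonging to `(S, α)`. -/
abbrev FormClass : Type (u + 1) := Quotient (formSetoid (α := α))

variable (α) in
/-- Isomorphism classes of primitive boxes belonging to `(S, α)`. -/
abbrev BoxClass : Type (u + 1) := Quotient (boxSetoid (α := α))

/-- The class of a primitive form belonging to `S`. -/
def PrimFormOver.cls (F : PrimFormOver α) : FormClass α := Quotient.mk _ F

/-- The class of a primitive box belonging to `S`. -/
def PrimBoxOver.cls (B : PrimBoxOver α) : BoxClass α := Quotient.mk _ B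

/-- The `i`-th quadratic form of a primitive box belonging to `S`. -/
def PrimBoxOver.form (B : PrimBoxOver α) (i : Fin 3) : PrimFormOver α :=
  ⟨B.1.formOver i, B.2 i⟩

/-- The box `B` is (isomorphic to) the box of the triple of ideals `I`: the lattices are
`I₁, I₂, I₃`, `β(x, y, z) = α(1 ∧ xyz)`, and `θ` is the restriction of
`α_K ⊗ α_K ⊗ α_K : (Λ² S_K)^{⊗ 3} → K`. -/
def BoxOver.IsBoxOf (B : BoxOver α) (I : Fin 3 → Submodule S (Total (R := R) K S)) : Prop :=
  ∃ ι : ∀ i, B.M i ≃ₗ[S] I i,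
    (∀ x : ∀ i, B.M i, (B.β x : K) = volK α 1 (∏ i, (ι i (x i) : Total (R := R) K S))) ∧
    ∀ x y : ∀ i, B.M i, (B.θ (⨂ₜ[R] i, wedge R (x i) (y i)) : K) =
      ∏ i, volK α (ι i (x i) : Total (R := R) K S) (ι i (y i) : Total (R := R) K S)

end QuadraticAlgebra

end

end BhargavaBox

/-! Everything is computed in the plane `K × K`. A lattice of rank 2 embeds there, and over a
Dedekind domain its image is, after a shear, a direct sum 𝔟 ⊕ 𝔠 of fractional ideals
(`IsLat.decomp`). The determinant then identifies Λ² M with the ideal 𝔟𝔠, so identities in (Λ² M)_K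
become identities in `K`. In the same way S = R ⊕ 𝔞ω with ω² = p + qω and α(1 ∧ ω) = 1
(`exists_coords`).

Since α(x ∧ sx) = α(1 ∧ s) N(x), the quadratic form of an ideal I of S is the norm. Primitivity says
that the norms of elements of I generate the index 𝔞⁻¹ α(Λ² I). This equality characterizes the
invertible ideals: if I is invertible, the norm form cannot have smaller content, because dividing
by the content would give multipliers of I outside S (`Coords.nI_eq_vI`); conversely, when norms
generate the index 𝔳, the conjugate of I divided by 𝔳 is an inverse of I
(`Coords.isUnit_of_nI_eq_vI`). Norm ideals are supermultiplicative and indices submultiplicative, so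
the index is multiplicative on invertible ideals, and a triple of invertible ideals is balanced
exactly when its product is S (`Coords.isBalanced_iff`).

A vector ω with φ(ω) ≠ 0 embeds the lattice of a form S-linearly in S_K by ω ↦ 1. Hence primitive
forms over S are invertible ideals up to units of S_K. For a box, S-balancedness reduces β to a
functional on S, which by duality is α(1 ∧ zs) for some z; the quadratic forms then force θ to be
N(z) times the product of the volumes. So z is a unit and can be absorbed into one embedding
(`PrimBoxOver.exists_isEmb`). Thus a box is a triple of ideals with product S, up to scalars with
product 1, and two of the classes determine it.

The S-action is visible in the form: m ∧ sm = α(1 ∧ s) φ(m) determines the action of s up to adding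
a scalar. Hence isomorphisms of forms and boxes are semilinear, and the automorphism involved is
trivial if 2 ≠ 0. Conversely, a form with coefficients P, Q, T defines an operator W with v ∧ Wv =
φ(v), which satisfies a quadratic equation and generates the algebra of the form. For a box the
three operators, shifted by suitable scalars, share the characteristic polynomial of the box and act
identically on β; that they make S preserve the lattices is an integrality statement
(`IsLat.mem_of_quadratic`). -/

namespace BhargavaBox

/-! ### Lattices in the plane over a Dedekind domain. -/

section PlaneLattices

variable {R K : Type u} [CommRing R] [Field K] [Algebra R K]

/-- The determinant of two vectors of the plane. -/
def det2 (u v : K × K) : K := u.1 * v.2 - u.2 * v.1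

theorem det2_add_left (u v w : K × K) : det2 (u + v) w = det2 u w + det2 v w := by
  simp only [det2, Prod.fst_add, Prod.snd_add]; ring

theorem det2_add_right (u v w : K × K) : det2 u (v + w) = det2 u v + det2 u w := by
  simp only [det2, Prod.fst_add, Prod.snd_add]; ring

theorem fst_smul_prod (c : R) (v : K × K) : (c • v).1 = algebraMap R K c * v.1 := by
  rw [Prod.smul_fst, Algebra.smul_def]

theorem snd_smul_prod (c : R) (v : K × K) : (c • v).2 = algebraMap R K c * v.2 := by
  rw [Prod.smul_snd, Algebra.smul_def]

theorem det2_smul_left (c : R) (u v : K × K) : det2 (c • u) v = c • det2 u v := by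
  simp only [det2, fst_smul_prod, snd_smul_prod]; rw [Algebra.smul_def]; ring

theorem det2_smul_right (c : R) (u v : K × K) : det2 u (c • v) = c • det2 u v := by
  simp only [det2, fst_smul_prod, snd_smul_prod]; rw [Algebra.smul_def]; ring

theorem det2_self (u : K × K) : det2 u u = 0 := by
  simp only [det2]; ring

/-- A lattice in the plane: a finitely generated submodule that spans the plane. -/
structure IsLat (N : Submodule R (K × K)) : Prop where
  fg : N.FG
  exists_det_ne : ∃ u ∈ N, ∃ v ∈ N, det2 u v ≠ 0

/-- The span of the determinants of pairs of vectors in `N`. -/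
def volN (N : Submodule R (K × K)) : Submodule R K :=
  Submodule.span R {c | ∃ u ∈ N, ∃ v ∈ N, c = det2 u v}

theorem det2_mem_volN {N : Submodule R (K × K)} {u v : K × K} (hu : u ∈ N) (hv : v ∈ N) :
    det2 u v ∈ volN N := Submodule.subset_span ⟨u, hu, v, hv, rfl⟩

theorem mul_mem_units {𝔟 𝔠 : (Submodule R K)ˣ} {x y : K} (hx : x ∈ (𝔟 : Submodule R K))
    (hy : y ∈ (𝔠 : Submodule R K)) : x * y ∈ ((𝔟 * 𝔠 : (Submodule R K)ˣ) : Submodule R K) := by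
  rw [Units.val_mul]
  exact Submodule.mul_mem_mul hx hy

/-- Writing 1 = Σ mᵢnᵢ with mᵢ ∈ 𝔟⁻¹ and nᵢ ∈ 𝔟 gives x = Σ (x mᵢ) nᵢ with x mᵢ ∈ R. Expanding 1 in
this way, by induction on membership in the product, takes the place of localization in many proofs
below. -/
theorem mem_of_forall_inv_mul_mem {𝔟 : (Submodule R K)ˣ} {x : K}
    (h : ∀ y ∈ (𝔟⁻¹ : (Submodule R K)ˣ).val, x * y ∈ (1 : Submodule R K)) :
    x ∈ (𝔟 : Submodule R K) := by
  have h1 : (1 : K) ∈ (𝔟⁻¹ : (Submodule R K)ˣ).val * 𝔟.val := by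
    rw [Units.inv_mul]
    exact Submodule.mem_one.2 ⟨1, map_one _⟩
  rw [← mul_one x]
  generalize (1 : K) = z at h1
  induction h1 using Submodule.mul_induction_on' with
  | mem_mul_mem m hm n hn =>
    obtain ⟨r, hr⟩ := Submodule.mem_one.1 (h m hm)
    rw [← mul_assoc, ← hr, ← Algebra.smul_def]
    exact Submodule.smul_mem _ _ hn
  | add a _ b _ ha hb =>
    rw [mul_add]
    exact add_mem ha hb

theorem exists_ne_zero_mem (𝔟 : (Submodule R K)ˣ) : ∃ x ∈ 𝔟.val, x ≠ 0 := by
  refine (Submodule.ne_bot_iff _).1 fun h => ?_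
  have h1 := 𝔟.mul_inv
  rw [h, Submodule.bot_mul] at h1
  exact one_ne_zero ((Submodule.mem_bot R).1 (h1.symm ▸ Submodule.mem_one.2 ⟨1, map_one _⟩))

variable [IsDedekindDomain R] [IsFractionRing R K]

theorem isUnit_of_fg {N : Submodule R K} (h : N.FG) (h0 : N ≠ ⊥) : IsUnit N := by
  let I : FractionalIdeal R⁰ K := ⟨N, FractionalIdeal.isFractional_of_fg h⟩
  have hI : I ≠ 0 := fun h => h0 (by simpa [I] using congrArg FractionalIdeal.coeToSubmodule h)
  exact (IsUnit.mk0 I hI).map (FractionalIdeal.coeSubmoduleHom R⁰ K)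

theorem mem_one_of_sq_mem_one {x : K} (h : x * x ∈ (1 : Submodule R K)) :
    x ∈ (1 : Submodule R K) := by
  obtain ⟨r, hr⟩ := Submodule.mem_one.1 h
  refine Submodule.mem_one.2 (IsIntegrallyClosed.isIntegral_iff.1 ?_)
  refine IsIntegral.of_pow (n := 2) two_pos ?_
  rw [sq, ← hr]
  exact isIntegral_algebraMap

theorem mem_one_of_quadratic {x t n : K} (ht : t ∈ (1 : Submodule R K))
    (hn : n ∈ (1 : Submodule R K)) (h : x * x = t * x - n) : x ∈ (1 : Submodule R K) := by
  obtain ⟨t, rfl⟩ := Submodule.mem_one.1 ht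
  obtain ⟨n, rfl⟩ := Submodule.mem_one.1 hn
  refine Submodule.mem_one.2 (IsIntegrallyClosed.isIntegral_iff.1 ?_)
  refine ⟨Polynomial.X ^ 2 + Polynomial.C (-t) * Polynomial.X + Polynomial.C n, ?_, ?_⟩
  · monicity!
  · simp [sq, h]; ring

/-- For y ∈ 𝔠⁻¹ the square of zy lies in R, and R is integrally closed, so zy ∈ R. -/
theorem mem_of_sq_mem {𝔠 : (Submodule R K)ˣ} {z : K} (h : z * z ∈ (𝔠 * 𝔠).val) : z ∈ 𝔠.val := by
  refine mem_of_forall_inv_mul_mem fun y hy => mem_one_of_sq_mem_one ?_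
  have h1 := mul_mem_units h (mul_mem_units hy hy)
  rw [show 𝔠 * 𝔠 * (𝔠⁻¹ * 𝔠⁻¹) = 1 by group, Units.val_one] at h1
  convert h1 using 1
  ring

/-- The squares of the elements of a fractional ideal generate the square of the ideal. -/
theorem mul_mem_of_forall_sq {𝔟 𝔠 : (Submodule R K)ˣ} {t : K}
    (h : ∀ x ∈ 𝔟.val, t * (x * x) ∈ 𝔠.val) {x y : K} (hx : x ∈ 𝔟.val) (hy : y ∈ 𝔟.val) :
    t * (x * y) ∈ 𝔠.val := by
  refine mem_of_sq_mem ?_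
  convert mul_mem_units (h x hx) (h y hy) using 1
  ring

theorem mem_one_of_forall_mul {𝔟 : (Submodule R K)ˣ} {k : K}
    (h : ∀ x ∈ 𝔟.val, k * x ∈ 𝔟.val) : k ∈ (1 : Submodule R K) := by
  have : k ∈ ((1 : (Submodule R K)ˣ) : Submodule R K) := by
    have h1 : (1 : K) ∈ 𝔟.val * (𝔟⁻¹ : (Submodule R K)ˣ).val := by
      rw [Units.mul_inv]
      exact Submodule.mem_one.2 ⟨1, map_one _⟩
    rw [← mul_one k]
    generalize (1 : K) = z at h1
    induction h1 using Submodule.mul_induction_on' with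
    | mem_mul_mem m hm n hn =>
      rw [← mul_assoc, ← mul_inv_cancel 𝔟]
      exact mul_mem_units (h m hm) hn
    | add a _ b _ ha hb =>
      rw [mul_add]
      exact add_mem ha hb
  exact this

/-- A lattice in the plane is the direct sum of two fractional ideals. -/
theorem IsLat.decomp {N : Submodule R (K × K)} (h : IsLat N) :
    ∃ (k : K) (𝔟 𝔠 : (Submodule R K)ˣ), ∀ v : K × K,
      v ∈ N ↔ v.1 - k * v.2 ∈ 𝔟.val ∧ v.2 ∈ 𝔠.val := by
  obtain ⟨u, hu, v, hv, huv⟩ := h.exists_det_ne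
  have : IsNoetherian R N := isNoetherian_of_fg_of_noetherian N h.fg
  have hC : IsUnit (N.map (LinearMap.snd R K K)) := by
    refine isUnit_of_fg (h.fg.map _) fun h0 => huv ?_
    have h1 : ∀ w ∈ N, w.2 = 0 := fun w hw =>
      (Submodule.mem_bot R).1 (h0 ▸ Submodule.mem_map_of_mem hw)
    rw [det2, h1 u hu, h1 v hv]; ring
  -- This is the kernel of the second projection of N. A nonzero element arises by eliminating the
  -- second coordinate between multiples of u and v.
  have hB : IsUnit (N.comap (LinearMap.inl R K K)) := by
    refine isUnit_of_fg ?_ ?_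
    · have h1 : IsNoetherian R (N.comap (LinearMap.inl R K K)) := by
        refine isNoetherian_of_injective
          (f := ((LinearMap.inl R K K).restrict (p := N.comap (LinearMap.inl R K K)) (q := N)
            fun x hx => hx)) fun x y hxy => ?_
        have := congrArg (fun z : N => (z : K × K).1) hxy
        exact Subtype.ext this
      exact (Submodule.fg_top _).1 (h1.noetherian ⊤)
    · obtain ⟨r, hr, a, b, hab⟩ : ∃ r : R, r ≠ 0 ∧ ∃ a b : R,
          r • v.2 = algebraMap R K a ∧ r • u.2 = algebraMap R K b := by
        obtain ⟨⟨r, hr⟩, h1⟩ := IsLocalization.exist_integer_multiples_of_finite R⁰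
          ![u.2, v.2]
        obtain ⟨b, hb⟩ := h1 0
        obtain ⟨a, ha⟩ := h1 1
        exact ⟨r, nonZeroDivisors.ne_zero hr, a, b, ha.symm, hb.symm⟩
      have h2 : a • u - b • v ∈ N := sub_mem (N.smul_mem _ hu) (N.smul_mem _ hv)
      have h3 : a • u - b • v = (r • det2 u v, 0) := by
        ext
        · rw [Algebra.smul_def, Algebra.smul_def] at hab
          simp only [Prod.fst_sub, fst_smul_prod, det2]
          rw [Algebra.smul_def]
          rw [← hab.1, ← hab.2]; ring
        · rw [Algebra.smul_def, Algebra.smul_def] at hab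
          simp only [Prod.snd_sub, snd_smul_prod]
          rw [← hab.1, ← hab.2]; ring
      rw [h3] at h2
      refine (Submodule.ne_bot_iff _).2 ⟨r • det2 u v, h2, ?_⟩
      rw [Algebra.smul_def]
      exact mul_ne_zero (by simpa using hr) huv
  obtain ⟨𝔟, h𝔟⟩ := hB
  obtain ⟨𝔠, h𝔠⟩ := hC
  -- The projection N → 𝔠 splits because 𝔠 is invertible: with 1 = Σ mᵢnᵢ and lifts wᵢ ∈ N of nᵢ ∈
  -- 𝔠, the map y ↦ Σ (mᵢy) wᵢ is a section, and it has the form y ↦ (ky, y).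
  obtain ⟨k, hk⟩ : ∃ k : K, ∀ y ∈ 𝔠.val, (k * y, y) ∈ N := by
    have h1 : (1 : K) ∈ (𝔠⁻¹ : (Submodule R K)ˣ).val * 𝔠.val := by
      rw [Units.inv_mul]
      exact Submodule.mem_one.2 ⟨1, map_one _⟩
    suffices ∃ k : K, ∀ y ∈ 𝔠.val, (k * y, 1 * y) ∈ N by simpa using this
    generalize (1 : K) = z at h1
    induction h1 using Submodule.mul_induction_on' with
    | mem_mul_mem m hm n hn =>
      rw [h𝔠] at hn
      obtain ⟨w, hw, rfl⟩ := hn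
      refine ⟨m * w.1, fun y hy => ?_⟩
      have h2 : m * y ∈ (1 : Submodule R K) := by
        rw [← 𝔠.inv_mul]; exact Submodule.mul_mem_mul hm hy
      obtain ⟨r, hr⟩ := Submodule.mem_one.1 h2
      convert N.smul_mem r hw using 1
      ext
      · rw [fst_smul_prod, hr]; ring
      · rw [snd_smul_prod, hr, LinearMap.snd_apply]; ring
    | add a _ b _ ha hb =>
      obtain ⟨k, hk⟩ := ha
      obtain ⟨l, hl⟩ := hb
      refine ⟨k + l, fun y hy => ?_⟩
      convert add_mem (hk y hy) (hl y hy) using 1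
      rw [Prod.mk_add_mk, add_mul, add_mul]
  refine ⟨k, 𝔟, 𝔠, fun v => ?_⟩
  constructor
  · intro hv
    have h2 : v.2 ∈ 𝔠.val := h𝔠 ▸ Submodule.mem_map_of_mem (f := LinearMap.snd R K K) hv
    refine ⟨?_, h2⟩
    rw [h𝔟, Submodule.mem_comap]
    convert sub_mem hv (hk _ h2) using 1
    ext <;> simp
  · rintro ⟨h1, h2⟩
    rw [h𝔟, Submodule.mem_comap] at h1
    convert add_mem h1 (hk _ h2) using 1
    ext <;> simp

theorem volN_eq {N : Submodule R (K × K)} {k : K} {𝔟 𝔠 : (Submodule R K)ˣ}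
    (h : ∀ v : K × K, v ∈ N ↔ v.1 - k * v.2 ∈ 𝔟.val ∧ v.2 ∈ 𝔠.val) :
    volN N = (𝔟 * 𝔠).val := by
  apply le_antisymm
  · refine Submodule.span_le.2 ?_
    rintro _ ⟨u, hu, v, hv, rfl⟩
    rw [h] at hu hv
    have := sub_mem (mul_mem_units hu.1 hv.2) (mul_mem_units hv.1 hu.2)
    rw [SetLike.mem_coe, det2]
    convert this using 1
    ring
  · rw [Units.val_mul]
    refine Submodule.mul_le.2 fun x hx y hy => ?_
    have h1 : (x, 0) ∈ N := (h _).2 ⟨by simpa using hx, by simp⟩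
    have h2 : (k * y, y) ∈ N := (h _).2 ⟨by simp, hy⟩
    convert det2_mem_volN h1 h2 using 1
    simp [det2]

theorem IsLat.isUnit_volN {N : Submodule R (K × K)} (h : IsLat N) : IsUnit (volN N) := by
  obtain ⟨k, 𝔟, 𝔠, h1⟩ := h.decomp
  rw [volN_eq h1]
  exact Units.isUnit _

theorem IsLat.mem_one_of_smul {N : Submodule R (K × K)} (h : IsLat N) {k : K}
    (hk : ∀ v ∈ N, k • v ∈ N) : k ∈ (1 : Submodule R K) := by
  obtain ⟨l, 𝔟, 𝔠, h1⟩ := h.decomp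
  refine mem_one_of_forall_mul (𝔟 := 𝔟) fun x hx => ?_
  have h2 := hk (x, 0) ((h1 _).2 ⟨by simpa using hx, by simp⟩)
  simpa using ((h1 _).1 h2).1

/-- An integral endomorphism `T` of the plane preserves the lattice `N` as soon as all `v ∧ T v`
with `v ∈ N` lie in `Λ² N`. -/
theorem IsLat.mem_of_quadratic {N : Submodule R (K × K)} (h : IsLat N) (T : K × K →ₗ[K] K × K)
    {t n : K} (ht : t ∈ (1 : Submodule R K)) (hn : n ∈ (1 : Submodule R K))
    (hT : ∀ v, T (T v) = t • T v - n • v) (hv : ∀ v ∈ N, det2 v (T v) ∈ volN N) :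
    ∀ v ∈ N, T v ∈ N := by
  obtain ⟨k, 𝔟, 𝔠, h1⟩ := h.decomp
  rw [volN_eq h1] at hv
  -- In the basis (1, 0), (k, 1), with respect to which N is 𝔟 ⊕ 𝔠, the columns of T are (a, c) and
  -- (b, d).
  obtain ⟨a, c, h10⟩ : ∃ a c : K, T (1, 0) = (a + k * c, c) :=
    ⟨(T (1, 0)).1 - k * (T (1, 0)).2, (T (1, 0)).2, by ext <;> simp⟩
  obtain ⟨b, d, hk1⟩ : ∃ b d : K, T (k, 1) = (b + k * d, d) :=
    ⟨(T (k, 1)).1 - k * (T (k, 1)).2, (T (k, 1)).2, by ext <;> simp⟩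
  have hdec : ∀ v : K × K, v = (v.1 - k * v.2) • ((1, 0) : K × K) + v.2 • ((k, 1) : K × K) := by
    intro v; ext <;> simp; ring
  have hTv : ∀ v : K × K, T v = (v.1 - k * v.2) • ((a + k * c, c) : K × K) +
      v.2 • ((b + k * d, d) : K × K) := by
    intro v
    conv_lhs => rw [hdec v]
    rw [map_add, map_smul, map_smul, h10, hk1]
  have hc : ∀ x ∈ 𝔟.val, c * x ∈ 𝔠.val := by
    intro x hx
    -- The vector (z, 0) of N gives cz² ∈ 𝔟𝔠, and squares generate 𝔟².
    have h2 : ∀ y ∈ 𝔟.val, c * (x * y) ∈ (𝔟 * 𝔠).val := fun y hy =>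
      mul_mem_of_forall_sq (𝔟 := 𝔟) (fun z hz => by
        have h3 := hv (z, 0) ((h1 _).2 ⟨by simpa using hz, by simp⟩)
        rw [hTv] at h3
        convert h3 using 1
        simp [det2]; ring) hx hy
    refine mem_of_forall_inv_mul_mem fun y hy => ?_
    have h3 : c * x * y ∈ (𝔠 * 𝔠⁻¹).val := by
      rw [mul_inv_cancel]
      have h4 : ∀ z ∈ 𝔟.val, (c * x * y) * z ∈ 𝔟.val := fun z hz => by
        have := mul_mem_units (h2 z hz) hy
        rw [mul_inv_cancel_right] at this
        convert this using 1
        ring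
      exact mem_one_of_forall_mul h4
    simpa using h3
  have hb : ∀ y ∈ 𝔠.val, b * y ∈ 𝔟.val := by
    intro x hx
    have h2 : ∀ y ∈ 𝔠.val, b * (x * y) ∈ (𝔟 * 𝔠).val := fun y hy =>
      mul_mem_of_forall_sq (𝔟 := 𝔠) (fun z hz => by
        have h3 := hv (k * z, z) ((h1 _).2 ⟨by simp, hz⟩)
        rw [hTv] at h3
        convert neg_mem h3 using 1
        simp [det2]; ring) hx hy
    refine mem_of_forall_inv_mul_mem fun y hy => ?_
    have h4 : ∀ z ∈ 𝔠.val, (b * x * y) * z ∈ 𝔠.val := fun z hz => by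
      have := mul_mem_units (h2 z hz) hy
      rw [mul_comm 𝔟 𝔠, mul_inv_cancel_right] at this
      convert this using 1
      ring
    exact mem_one_of_forall_mul h4
  have hcb : c * b ∈ (1 : Submodule R K) := mem_one_of_forall_mul (𝔟 := 𝔠) fun y hy => by
    rw [mul_assoc]; exact hc _ (hb y hy)
  -- The equation of T gives a² = ta − (n + bc), so a is integral over R; likewise d. This is where
  -- integrality of the trace and norm is used.
  have ha : a ∈ (1 : Submodule R K) := by
    refine mem_one_of_quadratic ht (add_mem hn hcb) ?_
    have h3 := hT (1, 0)
    rw [h10, hTv] at h3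
    have h4 := congrArg Prod.fst h3
    have h5 := congrArg Prod.snd h3
    simp at h4 h5
    linear_combination h4 - k * h5
  have hd : d ∈ (1 : Submodule R K) := by
    refine mem_one_of_quadratic ht (add_mem hn hcb) ?_
    have h3 := hT (k, 1)
    rw [hk1, hTv] at h3
    have h5 := congrArg Prod.snd h3
    simp at h5
    linear_combination h5
  have hmul : ∀ (x : K) (_ : x ∈ (1 : Submodule R K)) (𝔡 : (Submodule R K)ˣ), ∀ y ∈ 𝔡.val,
      x * y ∈ 𝔡.val := fun x hx 𝔡 y hy => by
    obtain ⟨r, rfl⟩ := Submodule.mem_one.1 hx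
    rw [← Algebra.smul_def]; exact Submodule.smul_mem _ _ hy
  intro v hvN
  obtain ⟨hv1, hv2⟩ := (h1 v).1 hvN
  rw [h1, hTv]
  constructor
  · convert add_mem (hmul a ha _ _ hv1) (hb _ hv2) using 1
    simp; ring
  · convert add_mem (hc _ hv1) (hmul d hd _ _ hv2) using 1
    simp; ring

end PlaneLattices

/-! ### Modules commensurable with a cyclic one. -/

section RankOne

variable {R K : Type u} [CommRing R] [IsDomain R] [Field K] [Algebra R K] [IsFractionRing R K]

theorem exists_smul_eq_algebraMap (x : K) : ∃ r : R, r ≠ 0 ∧ ∃ a : R, r • x = algebraMap R K a := by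
  obtain ⟨⟨r, hr⟩, a, h⟩ := IsLocalization.exists_integer_multiple R⁰ x
  exact ⟨r, nonZeroDivisors.ne_zero hr, a, h.symm⟩

/-- `T` is commensurable with `R g`. -/
def RankOneAt (R : Type u) [CommRing R] {T : Type u} [AddCommGroup T] [Module R T] (g : T) : Prop :=
  ∀ w : T, ∃ r : R, r ≠ 0 ∧ ∃ a : R, r • w = a • g

variable {T : Type u} [AddCommGroup T] [Module R T]

theorem RankOneAt.of_span {g : T} {G : Set T} (hG : Submodule.span R G = ⊤)
    (h : ∀ w ∈ G, ∃ r : R, r ≠ 0 ∧ ∃ a : R, r • w = a • g) : RankOneAt R g := by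
  intro w
  have hw : w ∈ Submodule.span R G := hG ▸ Submodule.mem_top
  induction hw using Submodule.span_induction with
  | mem x hx => exact h x hx
  | zero => exact ⟨1, one_ne_zero, 0, by simp⟩
  | add x y _ _ hx hy =>
    obtain ⟨r, hr, a, h1⟩ := hx
    obtain ⟨s, hs, b, h2⟩ := hy
    refine ⟨r * s, mul_ne_zero hr hs, s * a + r * b, ?_⟩
    rw [smul_add, mul_comm r s, mul_smul, h1, mul_comm s r, mul_smul r s y, h2, add_smul, mul_smul,
      mul_smul]
  | smul c x _ hx =>
    obtain ⟨r, hr, a, h1⟩ := hx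
    exact ⟨r, hr, c * a, by rw [smul_comm, h1, mul_smul]⟩

/-- A nonzero multiple of w is a multiple of g; if f kills w but not g, that multiple is zero, and
torsion-freeness gives w = 0. This places exterior squares, and tensor products of them, inside `K`.
-/
theorem RankOneAt.injective [Module.IsTorsionFree R T] {g : T} (h : RankOneAt R g) (f : T →ₗ[R] K)
    (hf : f g ≠ 0) : Function.Injective f := by
  refine (injective_iff_map_eq_zero f).2 fun w hw => ?_
  obtain ⟨r, hr, a, h1⟩ := h w
  have h2 : a • f g = 0 := by rw [← map_smul, ← h1, map_smul, hw, smul_zero]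
  rw [smul_eq_zero_iff_left hf] at h2
  rw [h2, zero_smul] at h1
  exact (smul_eq_zero_iff_right hr).1 h1

theorem RankOneAt.map_mul_map {g : T} (h : RankOneAt R g) (f f' : T →ₗ[R] K) (w : T) :
    f w * f' g = f' w * f g := by
  obtain ⟨r, hr, a, h1⟩ := h w
  have hr' : algebraMap R K r ≠ 0 := by simpa using hr
  refine mul_left_cancel₀ hr' ?_
  have e1 := congrArg f h1
  have e2 := congrArg f' h1
  rw [map_smul, map_smul, Algebra.smul_def, Algebra.smul_def] at e1 e2
  linear_combination f' g * e1 - f g * e2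

end RankOne

/-! ### Abstract lattices of rank two, their exterior squares, and primitivity. -/

section Lattices

variable {R K : Type u} [CommRing R] [IsDedekindDomain R] [Field K] [Algebra R K]
  [IsFractionRing R K]

/-- Every vector of the plane has a multiple in the lattice. -/
theorem IsLat.exists_smul_mem {N : Submodule R (K × K)} (h : IsLat N) (v : K × K) :
    ∃ r : R, r ≠ 0 ∧ r • v ∈ N := by
  obtain ⟨u, hu, w, hw, huw⟩ := h.exists_det_ne
  obtain ⟨r, hr, a, ha⟩ := exists_smul_eq_algebraMap (R := R) (det2 v w / det2 u w)
  obtain ⟨s, hs, b, hb⟩ := exists_smul_eq_algebraMap (R := R) (det2 u v / det2 u w)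
  refine ⟨r * s, mul_ne_zero hr hs, ?_⟩
  convert add_mem (N.smul_mem (s * a) hu) (N.smul_mem (r * b) hw) using 1
  rw [Algebra.smul_def] at ha hb
  ext
  · simp only [Prod.fst_add, fst_smul_prod, map_mul, ← ha, ← hb]
    field_simp
    simp only [det2]; ring
  · simp only [Prod.snd_add, snd_smul_prod, map_mul, ← ha, ← hb]
    field_simp
    simp only [det2]; ring

variable {M : Type u} [AddCommGroup M] [Module R M]

theorem isLocalizedModule_of_isLat {j : M →ₗ[R] K × K} (hj : Function.Injective j)
    (h : IsLat (LinearMap.range j)) : IsLocalizedModule R⁰ j where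
  map_units r := by
    rw [Module.End.isUnit_iff]
    have hr : algebraMap R K r ≠ 0 := by simpa using nonZeroDivisors.ne_zero r.2
    constructor
    · refine (injective_iff_map_eq_zero _).2 fun v hv => ?_
      rw [Module.algebraMap_end_apply, smul_eq_zero_iff_right (nonZeroDivisors.ne_zero r.2)] at hv
      exact hv
    · intro v
      refine ⟨((algebraMap R K r)⁻¹ * v.1, (algebraMap R K r)⁻¹ * v.2), ?_⟩
      rw [Module.algebraMap_end_apply]
      ext
      · rw [fst_smul_prod]; field_simp
      · rw [snd_smul_prod]; field_simp
  surj v := by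
    obtain ⟨r, hr, m, hm⟩ := h.exists_smul_mem v
    exact ⟨(m, ⟨r, mem_nonZeroDivisors_of_ne_zero hr⟩), hm.symm⟩
  exists_of_eq h := ⟨1, by rw [hj h]⟩

theorem isRankTwoLattice_of_isLat {j : M →ₗ[R] K × K} (hj : Function.Injective j)
    (h : IsLat (LinearMap.range j)) : IsRankTwoLattice R M where
  finite := by
    have := Module.Finite.iff_fg.2 h.fg
    exact Module.Finite.equiv (LinearEquiv.ofInjective j hj).symm
  torsionFree := hj.moduleIsTorsionFree j (map_smul j)
  finrank_eq := by
    have := isLocalizedModule_of_isLat hj h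
    rw [← IsLocalizedModule.finrank_eq R⁰ j le_rfl, ← IsLocalization.finrank_eq K R⁰ le_rfl]
    simp

-- Torsion-freeness embeds M in K ⊗ M, which has dimension 2. Calculations with abstract lattices
-- below take place in such embeddings.
variable (R K M) in
theorem exists_embedding [IsRankTwoLattice R M] :
    ∃ j : M →ₗ[R] K × K, Function.Injective j ∧ IsLat (LinearMap.range j) := by
  have := IsRankTwoLattice.finite (R := R) (M := M)
  have := IsRankTwoLattice.torsionFree (R := R) (M := M)
  have h2 : Module.finrank K (K ⊗[R] M) = Module.finrank K (K × K) := by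
    rw [IsLocalization.finrank_eq K R⁰ le_rfl,
      IsLocalizedModule.finrank_eq R⁰ (TensorProduct.mk R K M 1) le_rfl,
      IsRankTwoLattice.finrank_eq]
    simp
  let E : K ⊗[R] M ≃ₗ[K] K × K := LinearEquiv.ofFinrankEq _ _ h2
  let i : M →ₗ[R] K ⊗[R] M := TensorProduct.mk R K M 1
  have hi : Function.Injective i := by
    refine (injective_iff_map_eq_zero _).2 fun m hm => ?_
    obtain ⟨c, hc⟩ := (IsLocalizedModule.eq_zero_iff R⁰ i).1 hm
    exact (smul_eq_zero_iff_right (nonZeroDivisors.ne_zero c.2)).1 hc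
  refine ⟨(E.toLinearMap.restrictScalars R).comp i, ?_, ?_⟩
  · exact E.injective.comp hi
  · constructor
    · exact Module.Finite.iff_fg.1 inferInstance
    · have key : ∀ v : K × K, ∃ r : R, r ≠ 0 ∧
          r • v ∈ LinearMap.range ((E.toLinearMap.restrictScalars R).comp i) := by
        intro v
        obtain ⟨⟨m, r⟩, hm⟩ := IsLocalizedModule.surj R⁰ i (E.symm v)
        refine ⟨r, nonZeroDivisors.ne_zero r.2, m, ?_⟩
        have h3 := congrArg (E.toLinearMap.restrictScalars R) hm
        rw [LinearMap.comp_apply, ← h3, Submonoid.smul_def, map_smul]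
        simp
      obtain ⟨r, hr, h3⟩ := key (1, 0)
      obtain ⟨s, hs, h4⟩ := key (0, 1)
      refine ⟨_, h3, _, h4, ?_⟩
      simp [det2, Algebra.smul_def, hr, hs]

theorem smul_det2_ne {j : M →ₗ[R] K × K} (h : IsLat (LinearMap.range j)) :
    ∃ x y : M, det2 (j x) (j y) ≠ 0 := by
  obtain ⟨_, ⟨x, rfl⟩, _, ⟨y, rfl⟩, h⟩ := h.exists_det_ne
  exact ⟨x, y, h⟩

/-- An embedding may be changed so that a given basis becomes the standard one. -/
theorem exists_embedding_basis {j : M →ₗ[R] K × K} (hj : Function.Injective j)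
    (h : IsLat (LinearMap.range j)) {x y : M} (hxy : det2 (j x) (j y) ≠ 0) :
    ∃ j' : M →ₗ[R] K × K, Function.Injective j' ∧ IsLat (LinearMap.range j') ∧
      j' x = (1, 0) ∧ j' y = (0, 1) := by
  let j' : M →ₗ[R] K × K :=
    -- Cramer's rule for the coordinates of j m in the basis j x, j y.
    { toFun := fun m => (det2 (j m) (j y) / det2 (j x) (j y), det2 (j x) (j m) / det2 (j x) (j y))
      map_add' := fun a b => by
        simp only [map_add, det2_add_left, det2_add_right, add_div, Prod.mk_add_mk]
      map_smul' := fun c a => by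
        simp only [map_smul, det2_smul_left, det2_smul_right, smul_div_assoc, RingHom.id_apply,
          Prod.smul_mk] }
  have hx : j' x = (1, 0) := by simp [j', hxy, det2_self]
  have hy : j' y = (0, 1) := by simp [j', hxy, det2_self]
  refine ⟨j', ?_, ⟨?_, ?_⟩, hx, hy⟩
  · refine (injective_iff_map_eq_zero _).2 fun m hm => ?_
    rw [← map_eq_zero_iff j hj]
    have h1 : det2 (j m) (j y) = 0 := by
      have := congrArg Prod.fst hm
      simpa [j', hxy] using this
    have h2 : det2 (j x) (j m) = 0 := by
      have := congrArg Prod.snd hm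
      simpa [j', hxy] using this
    simp only [det2] at h1 h2 hxy
    ext
    · refine (mul_eq_zero_iff_left hxy).1 ?_
      linear_combination (j x).1 * h1 + (j y).1 * h2
    · refine (mul_eq_zero_iff_left hxy).1 ?_
      linear_combination (j x).2 * h1 + (j y).2 * h2
  · have : Module.Finite R M := by
      have := Module.Finite.iff_fg.2 h.fg
      exact Module.Finite.equiv (LinearEquiv.ofInjective j hj).symm
    exact Module.Finite.iff_fg.1 inferInstance
  · exact ⟨_, ⟨x, hx⟩, _, ⟨y, hy⟩, by simp [det2]⟩

/-- The splitting makes N a copy of 𝔟 ⊕ 𝔠. Projectivity is needed to exclude torsion in Λ² N. -/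
theorem projective_of_isLat {N : Submodule R (K × K)} (h : IsLat N) : Module.Projective R N := by
  obtain ⟨k, 𝔟, 𝔠, h1⟩ := h.decomp
  have h1' := fun v : N => (h1 v).1 v.2
  let f : N →ₗ[R] 𝔟.val × 𝔠.val :=
    { toFun := fun v => (⟨_, (h1' v).1⟩, ⟨_, (h1' v).2⟩)
      map_add' := fun v w => by
        ext
        · simp; ring
        · simp
      map_smul' := fun r v => by
        ext
        · simp [Algebra.smul_def]; ring
        · simp }
  let g : 𝔟.val × 𝔠.val →ₗ[R] N :=
    { toFun := fun w => ⟨(w.1 + k * w.2, w.2), (h1 _).2 ⟨by simp, w.2.2⟩⟩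
      map_add' := fun v w => by
        ext
        · simp; ring
        · simp
      map_smul' := fun r v => by
        ext
        · simp [Algebra.smul_def]; ring
        · simp }
  refine Module.Projective.of_split f g ?_
  ext v
  · simp [f, g]
  · simp [f, g]

/-! ### Exterior squares -/

theorem span_wedge (R M : Type u) [CommRing R] [AddCommGroup M] [Module R M] :
    Submodule.span R {w : ⋀[R]^2 M | ∃ x y, w = wedge R x y} = ⊤ := by
  rw [← exteriorPower.ιMulti_span]
  congr 1
  ext w
  constructor
  · rintro ⟨x, y, rfl⟩; exact ⟨_, rfl⟩
  · rintro ⟨v, rfl⟩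
    refine ⟨v 0, v 1, ?_⟩
    rw [wedge]; congr 1; ext i; fin_cases i <;> rfl

theorem map_wedge {P : Type u} [AddCommGroup P] [Module R P] (f : M →ₗ[R] P) (x y : M) :
    exteriorPower.map 2 f (wedge R x y) = wedge R (f x) (f y) := by
  rw [wedge, exteriorPower.map_apply_ιMulti, wedge]
  congr 1; ext i; fin_cases i <;> rfl

theorem wedge_add_left (x y z : M) : wedge R (x + y) z = wedge R x z + wedge R y z := by
  have h := (exteriorPower.ιMulti R 2 (M := M)).map_update_add ![x, z] 0 x y
  rwa [vec_update_zero, vec_update_zero, vec_update_zero] at h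

theorem wedge_smul_left (c : R) (x z : M) : wedge R (c • x) z = c • wedge R x z := by
  have h := (exteriorPower.ιMulti R 2 (M := M)).map_update_smul ![x, z] 0 c x
  rwa [vec_update_zero, vec_update_zero] at h

theorem wedge_add_right (x y z : M) : wedge R z (x + y) = wedge R z x + wedge R z y := by
  have h := (exteriorPower.ιMulti R 2 (M := M)).map_update_add ![z, x] 1 x y
  rwa [vec_update_one, vec_update_one, vec_update_one] at h

theorem wedge_smul_right (c : R) (x z : M) : wedge R z (c • x) = c • wedge R z x := by
  have h := (exteriorPower.ιMulti R 2 (M := M)).map_update_smul ![z, x] 1 c x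
  rwa [vec_update_one, vec_update_one] at h

theorem wedge_self (x : M) : wedge R x x = 0 :=
  (exteriorPower.ιMulti R 2 (M := M)).map_eq_zero_of_eq _ (i := 0) (j := 1) rfl (by decide)

theorem wedge_anticomm (x y : M) : wedge R x y = -wedge R y x := by
  have h := wedge_self (R := R) (x + y)
  rw [wedge_add_left, wedge_add_right, wedge_add_right, wedge_self, wedge_self, zero_add,
    add_zero] at h
  exact eq_neg_of_add_eq_zero_left h

/-- The determinant form on `M`, through an embedding in the plane, as a map on `Λ² M`. -/
def detAlt (j : M →ₗ[R] K × K) : M [⋀^Fin 2]→ₗ[R] K where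
  toFun v := det2 (j (v 0)) (j (v 1))
  map_update_add' v i x y := by
    fin_cases i <;> simp [det2_add_left, det2_add_right]
  map_update_smul' v i c x := by
    fin_cases i <;> simp [det2_smul_left, det2_smul_right]
  map_eq_zero_of_eq' v i k hv hik := by
    fin_cases i <;> fin_cases k <;> simp_all [det2_self]

noncomputable def detMap (j : M →ₗ[R] K × K) : ⋀[R]^2 M →ₗ[R] K :=
  exteriorPower.alternatingMapLinearEquiv (detAlt j)

theorem detMap_wedge (j : M →ₗ[R] K × K) (x y : M) :
    detMap j (wedge R x y) = det2 (j x) (j y) := by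
  rw [detMap, wedge, exteriorPower.alternatingMapLinearEquiv_apply_ιMulti]
  rfl

theorem range_detMap (j : M →ₗ[R] K × K) :
    LinearMap.range (detMap j) = volN (LinearMap.range j) := by
  rw [LinearMap.range_eq_map, ← span_wedge, Submodule.map_span, volN]
  congr 1
  ext c
  constructor
  · rintro ⟨_, ⟨x, y, rfl⟩, rfl⟩
    exact ⟨_, ⟨x, rfl⟩, _, ⟨y, rfl⟩, detMap_wedge j x y⟩
  · rintro ⟨_, ⟨x, rfl⟩, _, ⟨y, rfl⟩, rfl⟩
    exact ⟨_, ⟨x, y, rfl⟩, detMap_wedge j x y⟩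

/-- A projective module is a retract of a free one, and Λ² preserves retracts, so Λ² M embeds in the
exterior square of a free module, which is torsion-free. -/
theorem isTorsionFree_exterior [Module.Projective R M] : Module.IsTorsionFree R (⋀[R]^2 M) := by
  obtain ⟨s, hs⟩ := Module.projective_lifting_property (Finsupp.linearCombination R (id : M → M))
    LinearMap.id (Finsupp.linearCombination_id_surjective R M)
  exact (exteriorPower.map_injective (n := 2) _ hs).moduleIsTorsionFree _ (map_smul _)

theorem exists_smul_eq_add {j : M →ₗ[R] K × K} (hj : Function.Injective j)
    (h : IsLat (LinearMap.range j)) {x y : M} (hxy : det2 (j x) (j y) ≠ 0) (m : M) :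
    ∃ r : R, r ≠ 0 ∧ ∃ a b : R, r • m = a • x + b • y := by
  obtain ⟨j', hj', h', hx, hy⟩ := exists_embedding_basis hj h hxy
  obtain ⟨r, hr, a, ha⟩ := exists_smul_eq_algebraMap (R := R) (j' m).1
  obtain ⟨s, hs, b, hb⟩ := exists_smul_eq_algebraMap (R := R) (j' m).2
  refine ⟨r * s, mul_ne_zero hr hs, s * a, r * b, hj' ?_⟩
  rw [Algebra.smul_def] at ha hb
  rw [map_smul, map_add, map_smul, map_smul, hx, hy]
  ext
  · simp [fst_smul_prod, Algebra.smul_def, ← ha]; ring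
  · simp [snd_smul_prod, Algebra.smul_def, ← hb]; ring

theorem rankOneAt_wedge {j : M →ₗ[R] K × K} (hj : Function.Injective j)
    (h : IsLat (LinearMap.range j)) {x y : M} (hxy : det2 (j x) (j y) ≠ 0) :
    RankOneAt R (wedge R x y) := by
  refine .of_span (span_wedge R M) ?_
  rintro _ ⟨m, m', rfl⟩
  obtain ⟨r, hr, a, b, h1⟩ := exists_smul_eq_add hj h hxy m
  obtain ⟨s, hs, c, d, h2⟩ := exists_smul_eq_add hj h hxy m'
  refine ⟨r * s, mul_ne_zero hr hs, a * d - b * c, ?_⟩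
  rw [mul_smul, ← wedge_smul_right, ← wedge_smul_left, h1, h2]
  simp only [wedge_add_left, wedge_add_right, wedge_smul_left, wedge_smul_right, wedge_self,
    wedge_anticomm y x]
  module

/-- Λ² M is torsion-free and commensurable with R (x ∧ y), on which the determinant does not vanish.
Hence equalities in Λ² M can be tested on determinants. -/
theorem detMap_injective {j : M →ₗ[R] K × K} (hj : Function.Injective j)
    (h : IsLat (LinearMap.range j)) : Function.Injective (detMap j) := by
  have := projective_of_isLat h
  have : Module.Projective R M := Module.Projective.of_equiv (LinearEquiv.ofInjective j hj).symm
  have := isTorsionFree_exterior (R := R) (M := M)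
  obtain ⟨x, y, hxy⟩ := smul_det2_ne h
  exact (rankOneAt_wedge hj h hxy).injective _ (by rwa [detMap_wedge])

/-- Any linear map from `Λ² M` to `K` is a multiple of the determinant. -/
theorem map_mul_det2 {j : M →ₗ[R] K × K} (hj : Function.Injective j)
    (h : IsLat (LinearMap.range j)) (f : ⋀[R]^2 M →ₗ[R] K) (x y : M) (w : ⋀[R]^2 M) :
    f w * det2 (j x) (j y) = f (wedge R x y) * detMap j w := by
  obtain ⟨u, v, huv⟩ := smul_det2_ne h
  have h0 := (rankOneAt_wedge hj h huv)
  have e1 := h0.map_mul_map f (detMap j) w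
  have e2 := h0.map_mul_map f (detMap j) (wedge R x y)
  rw [detMap_wedge] at e1 e2
  rw [detMap_wedge] at e2
  refine mul_right_cancel₀ huv ?_
  linear_combination det2 (j x) (j y) * e1 - detMap j w * e2

/-- The `K`-linear extension of `detMap`. -/
noncomputable def detMapK (j : M →ₗ[R] K × K) : K ⊗[R] ⋀[R]^2 M →ₗ[K] K :=
  LinearMap.liftBaseChange K (detMap j)

theorem detMapK_tmul (j : M →ₗ[R] K × K) (c : K) (w : ⋀[R]^2 M) :
    detMapK j (c ⊗ₜ w) = c * detMap j w := by
  simp [detMapK]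

theorem detMapK_injective {j : M →ₗ[R] K × K} (hj : Function.Injective j)
    (h : IsLat (LinearMap.range j)) : Function.Injective (detMapK j) := by
  refine (injective_iff_map_eq_zero _).2 fun z hz => ?_
  obtain ⟨⟨w, r⟩, hw⟩ := IsLocalizedModule.surj R⁰ (TensorProduct.mk R K (⋀[R]^2 M) 1) z
  have h1 : detMapK j (r • z) = 0 := by
    rw [Submonoid.smul_def, ← algebraMap_smul K, map_smul, hz, smul_zero]
  rw [hw, TensorProduct.mk_apply, detMapK_tmul, one_mul] at h1
  rw [(map_eq_zero_iff _ (detMap_injective hj h)).1 h1, map_zero, Submonoid.smul_def,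
    ← algebraMap_smul K] at hw
  exact (smul_eq_zero_iff_right (by simpa using nonZeroDivisors.ne_zero r.2)).1 hw

/-- The image of `𝔞⁻¹ · Λ² M` in `K`. -/
theorem map_twist (𝔞 : (FractionalIdeal R⁰ K)ˣ) (j : M →ₗ[R] K × K) :
    (twist 𝔞 M).map ((detMapK j).restrictScalars R) =
      idealModule 𝔞⁻¹ * volN (LinearMap.range j) := by
  rw [twist, Submodule.map_span, ← range_detMap]
  apply le_antisymm
  · refine Submodule.span_le.2 ?_
    rintro _ ⟨_, ⟨c, hc, w, rfl⟩, rfl⟩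
    simp only [LinearMap.coe_restrictScalars, detMapK_tmul, SetLike.mem_coe]
    exact Submodule.mul_mem_mul hc ⟨w, rfl⟩
  · refine Submodule.mul_le.2 ?_
    rintro c hc _ ⟨w, rfl⟩
    refine Submodule.subset_span ⟨_, ⟨c, hc, w, rfl⟩, ?_⟩
    simp [detMapK_tmul]

/-- Primitivity means that the values span the target; since `detMapK` is injective, this may be
compared inside `K`, where it becomes an equality of fractional ideals. -/
theorem isPrimitive_iff {𝔞 : (FractionalIdeal R⁰ K)ˣ} {j : M →ₗ[R] K × K}
    (hj : Function.Injective j) (h : IsLat (LinearMap.range j))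
    (φ : QuadraticMap R M (twist 𝔞 M)) :
    IsPrimitive φ ↔ Submodule.span R (Set.range fun x => detMapK j (φ x : K ⊗[R] ⋀[R]^2 M)) =
      idealModule 𝔞⁻¹ * volN (LinearMap.range j) := by
  have h1 : IsPrimitive φ ↔ Submodule.span R (Set.range φ) = ⊤ := by
    constructor
    · exact fun h => h _ fun x => Submodule.subset_span ⟨x, rfl⟩
    · intro h N hN
      rw [eq_top_iff, ← h]
      refine Submodule.span_le.2 ?_
      rintro _ ⟨x, rfl⟩
      exact hN x
  let f : twist 𝔞 M →ₗ[R] K := ((detMapK j).restrictScalars R).comp (twist 𝔞 M).subtype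
  have hf : Function.Injective f := (detMapK_injective hj h).comp Subtype.val_injective
  rw [h1, ← map_twist, ← (Submodule.map_injective_of_injective hf).eq_iff, Submodule.map_span,
    ← Set.range_comp, Submodule.map_top, LinearMap.range_comp, Submodule.range_subtype]
  rfl

end Lattices

/-! ### Coordinates on an oriented quadratic algebra. -/

section Coordinates

variable {R K : Type u} [CommRing R] [IsDedekindDomain R] [Field K] [Algebra R K]
  [IsFractionRing R K] {𝔞 : (FractionalIdeal R⁰ K)ˣ}
  {S : Type u} [CommRing S] [Algebra R S]

/-- A fractional ideal of `R` as an invertible submodule of `K`. -/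
noncomputable def idealUnit (𝔞 : (FractionalIdeal R⁰ K)ˣ) : (Submodule R K)ˣ :=
  Units.map (FractionalIdeal.coeSubmoduleHom R⁰ K).toMonoidHom 𝔞

theorem val_idealUnit (𝔞 : (FractionalIdeal R⁰ K)ˣ) : (idealUnit 𝔞).val = idealModule 𝔞 := rfl

theorem val_inv_idealUnit (𝔞 : (FractionalIdeal R⁰ K)ˣ) :
    ((idealUnit 𝔞)⁻¹ : (Submodule R K)ˣ).val = idealModule 𝔞⁻¹ := rfl

theorem volK_tmul (α : ⋀[R]^2 S ≃ₗ[R] idealModule 𝔞) (s t : S) (c d : K) :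
    volK α (s ⊗ₜ c) (t ⊗ₜ d) = vol α s t * (c * d) := rfl

theorem vol_apply (α : ⋀[R]^2 S ≃ₗ[R] idealModule 𝔞) (s t : S) :
    vol α s t = (α (wedge R s t) : K) := rfl

/-- Coordinates on an oriented quadratic algebra: an isomorphism of `S_K` with `K ⊕ K ω`, where
`ω` satisfies a quadratic equation, such that `S = R ⊕ 𝔞 ω` and `α (1 ∧ ω) = 1`. -/
structure Coords (α : ⋀[R]^2 S ≃ₗ[R] idealModule 𝔞) where
  p : K
  q : K
  ψ : Total (R := R) K S ≃+* QuadraticAlgebra K p q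
  ψ_one_tmul : ∀ k : K, ψ ((1 : S) ⊗ₜ[R] k) = ⟨k, 0⟩
  volK_eq : ∀ x y, volK α x y = (ψ x).re * (ψ y).im - (ψ x).im * (ψ y).re
  mem_iff : ∀ z, (∃ s : S, ψ (s ⊗ₜ[R] (1 : K)) = z) ↔
    z.re ∈ (1 : Submodule R K) ∧ z.im ∈ idealModule 𝔞
  tmul_one_injective : Function.Injective fun s : S => s ⊗ₜ[R] (1 : K)

theorem exists_smul_eq_tmul_one (x : Total (R := R) K S) :
    ∃ r : R, r ≠ 0 ∧ ∃ s : S, r • x = s ⊗ₜ[R] (1 : K) := by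
  induction x using TensorProduct.induction_on with
  | zero => exact ⟨1, one_ne_zero, 0, by simp⟩
  | tmul s c =>
    obtain ⟨r, hr, a, ha⟩ := exists_smul_eq_algebraMap (R := R) c
    refine ⟨r, hr, a • s, ?_⟩
    rw [← TensorProduct.tmul_smul, ha, TensorProduct.smul_tmul, Algebra.algebraMap_eq_smul_one]
  | add x y hx hy =>
    obtain ⟨r, hr, s, h1⟩ := hx
    obtain ⟨r', hr', s', h2⟩ := hy
    refine ⟨r * r', mul_ne_zero hr hr', r' • s + r • s', ?_⟩
    rw [TensorProduct.add_tmul, ← TensorProduct.smul_tmul', ← TensorProduct.smul_tmul', ← h1, ← h2,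
      smul_add, mul_comm, mul_smul, mul_comm, mul_smul]

/-- Start from an embedding with 1 ↦ (1, 0). Rescaling the second coordinate makes the determinant
equal to α, and a shear, which fixes (1, 0) and determinants, splits the image. The two summands
then have product α(Λ² S) = 𝔞. -/
theorem exists_coordinate_map [IsRankTwoLattice R S] (α : ⋀[R]^2 S ≃ₗ[R] idealModule 𝔞) :
    ∃ j : S →ₗ[R] K × K, Function.Injective j ∧ j 1 = (1, 0) ∧
      (∀ s t, det2 (j s) (j t) = vol α s t) ∧
      ∃ 𝔟 𝔠 : (Submodule R K)ˣ, 𝔟 * 𝔠 = idealUnit 𝔞 ∧ ∀ v : K × K,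
        (∃ s, j s = v) ↔ v.1 ∈ 𝔟.val ∧ v.2 ∈ 𝔠.val := by
  obtain ⟨j, hj, hL⟩ := exists_embedding R K S
  obtain ⟨x, y, hxy⟩ := smul_det2_ne hL
  -- If 1 were parallel to both x and y it would vanish, and S would be the zero ring.
  obtain ⟨τ, hτ⟩ : ∃ τ, det2 (j 1) (j τ) ≠ 0 := by
    by_contra! h
    have h1 := h x
    have h2 := h y
    have h3 : j 1 = 0 := by
      simp only [det2] at h1 h2 hxy
      ext
      · refine (mul_eq_zero_iff_left hxy).1 ?_
        linear_combination (j x).1 * h2 - (j y).1 * h1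
      · refine (mul_eq_zero_iff_left hxy).1 ?_
        linear_combination (j x).2 * h2 - (j y).2 * h1
    have h4 : (1 : S) = 0 := (map_eq_zero_iff j hj).1 h3
    refine hxy ?_
    rw [← one_mul x, h4, zero_mul, map_zero]
    simp [det2]
  obtain ⟨j, hj, hL, h1, hτ⟩ := exists_embedding_basis hj hL hτ
  have hvol : ∀ s t, vol α s t = vol α 1 τ * det2 (j s) (j t) := by
    intro s t
    have := map_mul_det2 hj hL ((idealModule 𝔞).subtype.comp (α : _ →ₗ[R] idealModule 𝔞)) 1 τ
      (wedge R s t)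
    rw [h1, hτ, detMap_wedge] at this
    rw [vol_apply, vol_apply]
    simpa [det2] using this
  have hd : vol α 1 τ ≠ 0 := by
    rw [vol_apply, Ne, ZeroMemClass.coe_eq_zero, LinearEquiv.map_eq_zero_iff,
      ← map_eq_zero_iff _ (detMap_injective hj hL), detMap_wedge, h1, hτ]
    simp [det2]
  -- The factor α(1 ∧ τ) corrects the determinant. The shear k stays free for now, since the value
  -- that splits the image is read off from the lattice for k = 0.
  let L (k : K) : S →ₗ[R] K × K :=
    { toFun := fun s => ((j s).1 - k * (vol α 1 τ * (j s).2), vol α 1 τ * (j s).2)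
      map_add' := fun s t => by ext <;> simp <;> ring
      map_smul' := fun r s => by
        rw [map_smul, RingHom.id_apply]
        ext
        · simp only [fst_smul_prod, snd_smul_prod]; ring
        · simp only [snd_smul_prod]; ring }
  have hLdet : ∀ k s t, det2 (L k s) (L k t) = vol α s t := by
    intro k s t
    rw [hvol]
    simp only [L, det2, LinearMap.coe_mk, AddHom.coe_mk]
    ring
  have hLinj : ∀ k, Function.Injective (L k) := by
    intro k
    refine (injective_iff_map_eq_zero _).2 fun s hs => (map_eq_zero_iff j hj).1 ?_
    have e1 := congrArg Prod.fst hs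
    have e2 := congrArg Prod.snd hs
    simp only [L, LinearMap.coe_mk, AddHom.coe_mk, Prod.fst_zero, Prod.snd_zero] at e1 e2
    rw [e2, mul_zero, sub_zero] at e1
    exact Prod.ext e1 ((mul_eq_zero_iff_left hd).1 e2)
  have := IsRankTwoLattice.finite (R := R) (M := S)
  have hLat : ∀ k, IsLat (LinearMap.range (L k)) := fun k =>
    ⟨Module.Finite.iff_fg.1 inferInstance, _, ⟨1, rfl⟩, _, ⟨τ, rfl⟩, by rwa [hLdet]⟩
  obtain ⟨k, 𝔟, 𝔠, hk⟩ := (hLat 0).decomp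
  have hk' : ∀ v : K × K, (∃ s, L k s = v) ↔ v.1 ∈ 𝔟.val ∧ v.2 ∈ 𝔠.val := by
    intro v
    have := hk (v.1 + k * v.2, v.2)
    rw [add_sub_cancel_right] at this
    rw [← this]
    refine exists_congr fun s => ?_
    simp only [L, LinearMap.coe_mk, AddHom.coe_mk, Prod.ext_iff]
    constructor
    · rintro ⟨e1, e2⟩
      exact ⟨by linear_combination e1 + k * e2, e2⟩
    · rintro ⟨e1, e2⟩
      exact ⟨by linear_combination e1 - k * e2, e2⟩
  have hvolN : volN (LinearMap.range (L k)) = idealModule 𝔞 := by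
    rw [← range_detMap]
    have e : detMap (L k) = (idealModule 𝔞).subtype.comp (α : _ →ₗ[R] idealModule 𝔞) := by
      refine LinearMap.ext_on (span_wedge R S) ?_
      rintro _ ⟨s, t, rfl⟩
      rw [detMap_wedge, hLdet]
      rfl
    rw [e, LinearMap.range_comp, LinearEquiv.range, Submodule.map_top, Submodule.range_subtype]
  have h1' : L k 1 = (1, 0) := by simp [L, h1]
  rw [volN_eq (k := 0) (𝔟 := 𝔟) (𝔠 := 𝔠) (fun v => by simpa using hk' v)] at hvolN
  exact ⟨L k, hLinj k, h1', hLdet k, 𝔟, 𝔠, Units.ext hvolN, hk'⟩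

/-- The first summand 𝔟 is S ∩ K: it contains 1 and is closed under multiplication, and a fractional
ideal of this kind is R. The other summand is therefore 𝔞. The multiplication is determined by the
square of a single element outside K. -/
theorem exists_coords [IsRankTwoLattice R S] (α : ⋀[R]^2 S ≃ₗ[R] idealModule 𝔞) :
    Nonempty (Coords α) := by
  obtain ⟨j, hj, h1, hdet, 𝔟, 𝔠, hbc, hj'⟩ := exists_coordinate_map (K := K) α
  obtain ⟨e, he, he0⟩ := exists_ne_zero_mem 𝔠
  obtain ⟨τ, hτ⟩ := (hj' (0, e)).2 ⟨zero_mem _, he⟩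
  -- Here ω = τ / e, so ω² = p + qω means τ² = e²p + e²qω.
  obtain ⟨p, q, hpq⟩ : ∃ p q : K, j (τ * τ) = (p * e ^ 2, q * e ^ 2) :=
    ⟨(j (τ * τ)).1 / e ^ 2, (j (τ * τ)).2 / e ^ 2, by ext <;> simp [he0]⟩
  have hs : ∀ s, ∃ r : R, r ≠ 0 ∧ ∃ a b : R, r • s = a • 1 + b • τ := by
    intro s
    obtain ⟨r, hr, a, ha⟩ := exists_smul_eq_algebraMap (R := R) (j s).1
    obtain ⟨r', hr', b, hb⟩ := exists_smul_eq_algebraMap (R := R) ((j s).2 / e)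
    refine ⟨r * r', mul_ne_zero hr hr', r' * a, r * b, hj ?_⟩
    rw [Algebra.smul_def] at ha hb
    rw [map_smul, map_add, map_smul, map_smul, h1, hτ]
    ext
    · simp only [fst_smul_prod, Prod.fst_add, map_mul, ← ha]; ring
    · simp only [snd_smul_prod, Prod.snd_add, map_mul, ← hb]; field_simp; ring
  have hmul : ∀ s t, j (s * t) = ((j s).1 * (j t).1 + p * (j s).2 * (j t).2,
      (j s).1 * (j t).2 + (j s).2 * (j t).1 + q * (j s).2 * (j t).2) := by
    intro s t
    obtain ⟨r, hr, a, b, hab⟩ := hs s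
    obtain ⟨r', hr', c, d, hcd⟩ := hs t
    have hr1 : algebraMap R K r ≠ 0 := by simpa using hr
    have hr2 : algebraMap R K r' ≠ 0 := by simpa using hr'
    have e1 := congrArg j hab
    have e2 := congrArg j hcd
    have e3 : (r * r') • (s * t) = (a * c) • 1 + (a * d + b * c) • τ + (b * d) • (τ * τ) := by
      rw [mul_smul, ← mul_smul_comm, ← smul_mul_assoc, hab, hcd]
      simp only [Algebra.smul_def, map_mul, map_add]; ring
    replace e3 := congrArg j e3
    simp only [map_add, map_smul, h1, hτ, hpq] at e1 e2 e3
    have e1a := congrArg Prod.fst e1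
    have e1b := congrArg Prod.snd e1
    have e2a := congrArg Prod.fst e2
    have e2b := congrArg Prod.snd e2
    have e3a := congrArg Prod.fst e3
    have e3b := congrArg Prod.snd e3
    simp only [fst_smul_prod, snd_smul_prod, Prod.fst_add, Prod.snd_add, mul_one, mul_zero,
      add_zero, zero_add, map_mul, map_add] at e1a e1b e2a e2b e3a e3b
    ext
    · refine mul_left_cancel₀ (mul_ne_zero hr1 hr2) ?_
      rw [e3a]
      linear_combination -(algebraMap R K r' * (j t).1) * e1a - algebraMap R K a * e2a -
        p * (algebraMap R K r' * (j t).2) * e1b - p * algebraMap R K b * e * e2b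
    · refine mul_left_cancel₀ (mul_ne_zero hr1 hr2) ?_
      rw [e3b]
      linear_combination -(algebraMap R K r' * (j t).2) * e1a - algebraMap R K a * e2b -
        (algebraMap R K r' * (j t).1) * e1b - algebraMap R K b * e * e2a -
        q * (algebraMap R K r' * (j t).2) * e1b - q * algebraMap R K b * e * e2b
  have hb : 𝔟 = 1 := by
    have h11 : (1 : K) ∈ 𝔟.val := by
      simpa using ((hj' (1, 0)).1 ⟨1, h1⟩).1
    apply Units.ext
    apply le_antisymm
    · intro x hx
      refine mem_one_of_forall_mul (𝔟 := 𝔟) fun y hy => ?_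
      obtain ⟨s, hs⟩ := (hj' (x, 0)).2 ⟨hx, zero_mem _⟩
      obtain ⟨t, ht⟩ := (hj' (y, 0)).2 ⟨hy, zero_mem _⟩
      have := ((hj' _).1 ⟨s * t, rfl⟩).1
      rw [hmul, hs, ht] at this
      simpa using this
    · intro x hx
      obtain ⟨r, rfl⟩ := Submodule.mem_one.1 hx
      rw [Algebra.algebraMap_eq_smul_one]
      exact Submodule.smul_mem _ _ h11
  rw [hb, one_mul] at hbc
  let f : S →ₐ[R] QuadraticAlgebra K p q := AlgHom.ofLinearMap
    { toFun := fun s => ⟨(j s).1, (j s).2⟩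
      map_add' := fun s t => by ext <;> simp
      map_smul' := fun r s => by
        rw [map_smul, RingHom.id_apply]
        ext <;> rfl }
    (by ext <;> simp [h1] <;> rfl) (fun s t => by ext <;> simp [hmul])
  let g : K →ₐ[R] QuadraticAlgebra K p q := IsScalarTower.toAlgHom R K _
  let F := Algebra.TensorProduct.productMap f g
  have hF : ∀ s c, F (s ⊗ₜ c) = ⟨c * (j s).1, c * (j s).2⟩ := by
    intro s c
    rw [Algebra.TensorProduct.productMap_apply_tmul]
    ext <;> simp [f, g, QuadraticAlgebra.algebraMap_eq, mul_comm]
  have hbij : Function.Bijective F := by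
    constructor
    · refine (injective_iff_map_eq_zero F).2 fun x hx => ?_
      obtain ⟨r, hr, s, hs⟩ := exists_smul_eq_tmul_one x
      have h2 : F (s ⊗ₜ 1) = 0 := by rw [← hs, map_smul, hx, smul_zero]
      rw [hF, one_mul, one_mul] at h2
      have h3 : s = 0 := by
        refine (map_eq_zero_iff j hj).1 ?_
        ext
        · exact congrArg QuadraticAlgebra.re h2
        · exact congrArg QuadraticAlgebra.im h2
      rw [h3, TensorProduct.zero_tmul] at hs
      have hr1 : algebraMap R K r ≠ 0 := by simpa using hr
      calc x = ((1 : S) ⊗ₜ[R] ((algebraMap R K r)⁻¹)) * (r • x) := by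
            rw [Algebra.smul_def, ← mul_assoc, Algebra.TensorProduct.algebraMap_apply',
              Algebra.TensorProduct.tmul_mul_tmul, inv_mul_cancel₀ hr1, mul_one,
              ← Algebra.TensorProduct.one_def, one_mul]
        _ = 0 := by rw [hs, mul_zero]
    · rintro ⟨a, b⟩
      refine ⟨1 ⊗ₜ a + τ ⊗ₜ (b / e), ?_⟩
      rw [map_add, hF, hF, h1, hτ]
      ext <;> simp [he0]
  let ψ : Total (R := R) K S ≃+* QuadraticAlgebra K p q := RingEquiv.ofBijective F hbij
  have hψ : ∀ x, ψ x = F x := fun _ => rfl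
  refine ⟨⟨p, q, ψ, fun k => ?_, fun x y => ?_, fun z => ?_, fun s t hst => ?_⟩⟩
  · rw [hψ, hF, h1]; ext <;> simp
  · rw [hψ, hψ]
    induction x using TensorProduct.induction_on with
    | zero => simp
    | add x x' hx hx' =>
      rw [map_add, LinearMap.add_apply, hx, hx', map_add]; simp; ring
    | tmul s c =>
      induction y using TensorProduct.induction_on with
      | zero => simp
      | add y y' hy hy' => rw [map_add, hy, hy', map_add]; simp; ring
      | tmul t d =>
        rw [volK_tmul, hF, hF, ← hdet]; simp only [det2]; ring
  · have := hj' (z.re, z.im)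
    rw [hb, hbc] at this
    rw [Units.val_one] at this
    rw [← val_idealUnit, ← this]
    refine exists_congr fun s => ?_
    rw [hψ, hF]
    simp [QuadraticAlgebra.ext_iff, Prod.ext_iff]
  · have h2 : F (s ⊗ₜ 1) = F (t ⊗ₜ 1) := congrArg F hst
    rw [hF, hF, one_mul, one_mul, one_mul, one_mul] at h2
    refine hj ?_
    ext
    · exact congrArg QuadraticAlgebra.re h2
    · exact congrArg QuadraticAlgebra.im h2

end Coordinates

/-! ### Norm and index of an ideal of the quadratic algebra. -/

section FractionalIdeals

variable {R K : Type u} [CommRing R] [IsDedekindDomain R] [Field K] [Algebra R K]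
  [IsFractionRing R K] {𝔞 : (FractionalIdeal R⁰ K)ˣ}
  {S : Type u} [CommRing S] [Algebra R S] {α : ⋀[R]^2 S ≃ₗ[R] idealModule 𝔞}

namespace Coords

variable (c : Coords α)

theorem smul_eq (s : S) (x : Total (R := R) K S) : s • x = (s ⊗ₜ[R] (1 : K)) * x := by
  rw [Algebra.smul_def]; rfl

theorem ψ_algebraMap (r : R) : c.ψ (algebraMap R _ r) = ⟨algebraMap R K r, 0⟩ := by
  rw [Algebra.TensorProduct.algebraMap_apply', c.ψ_one_tmul]

theorem ψ_smul (r : R) (x : Total (R := R) K S) :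
    c.ψ (r • x) = ⟨algebraMap R K r * (c.ψ x).re, algebraMap R K r * (c.ψ x).im⟩ := by
  rw [Algebra.smul_def, map_mul, c.ψ_algebraMap]
  ext <;> simp

/-- The coordinates as an embedding of `S_K` in the plane. -/
noncomputable def emb : Total (R := R) K S →ₗ[R] K × K where
  toFun x := ((c.ψ x).re, (c.ψ x).im)
  map_add' x y := by simp
  map_smul' r x := by rw [c.ψ_smul]; ext <;> simp [Algebra.smul_def]

theorem emb_injective : Function.Injective c.emb := by
  intro x y h
  apply c.ψ.injective
  ext
  · exact congrArg Prod.fst h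
  · exact congrArg Prod.snd h

theorem det2_emb (x y : Total (R := R) K S) : det2 (c.emb x) (c.emb y) = volK α x y :=
  (c.volK_eq x y).symm

/-- The image in the plane of an ideal. -/
noncomputable def lat (I : Submodule S (Total (R := R) K S)) : Submodule R (K × K) :=
  (I.restrictScalars R).map c.emb

/-- The norm of an element of `S_K`. -/
def nrm (x : Total (R := R) K S) : K := (c.ψ x).norm

theorem nrm_eq (x : Total (R := R) K S) :
    c.nrm x = (c.ψ x).re * (c.ψ x).re + c.q * (c.ψ x).re * (c.ψ x).im -
      c.p * (c.ψ x).im * (c.ψ x).im := QuadraticAlgebra.norm_def _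

theorem nrm_mul (x y : Total (R := R) K S) : c.nrm (x * y) = c.nrm x * c.nrm y := by
  rw [nrm, map_mul, map_mul]; rfl

theorem nrm_one : c.nrm 1 = 1 := by
  rw [nrm, map_one, map_one]

theorem isUnit_iff (x : Total (R := R) K S) : IsUnit x ↔ c.nrm x ≠ 0 := by
  rw [nrm, ← isUnit_iff_ne_zero, ← QuadraticAlgebra.isUnit_iff_norm_isUnit, MulEquiv.isUnit_map]

/-- The conjugate of an element of `S_K`. -/
noncomputable def conj (x : Total (R := R) K S) : Total (R := R) K S := c.ψ.symm (star (c.ψ x))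

theorem ψ_conj (x : Total (R := R) K S) : c.ψ (c.conj x) = star (c.ψ x) :=
  c.ψ.apply_symm_apply _

theorem mul_conj (x : Total (R := R) K S) : x * c.conj x = (1 : S) ⊗ₜ[R] c.nrm x := by
  apply c.ψ.injective
  rw [map_mul, ψ_conj, c.ψ_one_tmul, nrm_eq]
  ext <;> simp <;> ring

theorem conj_mul (x y : Total (R := R) K S) : c.conj (x * y) = c.conj x * c.conj y := by
  apply c.ψ.injective
  rw [map_mul, ψ_conj, ψ_conj, ψ_conj, map_mul, star_mul']

/-- The norms of the elements of an ideal. -/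
def nI (I : Submodule S (Total (R := R) K S)) : Submodule R K :=
  Submodule.span R {k | ∃ x ∈ I, k = c.nrm x}

/-- The index of an ideal relative to `S`. -/
noncomputable def vI (I : Submodule S (Total (R := R) K S)) : Submodule R K :=
  idealModule 𝔞⁻¹ * volN (c.lat I)

variable {I J : Submodule S (Total (R := R) K S)}

theorem nrm_mem {x : Total (R := R) K S} (hx : x ∈ I) : c.nrm x ∈ c.nI I :=
  Submodule.subset_span ⟨x, hx, rfl⟩

theorem idealModule_mul_inv (𝔞 : (FractionalIdeal R⁰ K)ˣ) :
    idealModule 𝔞 * idealModule 𝔞⁻¹ = 1 := (idealUnit 𝔞).mul_inv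

theorem idealModule_inv_mul (𝔞 : (FractionalIdeal R⁰ K)ˣ) :
    idealModule 𝔞⁻¹ * idealModule 𝔞 = 1 := (idealUnit 𝔞).inv_mul

theorem mul_vI (I : Submodule S (Total (R := R) K S)) :
    idealModule 𝔞 * c.vI I = volN (c.lat I) := by
  rw [vI, ← mul_assoc, idealModule_mul_inv, one_mul]

theorem volK_mem {x y : Total (R := R) K S} (hx : x ∈ I) (hy : y ∈ I) :
    volK α x y ∈ volN (c.lat I) := by
  rw [← c.det2_emb]
  exact det2_mem_volN (Submodule.mem_map_of_mem hx) (Submodule.mem_map_of_mem hy)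

theorem mem_one_iff {x : Total (R := R) K S} : x ∈ (1 : Submodule S (Total (R := R) K S)) ↔
    (c.ψ x).re ∈ (1 : Submodule R K) ∧ (c.ψ x).im ∈ idealModule 𝔞 := by
  rw [← c.mem_iff, Submodule.mem_one]
  exact exists_congr fun s => c.ψ.injective.eq_iff.symm

theorem _root_.BhargavaBox.mem_inv_mul {𝔟 : (Submodule R K)ˣ} {N : Submodule R K} {x : K}
    (h : ∀ a ∈ 𝔟.val, a * x ∈ N) : x ∈ (𝔟⁻¹ : (Submodule R K)ˣ).val * N := by
  have h1 : (1 : K) ∈ (𝔟⁻¹ : (Submodule R K)ˣ).val * 𝔟.val := by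
    rw [Units.inv_mul]; exact Submodule.mem_one.2 ⟨1, map_one _⟩
  rw [← one_mul x]
  generalize (1 : K) = z at h1
  induction h1 using Submodule.mul_induction_on' with
  | mem_mul_mem m hm n hn => rw [mul_assoc]; exact Submodule.mul_mem_mul hm (h n hn)
  | add a _ b _ ha hb => rw [add_mul]; exact add_mem ha hb

theorem mem_of_forall_mul {N : Submodule R K} {x : K}
    (h : ∀ a ∈ idealModule 𝔞, a * x ∈ N) : x ∈ idealModule 𝔞⁻¹ * N :=
  mem_inv_mul (𝔟 := idealUnit 𝔞) h

theorem exists_ω {a : K} (ha : a ∈ idealModule 𝔞) : ∃ s : S, c.ψ (s ⊗ₜ[R] (1 : K)) = ⟨0, a⟩ :=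
  (c.mem_iff _).2 ⟨zero_mem _, ha⟩

/-- The ω-coordinate of (aω)(bω) is qab, and it must lie in 𝔞 for every b ∈ 𝔞; so multiplication by
qa preserves 𝔞. In other words, aω has integral trace. -/
theorem q_mul_mem {a : K} (ha : a ∈ idealModule 𝔞) : c.q * a ∈ (1 : Submodule R K) := by
  refine mem_one_of_forall_mul (𝔟 := idealUnit 𝔞) fun b hb => ?_
  obtain ⟨s, hs⟩ := c.exists_ω ha
  obtain ⟨t, ht⟩ := c.exists_ω hb
  have h := ((c.mem_iff _).1 ⟨s * t, rfl⟩).2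
  have h1 : (s * t) ⊗ₜ[R] (1 : K) = (s ⊗ₜ[R] (1 : K)) * (t ⊗ₜ[R] (1 : K)) := by simp
  rw [h1, map_mul, hs, ht] at h
  simpa [mul_assoc, val_idealUnit] using h

theorem conj_mem_one {x : Total (R := R) K S} (hx : x ∈ (1 : Submodule S (Total (R := R) K S))) :
    c.conj x ∈ (1 : Submodule S (Total (R := R) K S)) := by
  rw [c.mem_one_iff] at hx ⊢
  rw [ψ_conj]
  exact ⟨by simpa using add_mem hx.1 (c.q_mul_mem hx.2), by simpa using hx.2⟩

/-- The product x̄y packs the norm and the orientation together: its ω-coordinate is α(x ∧ y), and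
for y = x it is N(x). -/
theorem im_conj_mul (x y : Total (R := R) K S) : (c.ψ (c.conj x * y)).im = volK α x y := by
  rw [map_mul, ψ_conj, c.volK_eq]; simp; ring

/-- For a ∈ 𝔞 the identity α(x ∧ aωy) = a re(x̄y) + qa α(x ∧ y) expresses a re(x̄y) through volumes
of pairs in I, using that I is stable under aω ∈ S and that qa ∈ R. -/
theorem re_conj_mul_mem {x y : Total (R := R) K S} (hx : x ∈ I) (hy : y ∈ I) :
    (c.ψ (c.conj x * y)).re ∈ c.vI I := by
  refine mem_of_forall_mul fun a ha => ?_
  obtain ⟨s, hs⟩ := c.exists_ω ha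
  obtain ⟨r, hr⟩ := Submodule.mem_one.1 (c.q_mul_mem ha)
  have h1 := c.volK_mem hx (I.smul_mem s hy)
  have h2 := (volN (c.lat I)).smul_mem r (c.volK_mem hx hy)
  convert sub_mem h1 h2 using 1
  rw [Algebra.smul_def (A := K), hr, c.volK_eq, c.volK_eq, smul_eq, map_mul, map_mul, hs, ψ_conj]
  simp; ring

theorem nI_le_vI (I : Submodule S (Total (R := R) K S)) : c.nI I ≤ c.vI I := by
  refine Submodule.span_le.2 ?_
  rintro _ ⟨x, hx, rfl⟩
  have := c.re_conj_mul_mem hx hx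
  rwa [mul_comm, c.mul_conj, c.ψ_one_tmul] at this

theorem nI_mul_le (I J : Submodule S (Total (R := R) K S)) : c.nI I * c.nI J ≤ c.nI (I * J) := by
  rw [nI, nI, Submodule.span_mul_span]
  refine Submodule.span_le.2 ?_
  rintro _ ⟨_, ⟨x, hx, rfl⟩, _, ⟨y, hy, rfl⟩, rfl⟩
  change c.nrm x * c.nrm y ∈ c.nI (I * J)
  rw [← c.nrm_mul]
  exact c.nrm_mem (Submodule.mul_mem_mul hx hy)

/-- The conjugate of xy times x'y' is (x̄x')(ȳy'). Its ω-coordinate is a sum of products of real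
parts and volumes of the two factors, together with a term in q that 𝔞 makes integral. Invertibility
is not needed. -/
theorem volK_mul_mul_mem {x x' y y' : Total (R := R) K S} (hx : x ∈ I) (hx' : x' ∈ I) (hy : y ∈ J)
    (hy' : y' ∈ J) : volK α (x * y) (x' * y') ∈ idealModule 𝔞 * (c.vI I * c.vI J) := by
  have h1 := c.re_conj_mul_mem hx hx'
  have h2 := c.re_conj_mul_mem hy hy'
  have h3 := c.volK_mem hx hx'
  have h4 := c.volK_mem hy hy'
  rw [← mul_vI] at h3 h4
  have hq : Submodule.span R {c.q} * idealModule 𝔞 ≤ 1 := by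
    refine Submodule.mul_le.2 fun k hk a ha => ?_
    obtain ⟨r, rfl⟩ := Submodule.mem_span_singleton.1 hk
    rw [smul_mul_assoc]
    exact Submodule.smul_mem _ _ (c.q_mul_mem ha)
  rw [← c.im_conj_mul, conj_mul,
    show c.conj x * c.conj y * (x' * y') = (c.conj x * x') * (c.conj y * y') by ring, map_mul,
    QuadraticAlgebra.im_mul, c.im_conj_mul, c.im_conj_mul]
  refine add_mem (add_mem ?_ ?_) ?_
  · rw [show idealModule 𝔞 * (c.vI I * c.vI J) = c.vI I * (idealModule 𝔞 * c.vI J) by ring]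
    exact Submodule.mul_mem_mul h1 h4
  · rw [← mul_assoc]
    exact Submodule.mul_mem_mul h3 h2
  · have h5 := Submodule.mul_mem_mul
      (Submodule.mul_mem_mul (Submodule.mem_span_singleton_self (R := R) c.q) h3) h4
    have h6 : Submodule.span R {c.q} * (idealModule 𝔞 * c.vI I) * (idealModule 𝔞 * c.vI J) =
      (Submodule.span R {c.q} * idealModule 𝔞) * (idealModule 𝔞 * (c.vI I * c.vI J)) := by ring
    rw [h6] at h5
    have := mul_le_mul_left hq (idealModule 𝔞 * (c.vI I * c.vI J)) h5
    rwa [one_mul] at this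

theorem volK_mem_of_mem_mul {z z' : Total (R := R) K S} (hz : z ∈ I * J) (hz' : z' ∈ I * J) :
    volK α z z' ∈ idealModule 𝔞 * (c.vI I * c.vI J) := by
  induction hz using Submodule.mul_induction_on' with
  | add a _ b _ ha hb => rw [map_add, LinearMap.add_apply]; exact add_mem ha hb
  | mem_mul_mem x hx y hy =>
    induction hz' using Submodule.mul_induction_on' with
    | add a _ b _ ha hb => rw [map_add]; exact add_mem ha hb
    | mem_mul_mem x' hx' y' hy' => exact c.volK_mul_mul_mem hx hx' hy hy'

theorem vI_mul_le (I J : Submodule S (Total (R := R) K S)) :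
    c.vI (I * J) ≤ c.vI I * c.vI J := by
  have h : volN (c.lat (I * J)) ≤ idealModule 𝔞 * (c.vI I * c.vI J) := by
    rw [volN, Submodule.span_le]
    rintro _ ⟨_, ⟨z, hz, rfl⟩, _, ⟨z', hz', rfl⟩, rfl⟩
    rw [c.det2_emb]
    exact c.volK_mem_of_mem_mul hz hz'
  have h2 := mul_le_mul_right h (idealModule 𝔞⁻¹)
  rwa [← mul_assoc, idealModule_inv_mul, one_mul] at h2

theorem vI_one : c.vI 1 = 1 := by
  have h : volN (c.lat 1) = idealModule 𝔞 := by
    apply le_antisymm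
    · refine Submodule.span_le.2 ?_
      rintro _ ⟨_, ⟨z, hz, rfl⟩, _, ⟨z', hz', rfl⟩, rfl⟩
      obtain ⟨s, rfl⟩ := Submodule.mem_one.1 hz
      obtain ⟨t, rfl⟩ := Submodule.mem_one.1 hz'
      rw [c.det2_emb]
      change vol α s t * (1 * 1) ∈ idealModule 𝔞
      rw [one_mul, mul_one]
      exact (α _).2
    · intro a ha
      obtain ⟨s, hs⟩ := c.exists_ω ha
      have h := c.volK_mem (I := 1) (Submodule.mem_one.2 ⟨1, rfl⟩) (Submodule.mem_one.2 ⟨s, rfl⟩)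
      convert h using 1
      change _ = volK α 1 (s ⊗ₜ 1)
      rw [c.volK_eq, hs, map_one]
      change a = 1 * a - 0 * 0
      ring
  rw [vI, h, idealModule_inv_mul]

theorem exists_smul_mem_of_mem_mul {x : Total (R := R) K S} (hx : x ∈ I * J) :
    ∃ r : R, r ≠ 0 ∧ r • x ∈ I := by
  induction hx using Submodule.mul_induction_on' with
  | mem_mul_mem x hx y hy =>
    obtain ⟨r, hr, s, hs⟩ := exists_smul_eq_tmul_one y
    refine ⟨r, hr, ?_⟩
    rw [← mul_smul_comm, hs, mul_comm, ← smul_eq]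
    exact I.smul_mem s hx
  | add a _ b _ ha hb =>
    obtain ⟨r, hr, h1⟩ := ha
    obtain ⟨s, hs, h2⟩ := hb
    refine ⟨r * s, mul_ne_zero hr hs, ?_⟩
    rw [smul_add, mul_smul, mul_smul, smul_comm r s]
    exact add_mem ((I.restrictScalars R).smul_mem s h1) ((I.restrictScalars R).smul_mem r h2)

theorem exists_algebraMap_mem (I : InvIdeal R K S) :
    ∃ r : R, r ≠ 0 ∧ algebraMap R _ r ∈ (I : Submodule S (Total (R := R) K S)) := by
  have h : (1 : Total (R := R) K S) ∈ I.val * (I⁻¹ : InvIdeal R K S).val := by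
    rw [Units.mul_inv]; exact Submodule.mem_one.2 ⟨1, map_one _⟩
  obtain ⟨r, hr, h⟩ := exists_smul_mem_of_mem_mul h
  exact ⟨r, hr, by rwa [Algebra.algebraMap_eq_smul_one]⟩

theorem isLat [IsRankTwoLattice R S] (I : InvIdeal R K S) : IsLat (c.lat I.val) := by
  constructor
  · refine Submodule.FG.map _ ?_
    have := IsRankTwoLattice.finite (R := R) (M := S)
    have := Module.Finite.iff_fg.2 (Submodule.fg_unit I)
    exact Module.Finite.iff_fg.1 (Module.Finite.trans (R := R) S I.val)
  · obtain ⟨r, hr, h⟩ := exists_algebraMap_mem I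
    obtain ⟨a, ha, ha0⟩ := exists_ne_zero_mem (idealUnit 𝔞)
    obtain ⟨s, hs⟩ := c.exists_ω ha
    refine ⟨_, Submodule.mem_map_of_mem h, _, Submodule.mem_map_of_mem (I.val.smul_mem s h), ?_⟩
    rw [c.det2_emb, c.volK_eq, smul_eq, map_mul, hs, c.ψ_algebraMap]
    simp [hr, ha0]

/-- Invertible ideals give primitive forms. -/
theorem nI_eq_vI [IsRankTwoLattice R S] (I : InvIdeal R K S) : c.nI I.val = c.vI I.val := by
  refine le_antisymm (c.nI_le_vI _) ?_
  -- Thus I = 𝔟 ⊕ 𝔠θ with θ = k + ω, an element of trace 2k + q and norm k² + qk − p.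
  obtain ⟨k, 𝔟, 𝔠, h⟩ := (c.isLat I).decomp
  have hmem : ∀ x, x ∈ I.val ↔ (c.ψ x).re - k * (c.ψ x).im ∈ 𝔟.val ∧ (c.ψ x).im ∈ 𝔠.val := by
    intro x
    refine Iff.trans ?_ (h (c.emb x))
    constructor
    · exact fun hx => Submodule.mem_map_of_mem hx
    · rintro ⟨y, hy, hxy⟩; rwa [← c.emb_injective hxy]
  have hn : ∀ x ∈ 𝔟.val, ∀ y ∈ 𝔠.val,
      x * x + (2 * k + c.q) * (x * y) + (k ^ 2 + c.q * k - c.p) * (y * y) ∈ c.nI I.val := by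
    intro x hx y hy
    have hz : c.ψ.symm ⟨x + k * y, y⟩ ∈ I.val := by
      rw [hmem, RingEquiv.apply_symm_apply]
      exact ⟨by simpa using hx, hy⟩
    convert c.nrm_mem hz using 1
    rw [nrm_eq, RingEquiv.apply_symm_apply]
    ring
  obtain ⟨𝔫, h𝔫⟩ : IsUnit (c.nI I.val) := by
    refine isUnit_of_fg ?_ ?_
    · have h1 : (c.vI I.val).FG := by
        rw [vI, volN_eq h]
        exact Submodule.fg_unit ((idealUnit 𝔞)⁻¹ * (𝔟 * 𝔠))
      have := isNoetherian_of_fg_of_noetherian _ h1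
      have h2 : IsNoetherian R (c.nI I.val) := isNoetherian_of_le (c.nI_le_vI I.val)
      exact (Submodule.fg_top _).1 (h2.noetherian ⊤)
    · obtain ⟨x, hx, hx0⟩ := exists_ne_zero_mem 𝔟
      refine (Submodule.ne_bot_iff _).2 ⟨x * x, ?_, mul_ne_zero hx0 hx0⟩
      simpa using hn x hx 0 (zero_mem _)
  rw [← h𝔫] at hn ⊢
  -- The ideal 𝔫 of norms contains each term of the norm form x² + (2k + q)xy + (k² + qk − p)y²
  -- separately, and the square terms also in polarized form.
  have hxx : ∀ x ∈ 𝔟.val, ∀ x' ∈ 𝔟.val, x * x' ∈ 𝔫.val := fun x hx x' hx' => by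
    have := mul_mem_of_forall_sq (𝔟 := 𝔟) (𝔠 := 𝔫) (t := 1)
      (fun z hz => by simpa using hn z hz 0 (zero_mem _)) hx hx'
    simpa using this
  have hyy : ∀ x ∈ 𝔠.val, ∀ x' ∈ 𝔠.val, (k ^ 2 + c.q * k - c.p) * (x * x') ∈ 𝔫.val :=
    fun x hx x' hx' => mul_mem_of_forall_sq (𝔟 := 𝔠) (𝔠 := 𝔫)
      (fun z hz => by simpa using hn 0 (zero_mem _) z hz) hx hx'
  have hxy : ∀ x ∈ 𝔟.val, ∀ y ∈ 𝔠.val, (2 * k + c.q) * (x * y) ∈ 𝔫.val := fun x hx y hy => by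
    convert sub_mem (sub_mem (hn x hx y hy) (hxx x hx x hx)) (hyy y hy y hy) using 1
    ring
  have hdiv : ∀ {𝔡 𝔠 : (Submodule R K)ˣ} {l v : K}, l ∈ (𝔫⁻¹ * (𝔡 * 𝔠)).val →
      (∀ w ∈ 𝔡.val, w * v ∈ 𝔫.val) → l * v ∈ 𝔠.val := by
    intro 𝔡 𝔠 l v hl hv
    have h1 : v ∈ (𝔡⁻¹ * 𝔫).val := mem_inv_mul hv
    have h2 := mul_mem_units hl h1
    rwa [show 𝔫⁻¹ * (𝔡 * 𝔠) * (𝔡⁻¹ * 𝔫) = 𝔠 by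
      rw [mul_comm 𝔡 𝔠, mul_assoc, mul_assoc, mul_inv_cancel_left, mul_comm 𝔠,
        inv_mul_cancel_left]] at h2
  -- For l ∈ 𝔫⁻¹𝔟𝔠 the three memberships above make multiplication by lθ preserve I, by the equation
  -- of θ. As I is invertible, its only multipliers are the elements of S; so lθ ∈ S, and its
  -- ω-coordinate l lies in 𝔞.
  have key : (𝔫⁻¹ * (𝔟 * 𝔠)).val ≤ idealModule 𝔞 := by
    intro l hl
    have hlI : ∀ x ∈ I.val, c.ψ.symm ⟨l * k, l⟩ * x ∈ I.val := by
      intro x hx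
      rw [hmem] at hx ⊢
      obtain ⟨hx, hy⟩ := hx
      set y := (c.ψ x).im with hy'
      set z := (c.ψ x).re - k * y with hz'
      have hre : (c.ψ x).re = z + k * y := by rw [hz']; ring
      rw [map_mul, RingEquiv.apply_symm_apply, QuadraticAlgebra.re_mul, QuadraticAlgebra.im_mul,
        hre, ← hy']
      dsimp only
      constructor
      · have e : l * k * (z + k * y) + c.p * l * y - k * (l * k * y + l * (z + k * y) +
            c.q * l * y) = -(l * ((k ^ 2 + c.q * k - c.p) * y)) := by ring
        rw [e]
        refine neg_mem (hdiv (𝔠 := 𝔟) (𝔡 := 𝔠) (by rwa [mul_comm 𝔠]) fun w hw => ?_)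
        convert hyy w hw y hy using 1; ring
      · have e : l * k * y + l * (z + k * y) + c.q * l * y =
          l * z + l * ((2 * k + c.q) * y) := by ring
        rw [e]
        refine add_mem (hdiv (𝔡 := 𝔟) hl fun w hw => hxx w hw z hx)
          (hdiv (𝔡 := 𝔟) hl fun w hw => ?_)
        convert hxy w hw y hy using 1; ring
    have hl1 : c.ψ.symm ⟨l * k, l⟩ ∈ (1 : Submodule S (Total (R := R) K S)) := by
      have h1 : (1 : Total (R := R) K S) ∈ I.val * (I⁻¹ : InvIdeal R K S).val := by
        rw [Units.mul_inv]; exact Submodule.mem_one.2 ⟨1, map_one _⟩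
      rw [← I.mul_inv, ← mul_one (c.ψ.symm _)]
      generalize (1 : Total (R := R) K S) = w at h1
      induction h1 using Submodule.mul_induction_on' with
      | mem_mul_mem m hm n hn => rw [← mul_assoc]; exact Submodule.mul_mem_mul (hlI m hm) hn
      | add a _ b _ ha hb => rw [mul_add]; exact add_mem ha hb
    rw [c.mem_one_iff, RingEquiv.apply_symm_apply] at hl1
    exact hl1.2
  have h2 := mul_le_mul_left key (𝔫 * (idealUnit 𝔞)⁻¹).val
  rw [← val_idealUnit, ← Units.val_mul, ← Units.val_mul] at h2
  rw [vI, volN_eq h, ← val_inv_idealUnit, ← Units.val_mul]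
  rwa [mul_comm 𝔫, mul_inv_cancel_left, mul_comm _ 𝔫, mul_comm (𝔫⁻¹), mul_comm 𝔫, mul_assoc,
    ← mul_assoc (𝔫⁻¹), mul_comm (𝔫⁻¹), inv_mul_cancel_right, mul_comm] at h2

end Coords

end FractionalIdeals

/-! ### Invertible ideals, balanced triples and the class group. -/

section InvertibleIdeals

variable {R K : Type u} [CommRing R] [IsDedekindDomain R] [Field K] [Algebra R K]
  [IsFractionRing R K] {𝔞 : (FractionalIdeal R⁰ K)ˣ}
  {S : Type u} [CommRing S] [Algebra R S] {α : ⋀[R]^2 S ≃ₗ[R] idealModule 𝔞}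

namespace Coords

variable (c : Coords α)

theorem one_le_of_one_mem {I : Submodule S (Total (R := R) K S)} (h : 1 ∈ I) : 1 ≤ I := by
  intro x hx
  obtain ⟨s, rfl⟩ := Submodule.mem_one.1 hx
  rw [Algebra.algebraMap_eq_smul_one]
  exact I.smul_mem s h

/-- A lattice stable under `S` whose norm form is primitive is an invertible ideal. -/
theorem isUnit_of_nI_eq_vI {I : Submodule S (Total (R := R) K S)} (h : IsLat (c.lat I))
    (hI : c.nI I = c.vI I) : IsUnit I := by
  obtain ⟨𝔳, h𝔳⟩ : IsUnit (c.vI I) := by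
    rw [vI]
    exact (idealUnit 𝔞)⁻¹.isUnit.mul h.isUnit_volN
  -- The expected inverse: the conjugate ideal divided by the index 𝔳.
  let J : Submodule S (Total (R := R) K S) :=
    Submodule.span S {z | ∃ k ∈ (𝔳⁻¹ : (Submodule R K)ˣ).val, ∃ x ∈ I,
      z = ((1 : S) ⊗ₜ[R] k) * c.conj x}
  refine IsUnit.of_mul_eq_one J (le_antisymm ?_ (one_le_of_one_mem ?_))
  · refine Submodule.mul_le.2 fun y hy z hz => ?_
    induction hz using Submodule.span_induction with
    | zero => rw [mul_zero]; exact zero_mem _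
    | add z z' _ _ hz hz' => rw [mul_add]; exact add_mem hz hz'
    | smul s z _ hz => rw [mul_smul_comm]; exact Submodule.smul_mem _ _ hz
    | mem z hz =>
      obtain ⟨k, hk, x, hx, rfl⟩ := hz
      -- For every S-stable I the product x̄y lies in 𝔳 + 𝔞𝔳ω, so k x̄y ∈ R + 𝔞ω = S for k ∈ 𝔳⁻¹.
      have h1 := c.re_conj_mul_mem hx hy
      have h2 := c.volK_mem hx hy
      rw [← mul_vI, ← h𝔳, ← val_idealUnit] at h2
      rw [← h𝔳] at h1
      rw [show y * ((1 : S) ⊗ₜ[R] k * c.conj x) = (1 : S) ⊗ₜ[R] k * (c.conj x * y) by ring,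
        c.mem_one_iff, map_mul, c.ψ_one_tmul, QuadraticAlgebra.re_mul, QuadraticAlgebra.im_mul,
        c.im_conj_mul]
      have h3 := mul_mem_units hk h1
      rw [inv_mul_cancel] at h3
      have h4 := mul_mem_units hk (show _ ∈ ((idealUnit 𝔞) * 𝔳).val from h2)
      rw [mul_comm (idealUnit 𝔞), inv_mul_cancel_left] at h4
      constructor
      · simpa using h3
      · simpa [val_idealUnit] using h4
  -- Here primitivity enters: since the norms generate 𝔳, the unit 1 is an R-combination of terms
  -- kN(x) = x · (k x̄).
  · have h1 : (1 : K) ∈ (𝔳⁻¹ : (Submodule R K)ˣ).val * c.nI I := by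
      rw [hI, ← h𝔳, Units.inv_mul]; exact Submodule.mem_one.2 ⟨1, map_one _⟩
    have key : ∀ z ∈ (𝔳⁻¹ : (Submodule R K)ˣ).val * c.nI I, (1 : S) ⊗ₜ[R] z ∈ I * J := by
      intro z hz
      induction hz using Submodule.mul_induction_on' with
      | add a _ b _ ha hb => rw [TensorProduct.tmul_add]; exact add_mem ha hb
      | mem_mul_mem k hk n hn =>
        induction hn using Submodule.span_induction with
        | zero => rw [mul_zero, TensorProduct.tmul_zero]; exact zero_mem _
        | add z z' _ _ hz hz' => rw [mul_add, TensorProduct.tmul_add]; exact add_mem hz hz'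
        | smul s z _ hz =>
          rw [mul_smul_comm, TensorProduct.tmul_smul]
          exact ((I * J).restrictScalars R).smul_mem s hz
        | mem z hz =>
          obtain ⟨x, hx, rfl⟩ := hz
          have e : (1 : S) ⊗ₜ[R] (k * c.nrm x) = x * ((1 : S) ⊗ₜ[R] k * c.conj x) := by
            rw [mul_left_comm, c.mul_conj, Algebra.TensorProduct.tmul_mul_tmul, one_mul]
          rw [e]
          exact Submodule.mul_mem_mul hx (Submodule.subset_span ⟨k, hk, x, hx, rfl⟩)
    exact key 1 h1

theorem smul_cancel (c : Coords α) {r : R} (hr : r ≠ 0) {x y : Total (R := R) K S}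
    (h : r • x = r • y) : x = y := by
  have h1 := congrArg c.emb h
  rw [map_smul, map_smul] at h1
  refine c.emb_injective ?_
  have hr' : algebraMap R K r ≠ 0 := by simpa using hr
  ext
  · have := congrArg Prod.fst h1
    rw [fst_smul_prod, fst_smul_prod] at this
    exact mul_left_cancel₀ hr' this
  · have := congrArg Prod.snd h1
    rw [snd_smul_prod, snd_smul_prod] at this
    exact mul_left_cancel₀ hr' this

/-- An `S`-linear map between ideals is a multiplication. -/
theorem mul_map_eq (c : Coords α) {I J : Submodule S (Total (R := R) K S)} (f : I →ₗ[S] J)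
    (x y : I) : (x : Total (R := R) K S) * f y = y * f x := by
  obtain ⟨r, hr, s, hs⟩ := exists_smul_eq_tmul_one (x : Total (R := R) K S)
  obtain ⟨r', hr', t, ht⟩ := exists_smul_eq_tmul_one (y : Total (R := R) K S)
  refine c.smul_cancel (mul_ne_zero hr hr') ?_
  have e : (algebraMap R S r' * s) • y = (algebraMap R S r * t) • x := by
    apply Subtype.ext
    rw [Submodule.coe_smul, Submodule.coe_smul, mul_smul, mul_smul, algebraMap_smul,
      algebraMap_smul, smul_eq s, smul_eq t, ← hs, ← ht]
    simp only [Algebra.smul_def]; ring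
  have e2 := congrArg (fun z : J => (z : Total (R := R) K S)) (congrArg f e)
  simp only [map_smul, Submodule.coe_smul] at e2
  rw [mul_smul, mul_smul, algebraMap_smul, algebraMap_smul, smul_eq s, smul_eq t, ← hs, ← ht] at e2
  simp only [Algebra.smul_def, map_mul] at e2 ⊢
  linear_combination e2

variable [IsRankTwoLattice R S]

/-- On invertible ideals index and norm ideal agree; the former is submultiplicative and the latter
supermultiplicative. -/
theorem vI_mul (I J : InvIdeal R K S) : c.vI (I.val * J.val) = c.vI I.val * c.vI J.val := by
  refine le_antisymm (c.vI_mul_le _ _) ?_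
  rw [← c.nI_eq_vI, ← c.nI_eq_vI, ← Units.val_mul, ← c.nI_eq_vI]
  exact c.nI_mul_le _ _

/-- An integral ideal of index `1` is the unit ideal. -/
theorem eq_one_of_vI_eq_one {I : InvIdeal R K S} (hI : I.val ≤ 1) (h : c.vI I.val = 1) : I = 1 := by
  refine Units.ext (le_antisymm hI (one_le_of_one_mem ?_))
  -- N(x) = x x̄ with x̄ ∈ S because I ⊆ S; hence I contains its norms, and these generate R.
  have key : ∀ z ∈ c.nI I.val, (1 : S) ⊗ₜ[R] z ∈ I.val := by
    intro z hz
    induction hz using Submodule.span_induction with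
    | zero => rw [TensorProduct.tmul_zero]; exact zero_mem _
    | add z z' _ _ hz hz' => rw [TensorProduct.tmul_add]; exact add_mem hz hz'
    | smul s z _ hz =>
      rw [TensorProduct.tmul_smul]
      exact (I.val.restrictScalars R).smul_mem s hz
    | mem z hz =>
      obtain ⟨x, hx, rfl⟩ := hz
      obtain ⟨s, hs⟩ := Submodule.mem_one.1 (c.conj_mem_one (hI hx))
      rw [← c.mul_conj, ← hs, mul_comm, ← Algebra.smul_def]
      exact I.val.smul_mem s hx
  refine key 1 ?_
  rw [c.nI_eq_vI, h]
  exact Submodule.mem_one.2 ⟨1, map_one _⟩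

theorem span_prod_volK (I : Fin 3 → Submodule S (Total (R := R) K S)) :
    Submodule.span R {k : K | ∃ x y : ∀ i, I i,
      k = ∏ i, volK α (x i : Total (R := R) K S) (y i : Total (R := R) K S)} =
    ∏ i, volN (c.lat (I i)) := by
  rw [Fin.prod_univ_three, volN, volN, volN, Submodule.span_mul_span, Submodule.span_mul_span]
  congr 1
  ext k
  constructor
  · rintro ⟨x, y, rfl⟩
    rw [Fin.prod_univ_three]
    have h : ∀ i, volK α (x i : Total (R := R) K S) (y i : Total (R := R) K S) ∈
        {k | ∃ u ∈ c.lat (I i), ∃ v ∈ c.lat (I i), k = det2 u v} := fun i =>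
      ⟨_, Submodule.mem_map_of_mem (x i).2, _, Submodule.mem_map_of_mem (y i).2,
        (c.det2_emb _ _).symm⟩
    exact Set.mul_mem_mul (Set.mul_mem_mul (h 0) (h 1)) (h 2)
  · rintro ⟨_, ⟨_, ⟨_, ⟨x0, h0, rfl⟩, _, ⟨y0, h0', rfl⟩, rfl⟩, _, ⟨_, ⟨x1, h1, rfl⟩, _,
      ⟨y1, h1', rfl⟩, rfl⟩, rfl⟩, _, ⟨_, ⟨x2, h2, rfl⟩, _, ⟨y2, h2', rfl⟩, rfl⟩, rfl⟩
    refine ⟨fun i => ⟨![x0, x1, x2] i, ?_⟩, fun i => ⟨![y0, y1, y2] i, ?_⟩, ?_⟩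
    · fin_cases i <;> assumption
    · fin_cases i <;> assumption
    · rw [Fin.prod_univ_three]
      simp [det2_emb]

theorem span_prod_volK_one (c : Coords α) :
    Submodule.span R {k : K | ∃ s t : Fin 3 → S, k = ∏ i, volK α (s i ⊗ₜ 1) (t i ⊗ₜ 1)} =
      (idealUnit 𝔞 ^ 3).val := by
  have h := c.span_prod_volK fun _ => (1 : Submodule S (Total (R := R) K S))
  have h1 : volN (c.lat (1 : Submodule S (Total (R := R) K S))) = (idealUnit 𝔞).val := by
    rw [← c.mul_vI, c.vI_one, mul_one, val_idealUnit]
  rw [Finset.prod_const, Finset.card_univ, Fintype.card_fin, h1, ← Units.val_pow_eq_pow_val] at h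
  rw [← h]
  congr 1
  ext k
  constructor
  · rintro ⟨s, t, rfl⟩
    exact ⟨fun i => ⟨s i ⊗ₜ 1, Submodule.mem_one.2 ⟨s i, rfl⟩⟩,
      fun i => ⟨t i ⊗ₜ 1, Submodule.mem_one.2 ⟨t i, rfl⟩⟩, rfl⟩
  · rintro ⟨x, y, rfl⟩
    choose s hs using fun i => Submodule.mem_one.1 (x i).2
    choose t ht using fun i => Submodule.mem_one.1 (y i).2
    refine ⟨s, t, Finset.prod_congr rfl fun i _ => ?_⟩
    rw [← hs, ← ht]; rfl

/-- A triple of invertible ideals is balanced if and only if its product is the unit ideal. -/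
theorem isBalanced_iff (c : Coords α) (I : Fin 3 → InvIdeal R K S) :
    (IsBalanced α fun i => (I i : Submodule S (Total (R := R) K S))) ↔ ∏ i, I i = 1 := by
  -- Multiplicativity of the index turns the second condition of balancedness into: the product
  -- ideal has index 1.
  have h3 : ∏ i, volN (c.lat (I i).val) = idealModule 𝔞 ^ 3 * c.vI (∏ i, I i).val := by
    rw [Fin.prod_univ_three, Fin.prod_univ_three, Units.val_mul, c.vI_mul,
      Units.val_mul, c.vI_mul, ← c.mul_vI, ← c.mul_vI, ← c.mul_vI]
    ring
  have hv : ((idealUnit 𝔞 ^ 3).val = idealModule 𝔞 ^ 3) := Units.val_pow_eq_pow_val _ _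
  rw [IsBalanced, c.span_prod_volK, c.span_prod_volK_one, h3, ← hv, ← Units.coe_prod]
  constructor
  · rintro ⟨h1, h2⟩
    refine c.eq_one_of_vI_eq_one h1 ?_
    exact (Units.isUnit _).mul_left_cancel (h2.trans (mul_one _).symm)
  · intro h
    rw [h, Units.val_one, c.vI_one, mul_one]
    exact ⟨le_rfl, rfl⟩

/-- An invertible ideal contains a nonzero r ∈ R, which is a unit of S_K; then x f(r) = r f(x) shows
that f is multiplication by f(r)/r. -/
theorem exists_eq_mul (c : Coords α) (I : InvIdeal R K S)
    {J : Submodule S (Total (R := R) K S)} (f : I.val →ₗ[S] J) :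
    ∃ z : Total (R := R) K S, ∀ x, (f x : Total (R := R) K S) = z * x := by
  obtain ⟨r, hr, h⟩ := exists_algebraMap_mem I
  have hu : IsUnit (algebraMap R (Total (R := R) K S) r) := by
    rw [c.isUnit_iff, c.nrm_eq, c.ψ_algebraMap]
    simpa using hr
  obtain ⟨w, hw⟩ := hu
  refine ⟨(w⁻¹ : (Total (R := R) K S)ˣ) * f ⟨_, h⟩, fun x => ?_⟩
  have := c.mul_map_eq f x ⟨_, h⟩
  rw [mul_assoc, mul_comm _ (x : Total (R := R) K S), this, ← mul_assoc]
  dsimp only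
  rw [← hw, Units.inv_mul, one_mul]

variable (R K S) in
/-- The principal fractional ideal generated by a unit of `S_K`. -/
noncomputable def principal : (Total (R := R) K S)ˣ →* InvIdeal R K S :=
  Units.map (Submodule.spanSingleton S (A := Total (R := R) K S)).toMonoidHom

theorem mk_eq_mk_iff_principal (I J : InvIdeal R K S) :
    Pic.mk I = Pic.mk J ↔ ∃ z, principal R K S z * I = J := by
  have h1 : Pic.mk I = Pic.mk J ↔ ∃ z, principal R K S z = I⁻¹ * J := by
    rw [Pic.mk, Pic.mk, QuotientGroup.eq]; rfl
  rw [h1]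
  refine exists_congr fun z => ?_
  rw [eq_inv_mul_iff_mul_eq, mul_comm]

theorem principal_mul_eq_iff (z : (Total (R := R) K S)ˣ) (I J : InvIdeal R K S) :
    principal R K S z * I = J ↔ ∀ x, x ∈ J.val ↔ ∃ y ∈ I.val, z * y = x := by
  have h : ∀ x, x ∈ (principal R K S z * I).val ↔ ∃ y ∈ I.val, z * y = x := fun x =>
    Submodule.mem_span_singleton_mul
  rw [Units.ext_iff, eq_comm, SetLike.ext_iff]
  exact forall_congr' fun x => by rw [h]

theorem mk_eq_mk_iff (I J : InvIdeal R K S) :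
    Pic.mk I = Pic.mk J ↔ ∃ z : (Total (R := R) K S)ˣ,
      ∀ x, x ∈ J.val ↔ ∃ y ∈ I.val, z * y = x :=
  (mk_eq_mk_iff_principal I J).trans (exists_congr fun _ => principal_mul_eq_iff _ _ _)

/-- An isomorphism and its inverse are multiplications, by z and w say, and evaluation at a nonzero
element of R gives zw = 1. -/
theorem linearEquiv_iff (c : Coords α) (I J : InvIdeal R K S) :
    Nonempty (I.val ≃ₗ[S] J.val) ↔ Pic.mk I = Pic.mk J := by
  rw [mk_eq_mk_iff]
  constructor
  · rintro ⟨f⟩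
    obtain ⟨z, hz⟩ := c.exists_eq_mul I f.toLinearMap
    obtain ⟨w, hw⟩ := c.exists_eq_mul J f.symm.toLinearMap
    obtain ⟨r, hr, h⟩ := exists_algebraMap_mem I
    have hzw : z * w = 1 := by
      have h1 := hw (f ⟨_, h⟩)
      have h2 := hz ⟨_, h⟩
      simp only [LinearEquiv.coe_coe, LinearEquiv.symm_apply_apply] at h1 h2
      refine c.smul_cancel hr ?_
      rw [Algebra.smul_def, Algebra.smul_def, mul_one]
      rw [h2] at h1
      linear_combination -h1
    refine ⟨⟨z, w, hzw, by rw [mul_comm, hzw]⟩, fun x => ⟨fun hx => ?_, ?_⟩⟩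
    · refine ⟨f.symm ⟨x, hx⟩, (f.symm ⟨x, hx⟩).2, ?_⟩
      have := hz (f.symm ⟨x, hx⟩)
      simpa using this.symm
    · rintro ⟨y, hy, rfl⟩
      have := hz ⟨y, hy⟩
      exact this ▸ (f ⟨y, hy⟩).2
  · rintro ⟨z, hz⟩
    refine ⟨LinearEquiv.ofBijective
      ((LinearMap.mulLeft S (z : Total (R := R) K S)).restrict (p := I.val) (q := J.val)
        fun x hx => (hz _).2 ⟨x, hx, rfl⟩) ⟨?_, ?_⟩⟩
    · intro x y hxy
      have := congrArg (fun w : J.val => (w : Total (R := R) K S)) hxy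
      exact Subtype.ext (z.isUnit.mul_left_cancel this)
    · rintro ⟨x, hx⟩
      obtain ⟨y, hy, rfl⟩ := (hz x).1 hx
      exact ⟨⟨y, hy⟩, rfl⟩

end Coords

end InvertibleIdeals

/-! ### Primitive forms over S and their ideal classes. -/

section Forms

variable {R K : Type u} [CommRing R] [IsDedekindDomain R] [Field K] [Algebra R K]
  [IsFractionRing R K] {𝔞 : (FractionalIdeal R⁰ K)ˣ}
  {S : Type u} [CommRing S] [Algebra R S] {α : ⋀[R]^2 S ≃ₗ[R] idealModule 𝔞}

namespace Coords

variable (c : Coords α)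

theorem volK_one (x : Total (R := R) K S) : volK α 1 x = (c.ψ x).im := by
  rw [c.volK_eq, map_one]
  change 1 * _ - 0 * _ = _
  ring

theorem vol_one (s : S) : vol α 1 s = (c.ψ (s ⊗ₜ[R] (1 : K))).im := by
  rw [← c.volK_one, Algebra.TensorProduct.one_def, volK_tmul, mul_one, mul_one]

theorem exists_vol_ne (c : Coords α) : ∃ s : S, vol α 1 s ≠ 0 := by
  obtain ⟨a, ha, ha0⟩ := exists_ne_zero_mem (idealUnit 𝔞)
  obtain ⟨s, hs⟩ := c.exists_ω ha
  exact ⟨s, by rw [c.vol_one, hs]; exact ha0⟩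

/-- In coordinates x ∧ sx = N(x) (1 ∧ s), multiplication by x having determinant N(x). Hence the
form of an ideal is its norm form. -/
theorem volK_smul_right (x : Total (R := R) K S) (s : S) :
    volK α x (s • x) = vol α 1 s * c.nrm x := by
  rw [c.vol_one, c.nrm_eq, c.volK_eq, smul_eq, map_mul]
  simp; ring

theorem nrm_smul (r : R) (x : Total (R := R) K S) : c.nrm (r • x) = (r * r) • c.nrm x := by
  rw [Algebra.smul_def (A := K), c.nrm_eq, c.nrm_eq, c.ψ_smul, map_mul]
  ring

theorem polar_nrm (x y : Total (R := R) K S) : c.nrm (x + y) - c.nrm x - c.nrm y =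
    2 * (c.ψ x).re * (c.ψ y).re + c.q * ((c.ψ x).re * (c.ψ y).im + (c.ψ x).im * (c.ψ y).re) -
      2 * c.p * (c.ψ x).im * (c.ψ y).im := by
  rw [c.nrm_eq, c.nrm_eq, c.nrm_eq, map_add, QuadraticAlgebra.re_add, QuadraticAlgebra.im_add]
  ring

theorem polar_nrm_add (x x' y : Total (R := R) K S) :
    c.nrm (x + x' + y) - c.nrm (x + x') - c.nrm y =
      c.nrm (x + y) - c.nrm x - c.nrm y + (c.nrm (x' + y) - c.nrm x' - c.nrm y) := by
  rw [c.polar_nrm, c.polar_nrm, c.polar_nrm, map_add, QuadraticAlgebra.re_add,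
    QuadraticAlgebra.im_add]
  ring

theorem polar_nrm_smul (r : R) (x y : Total (R := R) K S) :
    c.nrm (r • x + y) - c.nrm (r • x) - c.nrm y = r • (c.nrm (x + y) - c.nrm x - c.nrm y) := by
  rw [c.polar_nrm, c.polar_nrm, c.ψ_smul, Algebra.smul_def (A := K)]
  ring

end Coords

/-- The data of an `S`-linear embedding of the lattice of a form in `S_K`. -/
structure IsIdealMap {M : Type u} [AddCommGroup M] [Module R M] [Module S M] [IsScalarTower R S M]
    (c : Coords α) (ι : M →ₗ[S] Total (R := R) K S) : Prop where
  injective : Function.Injective ι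
  isLat : IsLat (c.lat (LinearMap.range ι))

section IdealMap

variable {M : Type u} [AddCommGroup M] [Module R M] [Module S M] [IsScalarTower R S M]
  (c : Coords α) {ι : M →ₗ[S] Total (R := R) K S}

/-- The embedding in the plane defined by an embedding in `S_K`. -/
noncomputable def planeMap (ι : M →ₗ[S] Total (R := R) K S) : M →ₗ[R] K × K :=
  c.emb.comp (ι.restrictScalars R)

theorem det2_planeMap (x y : M) :
    det2 (planeMap c ι x) (planeMap c ι y) = volK α (ι x) (ι y) := c.det2_emb _ _

theorem range_planeMap : LinearMap.range (planeMap c ι) = c.lat (LinearMap.range ι) := by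
  rw [planeMap, LinearMap.range_comp]; rfl

variable {c}

theorem IsIdealMap.planeMap_injective (h : IsIdealMap c ι) : Function.Injective (planeMap c ι) :=
  c.emb_injective.comp h.injective

theorem IsIdealMap.isLat_range (h : IsIdealMap c ι) : IsLat (LinearMap.range (planeMap c ι)) := by
  rw [range_planeMap]; exact h.isLat

end IdealMap

/-- Both sides become equal after multiplication by α(1 ∧ s), which is nonzero for some s. So for
any S-linear map to S_K the form is read off as the norm. -/
theorem FormOver.detMapK_φ (c : Coords α) (F : FormOver α) (ι : F.M →ₗ[S] Total (R := R) K S)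
    (x : F.M) : detMapK (planeMap c ι) (F.φ x : K ⊗[R] ⋀[R]^2 F.M) = c.nrm (ι x) := by
  obtain ⟨s, hs⟩ := c.exists_vol_ne
  have h := congrArg (detMapK (planeMap c ι)) (F.wedge_smul s x)
  rw [detMapK_tmul, one_mul, detMap_wedge, det2_planeMap, map_smul ι, c.volK_smul_right,
    map_smul, smul_eq_mul] at h
  exact (mul_left_cancel₀ hs h).symm

theorem span_detMapK_φ (c : Coords α) (F : FormOver α) (ι : F.M →ₗ[S] Total (R := R) K S) :
    Submodule.span R (Set.range fun x => detMapK (planeMap c ι) (F.φ x : K ⊗[R] ⋀[R]^2 F.M)) =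
      c.nI (LinearMap.range ι) := by
  rw [Coords.nI]
  congr 1
  ext k
  constructor
  · rintro ⟨x, rfl⟩; exact ⟨_, ⟨x, rfl⟩, F.detMapK_φ c ι x⟩
  · rintro ⟨_, ⟨x, rfl⟩, rfl⟩; exact ⟨x, F.detMapK_φ c ι x⟩

/-- An ideal map for a primitive form has invertible image. -/
theorem FormOver.isUnit_range (c : Coords α) (F : FormOver α) (hF : IsPrimitive F.φ)
    {ι : F.M →ₗ[S] Total (R := R) K S} (h : IsIdealMap c ι) : IsUnit (LinearMap.range ι) := by
  refine c.isUnit_of_nI_eq_vI h.isLat ?_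
  rw [isPrimitive_iff h.planeMap_injective h.isLat_range, span_detMapK_φ] at hF
  rw [hF, Coords.vI, range_planeMap]

theorem exists_φ_ne_zero (F : Form 𝔞) (hF : IsPrimitive F.φ) : ∃ x, F.φ x ≠ 0 := by
  by_contra! h
  obtain ⟨j, hj, hL⟩ := exists_embedding R K F.M
  have h1 := (isPrimitive_iff hj hL F.φ).1 hF
  have h2 : (Set.range fun x => detMapK j (F.φ x : K ⊗[R] ⋀[R]^2 F.M)) = {0} := by
    have : (fun x => detMapK j (F.φ x : K ⊗[R] ⋀[R]^2 F.M)) = fun _ => 0 := by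
      funext x; rw [h x, ZeroMemClass.coe_zero, map_zero]
    rw [this, Set.range_const]
  obtain ⟨𝔳, h𝔳⟩ : IsUnit (idealModule 𝔞⁻¹ * volN (LinearMap.range j)) :=
    ((idealUnit 𝔞)⁻¹.isUnit.mul hL.isUnit_volN)
  obtain ⟨x, hx, hx0⟩ := exists_ne_zero_mem 𝔳
  rw [h𝔳, ← h1, h2, Submodule.span_zero_singleton] at hx
  exact hx0 ((Submodule.mem_bot R).1 hx)

/-- If sω = 0 then α(1 ∧ s) φ(ω) = 0, so s has no ω-coordinate and comes from R; the lattice is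
torsion-free over R. -/
theorem FormOver.smul_injective (c : Coords α) (F : FormOver α) {ω : F.M} (hω : F.φ ω ≠ 0) {s : S}
    (hs : s • ω = 0) : s = 0 := by
  have htf := IsRankTwoLattice.torsionFree (R := R) (M := F.M)
  have hω0 : ω ≠ 0 := by rintro rfl; exact hω (QuadraticMap.map_zero _)
  have h1 := F.wedge_smul s ω
  rw [hs] at h1
  have h0 : wedge R ω (0 : F.M) = 0 := by
    have := wedge_smul_right (R := R) 0 ω ω
    rwa [zero_smul, zero_smul] at this
  rw [h0, TensorProduct.tmul_zero, eq_comm, smul_eq_zero, ZeroMemClass.coe_eq_zero] at h1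
  have him := h1.resolve_right hω
  rw [c.vol_one] at him
  obtain ⟨r, hr⟩ := Submodule.mem_one.1 ((c.mem_iff _).1 ⟨s, rfl⟩).1
  have hsr : s = algebraMap R S r := by
    refine c.tmul_one_injective (c.ψ.injective ?_)
    have h2 : (algebraMap R S r) ⊗ₜ[R] (1 : K) = algebraMap R (Total (R := R) K S) r := rfl
    dsimp only
    rw [h2, c.ψ_algebraMap]
    ext
    · exact hr.symm
    · exact him
  rw [hsr, algebraMap_smul, smul_eq_zero] at hs
  rw [hsr, hs.resolve_right hω0, map_zero]

/-- ω ∧ σω = α(1 ∧ σ) φ(ω) ≠ 0 for a suitable σ, so ω and σω span the lattice rationally. -/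
theorem FormOver.exists_smul_eq (c : Coords α) (F : FormOver α) {ω : F.M} (hω : F.φ ω ≠ 0)
    (m : F.M) : ∃ r : R, r ≠ 0 ∧ ∃ s : S, r • m = s • ω := by
  obtain ⟨σ, hσ⟩ := c.exists_vol_ne
  obtain ⟨j, hj, hL⟩ := exists_embedding R K F.M
  have h1 : det2 (j ω) (j (σ • ω)) ≠ 0 := by
    have h2 := congrArg (detMapK j) (F.wedge_smul σ ω)
    rw [detMapK_tmul, one_mul, detMap_wedge, (detMapK j).map_smul] at h2
    rw [h2]
    refine smul_ne_zero hσ ?_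
    rw [Ne, map_eq_zero_iff _ (detMapK_injective hj hL), ZeroMemClass.coe_eq_zero]
    exact hω
  obtain ⟨r, hr, a, b, h⟩ := exists_smul_eq_add hj hL h1 m
  refine ⟨r, hr, algebraMap R S a + b • σ, ?_⟩
  rw [h, add_smul, algebraMap_smul, smul_assoc]

/-- The lattice of a form belonging to `S` that is not zero embeds in `S_K`. -/
theorem FormOver.exists_isIdealMap (c : Coords α) (F : FormOver α) {ω : F.M} (hω : F.φ ω ≠ 0) :
    ∃ ι : F.M →ₗ[S] Total (R := R) K S, IsIdealMap c ι ∧ ι ω = 1 := by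
  have htf := IsRankTwoLattice.torsionFree (R := R) (M := F.M)
  -- The graph of m ↦ s/r, where rm = sω. It is single-valued because ω has trivial annihilator in
  -- S.
  let P : F.M → Total (R := R) K S → Prop := fun m z =>
    ∃ r : R, r ≠ 0 ∧ ∃ s : S, r • m = s • ω ∧ r • z = s ⊗ₜ 1
  have hP : ∀ m, ∃ z, P m z := by
    intro m
    obtain ⟨r, hr, s, h⟩ := F.exists_smul_eq c hω m
    have hr' : algebraMap R K r ≠ 0 := by simpa using hr
    refine ⟨s ⊗ₜ (algebraMap R K r)⁻¹, r, hr, s, h, ?_⟩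
    rw [← TensorProduct.tmul_smul, Algebra.smul_def, mul_inv_cancel₀ hr']
  have huniq : ∀ m z z', P m z → P m z' → z = z' := by
    rintro m z z' ⟨r, hr, s, h1, h2⟩ ⟨r', hr', s', h1', h2'⟩
    have e : (r' • s - r • s') • ω = 0 := by
      rw [sub_smul, smul_assoc, smul_assoc, ← h1, ← h1', smul_comm, sub_self]
    have e2 := sub_eq_zero.1 (F.smul_injective c hω e)
    refine c.smul_cancel (mul_ne_zero hr hr') ?_
    rw [mul_comm, mul_smul, h2, TensorProduct.smul_tmul', e2, ← TensorProduct.smul_tmul', ← h2',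
      ← mul_smul, mul_comm r r']
  choose f hf using hP
  let ι : F.M →ₗ[S] Total (R := R) K S :=
    { toFun := f
      map_add' := fun m m' => by
        refine huniq _ _ _ (hf _) ?_
        obtain ⟨r, hr, s, h1, h2⟩ := hf m
        obtain ⟨r', hr', s', h1', h2'⟩ := hf m'
        refine ⟨r * r', mul_ne_zero hr hr', r' • s + r • s', ?_, ?_⟩
        · rw [add_smul, smul_assoc, smul_assoc, ← h1, ← h1', smul_add]; module
        · rw [TensorProduct.add_tmul, ← TensorProduct.smul_tmul', ← TensorProduct.smul_tmul', ← h2,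
            ← h2']; module
      map_smul' := fun t m => by
        refine huniq _ _ _ (hf _) ?_
        obtain ⟨r, hr, s, h1, h2⟩ := hf m
        refine ⟨r, hr, t * s, ?_, ?_⟩
        · rw [smul_comm, h1, mul_smul]
        · rw [RingHom.id_apply, smul_comm, h2, TensorProduct.smul_tmul', smul_eq_mul] }
  have hι : ∀ m, P m (ι m) := hf
  have hω1 : ι ω = 1 := huniq _ _ _ (hι ω) ⟨1, one_ne_zero, 1, by simp, by
    rw [one_smul, Algebra.TensorProduct.one_def]⟩
  refine ⟨ι, ⟨?_, ?_, ?_⟩, hω1⟩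
  · refine (injective_iff_map_eq_zero ι).2 fun m hm => ?_
    obtain ⟨r, hr, s, h1, h2⟩ := hι m
    rw [hm, smul_zero] at h2
    have hs : s = 0 := c.tmul_one_injective (by simpa using h2.symm)
    rw [hs, zero_smul] at h1
    exact (smul_eq_zero_iff_right hr).1 h1
  · rw [← range_planeMap]
    have := IsRankTwoLattice.finite (R := R) (M := F.M)
    exact Module.Finite.iff_fg.1 inferInstance
  · obtain ⟨σ, hσ⟩ := c.exists_vol_ne
    refine ⟨_, Submodule.mem_map_of_mem ⟨ω, rfl⟩, _, Submodule.mem_map_of_mem ⟨σ • ω, rfl⟩, ?_⟩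
    rw [c.det2_emb, map_smul, hω1, c.volK_smul_right, c.nrm_one, mul_one]
    exact hσ

theorem PrimFormOver.exists_ideal (c : Coords α) (F : PrimFormOver α) :
    ∃ I : InvIdeal R K S, Nonempty (F.1.M ≃ₗ[S] I.val) := by
  obtain ⟨ω, hω⟩ := exists_φ_ne_zero F.1.toForm F.2
  obtain ⟨ι, hι, -⟩ := F.1.exists_isIdealMap c hω
  obtain ⟨I, hI⟩ := F.1.isUnit_range c F.2 hι
  exact ⟨I, ⟨(LinearEquiv.ofInjective ι hι.injective).trans (LinearEquiv.ofEq _ _ hI.symm)⟩⟩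

/-- `S`-linear isomorphisms of forms belonging to `S` respect the forms. -/
theorem FormOver.isomorphic_of_linearEquiv (c : Coords α) (F G : FormOver α) (f : F.M ≃ₗ[S] G.M) :
    F.Isomorphic G := by
  refine ⟨f, fun x => ?_⟩
  obtain ⟨σ, hσ⟩ := c.exists_vol_ne
  -- After multiplication by α(1 ∧ σ) the value φ(x) becomes x ∧ σx, which every S-linear map
  -- respects.
  refine smul_right_injective _ hσ ?_
  dsimp only
  have h1 := F.wedge_smul σ x
  have h2 := G.wedge_smul σ (f x)
  rw [LinearEquiv.restrictScalars_apply, ← h2, ← LinearMap.baseChange_eq_ltensor,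
    ← (LinearMap.baseChange K _).map_smul, ← h1,
    LinearMap.baseChange_tmul, map_wedge]
  simp

/-- The values lift uniquely through the injection `detMapK`, so the axioms of a quadratic map can
be verified on `K`-valued functions. -/
theorem exists_quadraticMap {M : Type u} [AddCommGroup M] [Module R M] {j : M →ₗ[R] K × K}
    (hj : Function.Injective j) (hL : IsLat (LinearMap.range j)) (N : M → K)
    (hN : ∀ x, N x ∈ idealModule 𝔞⁻¹ * volN (LinearMap.range j))
    (hsmul : ∀ (r : R) x, N (r • x) = (r * r) • N x)
    (hadd : ∀ x x' y, N (x + x' + y) - N (x + x') - N y =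
      N (x + y) - N x - N y + (N (x' + y) - N x' - N y))
    (hpolar : ∀ (r : R) x y, N (r • x + y) - N (r • x) - N y = r • (N (x + y) - N x - N y)) :
    ∃ φ : QuadraticMap R M (twist 𝔞 M), ∀ x, detMapK j (φ x : K ⊗[R] ⋀[R]^2 M) = N x := by
  have h : ∀ x : M, ∃ v : twist 𝔞 M, detMapK j (v : K ⊗[R] ⋀[R]^2 M) = N x := by
    intro x
    have h1 := hN x
    rw [← map_twist] at h1
    obtain ⟨v, hv, h2⟩ := h1
    exact ⟨⟨v, hv⟩, h2⟩
  choose f hf using h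
  let D : twist 𝔞 M →ₗ[R] K := ((detMapK j).restrictScalars R).comp (twist 𝔞 M).subtype
  have hD : Function.Injective D := (detMapK_injective hj hL).comp Subtype.val_injective
  replace hf : ∀ x, D (f x) = N x := hf
  refine ⟨QuadraticMap.ofPolar f (fun r x => hD ?_) (fun x x' y => hD ?_)
    (fun r x y => hD ?_), hf⟩
  · rw [map_smul, hf, hf, hsmul]
  · rw [map_add]
    simp only [QuadraticMap.polar, map_sub, hf]
    exact hadd x x' y
  · rw [map_smul]
    simp only [QuadraticMap.polar, map_sub, hf]
    exact hpolar r x y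

theorem isRankTwoLattice_of_isIdealMap {c : Coords α} {M : Type u} [AddCommGroup M] [Module R M]
    [Module S M] [IsScalarTower R S M] {ι : M →ₗ[S] Total (R := R) K S} (hι : IsIdealMap c ι) :
    IsRankTwoLattice R M :=
  isRankTwoLattice_of_isLat hι.planeMap_injective hι.isLat_range

/-- The norm form of a lattice in `S_K`. -/
theorem exists_norm_form {c : Coords α} {M : Type u} [AddCommGroup M] [Module R M]
    [Module S M] [IsScalarTower R S M] {ι : M →ₗ[S] Total (R := R) K S} (hι : IsIdealMap c ι) :
    ∃ φ : QuadraticMap R M (twist 𝔞 M), ∀ x,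
      detMapK (planeMap c ι) (φ x : K ⊗[R] ⋀[R]^2 M) = c.nrm (ι x) := by
  have hR : ∀ (r : R) x, ι (r • x) = r • ι x := (ι.restrictScalars R).map_smul
  refine exists_quadraticMap hι.planeMap_injective hι.isLat_range _ (fun x => ?_)
    (fun r x => ?_) (fun x x' y => ?_) (fun r x y => ?_)
  · rw [range_planeMap]
    exact c.nI_le_vI _ (c.nrm_mem ⟨x, rfl⟩)
  · rw [hR, c.nrm_smul]
  · simp only [map_add]
    exact c.polar_nrm_add _ _ _
  · rw [map_add, map_add, hR]
    exact c.polar_nrm_smul _ _ _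

theorem wedge_smul_of_norm_form {c : Coords α} {M : Type u} [AddCommGroup M] [Module R M]
    [Module S M] [IsScalarTower R S M] {ι : M →ₗ[S] Total (R := R) K S} (hι : IsIdealMap c ι)
    {φ : QuadraticMap R M (twist 𝔞 M)}
    (hφ : ∀ x, detMapK (planeMap c ι) (φ x : K ⊗[R] ⋀[R]^2 M) = c.nrm (ι x)) (s : S) (x : M) :
    (1 : K) ⊗ₜ[R] wedge R x (s • x) = vol α 1 s • (φ x : K ⊗[R] ⋀[R]^2 M) := by
  apply detMapK_injective hι.planeMap_injective hι.isLat_range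
  rw [detMapK_tmul, detMap_wedge, det2_planeMap, one_mul, map_smul ι, (detMapK _).map_smul, hφ,
    c.volK_smul_right, smul_eq_mul]

theorem exists_primFormOver_of_isIdealMap {c : Coords α} {M : Type u} [AddCommGroup M] [Module R M]
    [Module S M] [IsScalarTower R S M] {ι : M →ₗ[S] Total (R := R) K S} (hι : IsIdealMap c ι)
    (hn : c.nI (LinearMap.range ι) = c.vI (LinearMap.range ι)) :
    ∃ F : PrimFormOver α, Nonempty (F.1.M ≃ₗ[S] M) := by
  obtain ⟨φ, hφ⟩ := exists_norm_form hι
  have := isRankTwoLattice_of_isIdealMap hι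
  let F : FormOver α := { M := M, φ := φ, wedge_smul := wedge_smul_of_norm_form hι hφ }
  refine ⟨⟨F, ?_⟩, ⟨LinearEquiv.refl S M⟩⟩
  rw [isPrimitive_iff hι.planeMap_injective hι.isLat_range]
  have := span_detMapK_φ c F ι
  rw [this, hn, range_planeMap]
  rfl

variable [IsRankTwoLattice R S]

theorem isIdealMap_subtype (c : Coords α) (I : InvIdeal R K S) : IsIdealMap c I.val.subtype where
  injective := Subtype.val_injective
  isLat := by rw [Submodule.range_subtype]; exact c.isLat I

/-- Every invertible ideal is the lattice of a primitive form belonging to `S`. -/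
theorem exists_primFormOver (c : Coords α) (I : InvIdeal R K S) :
    ∃ F : PrimFormOver α, Nonempty (F.1.M ≃ₗ[S] I.val) := by
  obtain ⟨F, hF⟩ := exists_primFormOver_of_isIdealMap (isIdealMap_subtype c I) (by
    rw [Submodule.range_subtype, c.nI_eq_vI])
  exact ⟨F, hF⟩

/-- The class of the invertible ideal of a primitive form. -/
theorem exists_formClass_equiv (c : Coords α) :
    ∃ e : FormClass α ≃ Pic R K S, ∀ (F : PrimFormOver α) (I : InvIdeal R K S),
      Nonempty (F.1.M ≃ₗ[S] I.val) → e F.cls = Pic.mk I := by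
  choose I hI using fun F : PrimFormOver α => F.exists_ideal c
  have hI' : ∀ (F : PrimFormOver α) (J : InvIdeal R K S), Nonempty (F.1.M ≃ₗ[S] J.val) →
      Pic.mk (I F) = Pic.mk J := by
    rintro F J ⟨f⟩
    obtain ⟨g⟩ := hI F
    exact (c.linearEquiv_iff _ _).1 ⟨g.symm.trans f⟩
  let e : FormClass α → Pic R K S := Quotient.lift (fun F => Pic.mk (I F)) (by
    rintro F G ⟨f, -⟩
    obtain ⟨g⟩ := hI G
    exact hI' F (I G) ⟨f.trans g⟩)
  refine ⟨Equiv.ofBijective e ⟨?_, ?_⟩, hI'⟩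
  · rintro ⟨F⟩ ⟨G⟩ h
    obtain ⟨f⟩ := (c.linearEquiv_iff (I F) (I G)).2 h
    obtain ⟨g⟩ := hI F
    obtain ⟨g'⟩ := hI G
    exact Quotient.sound (F.1.isomorphic_of_linearEquiv c G.1 ((g.trans f).trans g'.symm))
  · intro x
    obtain ⟨J, rfl⟩ := QuotientGroup.mk_surjective x
    obtain ⟨F, hF⟩ := exists_primFormOver c J
    exact ⟨F.cls, hI' F J hF⟩

theorem span_φ_eq_top_iff (c : Coords α) (F : PrimFormOver α)
    {ι : F.1.M →ₗ[S] Total (R := R) K S} (hι : IsIdealMap c ι) (x : F.1.M) :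
    Submodule.span R {F.1.φ x} = ⊤ ↔
      Submodule.span R {c.nrm (ι x)} = c.vI (LinearMap.range ι) := by
  let f : twist 𝔞 F.1.M →ₗ[R] K :=
    ((detMapK (planeMap c ι)).restrictScalars R).comp (twist 𝔞 F.1.M).subtype
  have hf : Function.Injective f :=
    (detMapK_injective hι.planeMap_injective hι.isLat_range).comp Subtype.val_injective
  rw [← (Submodule.map_injective_of_injective hf).eq_iff, Submodule.map_span,
    Set.image_singleton, Submodule.map_top, LinearMap.range_comp, Submodule.range_subtype,
    map_twist, range_planeMap]
  exact Iff.of_eq (congrArg (fun k => Submodule.span R {k} = _) (F.1.detMapK_φ c ι x))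

theorem exists_isIdealMap_of_linearEquiv (c : Coords α) {M : Type u} [AddCommGroup M] [Module R M]
    [Module S M] [IsScalarTower R S M] {N : Submodule S (Total (R := R) K S)} (hN : N = 1) (f : M ≃ₗ[S] N) :
    ∃ ι : M →ₗ[S] Total (R := R) K S, IsIdealMap c ι ∧ LinearMap.range ι = 1 ∧
      ∃ ω, ι ω = 1 := by
  have hr : LinearMap.range (N.subtype.comp f.toLinearMap) = N := by
    rw [LinearMap.range_comp, LinearEquiv.range, Submodule.map_top, Submodule.range_subtype]
  refine ⟨N.subtype.comp f.toLinearMap, ⟨Subtype.val_injective.comp f.injective, ?_⟩,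
    hr.trans hN, ?_⟩
  · rw [hr, hN]
    exact c.isLat (1 : InvIdeal R K S)
  · have h1 : (1 : Total (R := R) K S) ∈ LinearMap.range (N.subtype.comp f.toLinearMap) := by
      rw [hr, hN]; exact Submodule.mem_one.2 ⟨1, map_one _⟩
    exact LinearMap.mem_range.1 h1

/-- The lattice of `F` is isomorphic to `S` if and only if a value of the form is a generator. -/
theorem linearEquiv_one_iff (c : Coords α) (F : PrimFormOver α) :
    Nonempty (F.1.M ≃ₗ[S] (1 : InvIdeal R K S).val) ↔ ∃ x, Submodule.span R {F.1.φ x} = ⊤ := by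
  constructor
  · rintro ⟨f⟩
    obtain ⟨ι, hι, hr, ω, hω⟩ := exists_isIdealMap_of_linearEquiv c Units.val_one f
    refine ⟨ω, (span_φ_eq_top_iff c F hι ω).2 ?_⟩
    rw [hr, c.vI_one, hω, c.nrm_one, Submodule.one_eq_span]
  · rintro ⟨ω, hω⟩
    have hω0 : F.1.φ ω ≠ 0 := by
      obtain ⟨x, hx⟩ := exists_φ_ne_zero F.1.toForm F.2
      intro h
      rw [h, Submodule.span_zero_singleton] at hω
      exact hx ((Submodule.mem_bot R).1 (hω ▸ Submodule.mem_top))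
    obtain ⟨ι, hι, h1⟩ := F.1.exists_isIdealMap c hω0
    obtain ⟨I, hI⟩ := F.1.isUnit_range c F.2 hι
    rw [span_φ_eq_top_iff c F hι, h1, c.nrm_one, ← hI, ← Submodule.one_eq_span] at hω
    have h2 : I = 1 := by
      -- With ω ↦ 1 the ideal I contains S, and as N(1) = 1 generates its index, that index is 1.
      -- Passing to the inverse gives an ideal inside S of index 1.
      have h3 : I⁻¹ = 1 := by
        refine c.eq_one_of_vI_eq_one ?_ ?_
        · have h4 : (1 : Submodule S (Total (R := R) K S)) ≤ I.val :=
            Coords.one_le_of_one_mem (hI ▸ ⟨ω, h1⟩)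
          have h5 := mul_le_mul_left h4 (I⁻¹ : InvIdeal R K S).val
          rwa [one_mul, Units.mul_inv] at h5
        · have h6 := c.vI_mul I I⁻¹
          rwa [← hω, one_mul, Units.mul_inv, c.vI_one, eq_comm] at h6
      rwa [inv_eq_one] at h3
    exact ⟨(LinearEquiv.ofInjective ι hι.injective).trans
      (LinearEquiv.ofEq _ _ (by rw [← hI, h2]))⟩

end Forms

/-! ### Embedding the three lattices of a box in S_K. -/

section Boxes

variable {R K : Type u} [CommRing R] [IsDedekindDomain R] [Field K] [Algebra R K]
  [IsFractionRing R K] {𝔞 : (FractionalIdeal R⁰ K)ˣ}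
  {S : Type u} [CommRing S] [Algebra R S] {α : ⋀[R]^2 S ≃ₗ[R] idealModule 𝔞}

namespace Coords

variable (c : Coords α)

theorem volK_mul_left (z x y : Total (R := R) K S) :
    volK α (z * x) (z * y) = c.nrm z * volK α x y := by
  rw [c.volK_eq, c.volK_eq, c.nrm_eq, map_mul, map_mul]
  simp; ring

/-- The bilinear form (x, y) ↦ α(1 ∧ xy) has determinant −1 in the basis 1, ω, and multiplication by
zw has determinant N(zw). The sign matches the −θ in the definition of the forms of a box. -/
theorem volK_one_mul_sub (z w x x' y y' : Total (R := R) K S) :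
    volK α 1 (z * (w * (x * y))) * volK α 1 (z * (w * (x' * y'))) -
      volK α 1 (z * (w * (x' * y))) * volK α 1 (z * (w * (x * y'))) =
      -(c.nrm z * (c.nrm w * (volK α x x' * volK α y y'))) := by
  simp only [c.volK_one, c.volK_eq, c.nrm_eq, map_mul]
  simp; ring

end Coords

theorem exists_third : ∀ i j : Fin 3, j ≠ i → ∃ k, k ≠ i ∧ k ≠ j ∧
    Finset.univ = ({i, j, k} : Finset (Fin 3)) ∧ Finset.univ.erase i = ({j, k} : Finset (Fin 3)) := by
  decide

theorem Coords.volK_prod_sub (c : Coords α) (z : Total (R := R) K S)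
    (X Y : Fin 3 → Total (R := R) K S) {i j : Fin 3} (hij : j ≠ i) (h : X i = Y i) :
    volK α 1 (z * ∏ k, X k) * volK α 1 (z * ∏ k, Y k) -
      volK α 1 (z * ∏ k, Function.update X j (Y j) k) *
        volK α 1 (z * ∏ k, Function.update Y j (X j) k) =
      -(c.nrm z * (c.nrm (X i) * ∏ k ∈ Finset.univ.erase i, volK α (X k) (Y k))) := by
  obtain ⟨k, hki, hkj, hu, he⟩ := exists_third i j hij
  rw [he, hu]
  have h1 : i ∉ ({j, k} : Finset (Fin 3)) := by simp [hij.symm, hki.symm]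
  have h2 : j ∉ ({k} : Finset (Fin 3)) := by simp [hkj.symm]
  simp only [Finset.prod_insert h1, Finset.prod_insert h2, Finset.prod_singleton,
    Function.update_self, Function.update_of_ne hij.symm, Function.update_of_ne hkj, ← h]
  exact c.volK_one_mul_sub _ _ _ _ _ _

/-- An embedding of a box belonging to `S` as the box of a triple of ideals. -/
structure BoxOver.IsEmb (B : BoxOver α) (c : Coords α)
    (ι : ∀ i, B.M i →ₗ[S] Total (R := R) K S) : Prop where
  isIdealMap : ∀ i, IsIdealMap c (ι i)
  β_eq : ∀ x, (B.β x : K) = volK α 1 (∏ i, ι i (x i))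
  θ_eq : ∀ x y : ∀ i, B.M i, (B.θ (⨂ₜ[R] i, wedge R (x i) (y i)) : K) =
    ∏ i, volK α (ι i (x i)) (ι i (y i))

theorem IsIdealMap.mul_left {c : Coords α} {M : Type u} [AddCommGroup M] [Module R M]
    [Module S M] [IsScalarTower R S M] {ι : M →ₗ[S] Total (R := R) K S} (hι : IsIdealMap c ι)
    {z : Total (R := R) K S} (hz : IsUnit z) : IsIdealMap c ((LinearMap.mulLeft S z).comp ι) where
  injective := fun x y h => hι.injective (hz.mul_left_cancel h)
  isLat := by
    rw [← range_planeMap]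
    have := isRankTwoLattice_of_isIdealMap hι
    have := IsRankTwoLattice.finite (R := R) (M := M)
    refine ⟨Module.Finite.iff_fg.1 inferInstance, ?_⟩
    obtain ⟨_, ⟨x, rfl⟩, _, ⟨y, rfl⟩, h⟩ := hι.isLat_range.exists_det_ne
    refine ⟨_, ⟨x, rfl⟩, _, ⟨y, rfl⟩, ?_⟩
    rw [det2_planeMap] at h ⊢
    rw [LinearMap.comp_apply, LinearMap.comp_apply, LinearMap.mulLeft_apply,
      LinearMap.mulLeft_apply, c.volK_mul_left]
    exact mul_ne_zero ((c.isUnit_iff z).1 hz) h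

variable [IsRankTwoLattice R S]

/-- The pairing (z, s) ↦ α(1 ∧ zs) is nondegenerate over K, so every functional on S is represented
by some z. -/
theorem Coords.exists_volK_eq (c : Coords α) (g : S →ₗ[R] K) :
    ∃ z : Total (R := R) K S, ∀ s, g s = volK α 1 (z * s ⊗ₜ[R] (1 : K)) := by
  obtain ⟨σ, hσ⟩ := c.exists_vol_ne
  have hσ' := hσ
  rw [c.vol_one] at hσ'
  set a := (c.ψ (σ ⊗ₜ[R] (1 : K))).re with ha
  set d := (c.ψ (σ ⊗ₜ[R] (1 : K))).im with hd
  -- The solution of α(1 ∧ z) = g(1) and α(1 ∧ zσ) = g(σ).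
  let z := c.ψ.symm ⟨(g σ - g 1 * a - c.q * g 1 * d) / d, g 1⟩
  let G : S →ₗ[R] K := ((volK α 1).comp (LinearMap.mulLeft R z)).comp
    ((TensorProduct.mk R S K).flip 1)
  have hG : ∀ s, G s = volK α 1 (z * s ⊗ₜ[R] (1 : K)) := fun s => rfl
  refine ⟨z, fun s => ?_⟩
  rw [← hG]
  have e1 : G 1 = g 1 := by
    rw [hG, ← Algebra.TensorProduct.one_def, mul_one, c.volK_one, RingEquiv.apply_symm_apply]
  have e2 : G σ = g σ := by
    rw [hG, c.volK_one, map_mul, RingEquiv.apply_symm_apply]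
    simp only [QuadraticAlgebra.im_mul, ← ha, ← hd]
    field_simp
    ring
  have hj : Function.Injective (c.emb.comp ((TensorProduct.mk R S K).flip 1)) :=
    c.emb_injective.comp c.tmul_one_injective
  have hL : IsLat (LinearMap.range (c.emb.comp ((TensorProduct.mk R S K).flip 1))) := by
    convert c.isLat (1 : InvIdeal R K S) using 1
    rw [LinearMap.range_comp]
    congr 1
    ext x
    exact Submodule.mem_one.symm
  obtain ⟨r, hr, a, b, h⟩ := exists_smul_eq_add hj hL (x := 1) (y := σ) (by
    change det2 (c.emb (1 ⊗ₜ 1)) (c.emb (σ ⊗ₜ 1)) ≠ 0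
    rw [c.det2_emb, volK_tmul, mul_one, mul_one]
    exact hσ) s
  refine smul_right_injective K hr ?_
  change r • g s = r • G s
  rw [← map_smul, ← map_smul, h, map_add, map_add, map_smul, map_smul, map_smul, map_smul, e1, e2]

theorem FormOver.exists_nrm_ne (c : Coords α) {F : FormOver α} (hF : IsPrimitive F.φ)
    {ι : F.M →ₗ[S] Total (R := R) K S} (hι : IsIdealMap c ι) : ∃ x, c.nrm (ι x) ≠ 0 := by
  obtain ⟨x, hx⟩ := exists_φ_ne_zero F.toForm hF
  refine ⟨x, ?_⟩
  rw [← F.detMapK_φ c ι x, Ne, map_eq_zero_iff _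
    (detMapK_injective hι.planeMap_injective hι.isLat_range), ZeroMemClass.coe_eq_zero]
  exact hx

/-- The trilinear form of a box is the trace form of a product in `S_K`. -/
theorem PrimBoxOver.exists_β_eq (B : PrimBoxOver α) (c : Coords α) :
    ∃ (ι : ∀ i, B.1.M i →ₗ[S] Total (R := R) K S) (z : Total (R := R) K S),
      (∀ i, IsIdealMap c (ι i)) ∧ ∀ x, (B.1.β x : K) = volK α 1 (z * ∏ i, ι i (x i)) := by
  have h1 : ∀ i, ∃ m : B.1.M i, B.1.form i m ≠ 0 := fun i =>
    exists_φ_ne_zero (B.1.formOver i).toForm (B.2 i)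
  choose m hm using h1
  have h2 := fun i => (B.1.formOver i).exists_isIdealMap c (hm i)
  choose ι hι hιm using h2
  -- The functional s ↦ β(s m₀, m₁, m₂); its representing element z determines β.
  let g : S →ₗ[R] K := (idealModule 𝔞).subtype.comp ((B.1.β.toLinearMap m 0).comp
    ((LinearMap.toSpanSingleton S (B.1.M 0) (m 0)).restrictScalars R))
  obtain ⟨z, hz⟩ := c.exists_volK_eq g
  have hg : ∀ s, g s = B.1.β (Function.update m 0 (s • m 0)) := fun s => rfl
  refine ⟨ι, z, hι, fun x => ?_⟩
  have h3 := fun i => (B.1.formOver i).exists_smul_eq c (hm i) (x i)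
  choose r hr s hs using h3
  have h4 : ∀ i, r i • ι i (x i) = s i ⊗ₜ[R] (1 : K) := by
    intro i
    have e : ι i (r i • x i) = s i • ι i (m i) :=
      (congrArg (ι i) (hs i)).trans ((ι i).map_smul (s i) (m i))
    rw [hιm, Coords.smul_eq, mul_one] at e
    rw [← e]
    exact (((ι i).restrictScalars R).map_smul _ _).symm
  -- Balancedness moves all three scalars to place 0, where they multiply.
  have h5 : B.1.β (fun i => s i • m i) = B.1.β (Function.update m 0 ((∏ i, s i) • m 0)) := by
    have hcomm : ∀ (t t' : S) (k : Fin 3) (hk : k ≠ 0) (y : ∀ i, B.1.M i),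
        B.1.β (Function.update (Function.update y 0 (t • y 0)) k (t' • y k)) =
          B.1.β (Function.update y 0 ((t' * t) • y 0)) := by
      intro t t' k hk y
      have e := B.1.smul_balanced t' (Function.update y 0 (t • y 0)) k 0
      rw [Function.update_of_ne hk, Function.update_self, Function.update_idem, smul_smul] at e
      exact e
    have e1 := hcomm (s 0) (s 1) 1 (by decide) m
    have e2 := hcomm (s 1 * s 0) (s 2) 2 (by decide) m
    have e3 := B.1.smul_balanced (s 2)
      (Function.update (Function.update m 0 (s 0 • m 0)) 1 (s 1 • m 1)) 2 0
    rw [Function.update_of_ne (by decide), Function.update_of_ne (by decide)] at e3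
    have e4 : (fun i => s i • m i) = Function.update
        (Function.update (Function.update m 0 (s 0 • m 0)) 1 (s 1 • m 1)) 2 (s 2 • m 2) := by
      funext i
      fin_cases i <;> simp [Function.update]
    rw [e4, e3, Function.update_of_ne (by decide), Function.update_self]
    rw [Function.update_comm (by decide), Function.update_idem, smul_smul]
    have e5 := hcomm (s 2 * s 0) (s 1) 1 (by decide) m
    rw [e5, Fin.prod_univ_three]
    congr 3
    ring
  refine smul_right_injective K (Finset.prod_ne_zero_iff.2 fun i _ => hr i : (∏ i, r i) ≠ 0) ?_
  change (∏ i, r i) • (B.1.β x : K) = (∏ i, r i) • volK α 1 (z * ∏ i, ι i (x i))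
  have h6 : (∏ i, r i) • ∏ i, ι i (x i) = (∏ i, s i) ⊗ₜ[R] (1 : K) := by
    rw [← Finset.prod_smul]
    simp only [h4]
    rw [Fin.prod_univ_three, Fin.prod_univ_three, Algebra.TensorProduct.tmul_mul_tmul,
      Algebra.TensorProduct.tmul_mul_tmul, mul_one, mul_one]
  rw [← map_smul, ← mul_smul_comm, h6, ← hz, hg, ← h5, ← Submodule.coe_smul,
    ← MultilinearMap.map_smul_univ]
  exact congrArg (fun y => (B.1.β y : K)) (funext hs)

theorem Box.thetaAt_tmul (B : Box 𝔞) (i : Fin 3) (w : ∀ j, ⋀[R]^2 (B.M j)) (k : K)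
    (v : ⋀[R]^2 (B.M i)) :
    B.thetaAt i w (k ⊗ₜ v) = k * B.θ (⨂ₜ[R] j, Function.update w i v j) := by
  rw [Box.thetaAt, LinearMap.liftBaseChange_tmul]
  rfl

theorem tprod_wedge_ext {M : Fin 3 → Type u} [∀ i, AddCommGroup (M i)] [∀ i, Module R (M i)]
    {N : Type u} [AddCommGroup N] [Module R N] {f g : (⨂[R] i, ⋀[R]^2 (M i)) →ₗ[R] N}
    (h : ∀ x y : ∀ i, M i, f (⨂ₜ[R] i, wedge R (x i) (y i)) = g (⨂ₜ[R] i, wedge R (x i) (y i))) :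
    f = g := by
  refine PiTensorProduct.ext_of_span_eq_top (γ := fun i => M i × M i)
    (g := fun i p => wedge R p.1 p.2) (fun i => ?_) fun p => h _ _
  rw [← span_wedge]
  congr 1
  ext w
  exact ⟨fun ⟨p, hp⟩ => ⟨p.1, p.2, hp.symm⟩, fun ⟨x, y, h⟩ => ⟨(x, y), h.symm⟩⟩

theorem Box.exists_θ_ne_zero (B : Box 𝔞) : ∃ x y : ∀ i, B.M i,
    (B.θ (⨂ₜ[R] i, wedge R (x i) (y i)) : K) ≠ 0 := by
  by_contra! h
  have h0 : (B.θ : (⨂[R] i, ⋀[R]^2 (B.M i)) →ₗ[R] idealModule (𝔞 ^ 3)) = 0 :=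
    tprod_wedge_ext fun x y => Subtype.ext (h x y)
  obtain ⟨a, ha, ha0⟩ := exists_ne_zero_mem (idealUnit (𝔞 ^ 3))
  obtain ⟨t, ht⟩ := B.θ.surjective ⟨a, ha⟩
  have h1 := LinearMap.congr_fun h0 t
  rw [LinearEquiv.coe_coe, ht] at h1
  exact ha0 (congrArg Subtype.val h1)

/-- These 2 × 2 minors define the quadratic forms of a box. For a trilinear form that comes from
multiplication they factor into norms and the volumes at the other two places. -/
theorem Coords.trilinear_sub (c : Coords α) {M : Fin 3 → Type u} [∀ i, AddCommGroup (M i)]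
    [∀ i, Module S (M i)] (ι : ∀ i, M i →ₗ[S] Total (R := R) K S) {z : Total (R := R) K S}
    {β : (∀ i, M i) → K} (hβ : ∀ x, β x = volK α 1 (z * ∏ i, ι i (x i))) (x y : ∀ i, M i)
    {i j : Fin 3} (hij : j ≠ i) (h : x i = y i) :
    β x * β y - β (Function.update x j (y j)) * β (Function.update y j (x j)) =
      -(c.nrm z * (c.nrm (ι i (x i)) *
        ∏ k ∈ Finset.univ.erase i, volK α (ι k (x k)) (ι k (y k)))) := by
  have hupd : ∀ u v : ∀ i, M i, (fun i => ι i (Function.update u j (v j) i)) =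
      Function.update (fun i => ι i (u i)) j (ι j (v j)) := fun u v =>
    funext fun i => Function.apply_update (fun i => ι i) u j (v j) i
  rw [hβ, hβ, hβ, hβ, hupd x y, hupd y x]
  exact c.volK_prod_sub z (fun i => ι i (x i)) (fun i => ι i (y i)) hij (by rw [h])

/-- The linear map `Λ² M_i → K` defined by the orientation of a box and the wedge products of the
other two places. -/
theorem Box.exists_θ_linear (B : Box 𝔞) (i : Fin 3) (x y : ∀ i, B.M i) :
    ∃ f : ⋀[R]^2 (B.M i) →ₗ[R] K,
      (∀ (x' y' : ∀ i, B.M i), (∀ k, k ≠ i → x' k = x k ∧ y' k = y k) →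
        f (wedge R (x' i) (y' i)) = B.θ (⨂ₜ[R] i, wedge R (x' i) (y' i))) ∧
      ∀ (x' y' : ∀ i, B.M i), (∀ k, k ≠ i → x' k = x k ∧ y' k = y k) → ∀ v,
        f v = B.thetaAt i (fun k => wedge R (x' k) (y' k)) (1 ⊗ₜ v) := by
  have hu : ∀ (x' y' : ∀ i, B.M i), (∀ k, k ≠ i → x' k = x k ∧ y' k = y k) → ∀ v,
      Function.update (fun k => wedge R (x k) (y k)) i v =
        Function.update (fun k => wedge R (x' k) (y' k)) i v := by
    intro x' y' h v
    funext k
    by_cases hk : k = i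
    · subst hk; rw [Function.update_self, Function.update_self]
    · rw [Function.update_of_ne hk, Function.update_of_ne hk, (h k hk).1, (h k hk).2]
  refine ⟨(idealModule (𝔞 ^ 3)).subtype ∘ₗ (B.θ : _ →ₗ[R] idealModule (𝔞 ^ 3)) ∘ₗ
    (PiTensorProduct.tprod R).toLinearMap (fun k => wedge R (x k) (y k)) i, ?_, ?_⟩
  · intro x' y' h
    have h1 := hu x' y' h (wedge R (x' i) (y' i))
    rw [Function.update_eq_self i (fun k => wedge R (x' k) (y' k))] at h1
    exact congrArg (fun w => (B.θ (⨂ₜ[R] i, w i) : K)) h1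
  · intro x' y' h v
    rw [Box.thetaAt_tmul, one_mul]
    exact congrArg (fun w => (B.θ (⨂ₜ[R] i, w i) : K)) (hu x' y' h v)

theorem PrimBoxOver.thetaAt_wedge (B : PrimBoxOver α) (c : Coords α)
    {ι : ∀ i, B.1.M i →ₗ[S] Total (R := R) K S} {z : Total (R := R) K S}
    (hβ : ∀ x, (B.1.β x : K) = volK α 1 (z * ∏ i, ι i (x i)))
    (x y : ∀ i, B.1.M i) (h : x 0 = y 0) (σ : S) :
    B.1.thetaAt 0 (fun k => wedge R (x k) (y k)) (1 ⊗ₜ wedge R (x 0) (σ • x 0)) =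
      vol α 1 σ * (c.nrm z * (c.nrm (ι 0 (x 0)) *
        ∏ k ∈ Finset.univ.erase 0, volK α (ι k (x k)) (ι k (y k)))) := by
  have h1 := B.1.hasForm 0 x y h 1 (by decide)
  rw [c.trilinear_sub ι hβ (i := 0) (j := 1) _ _ (by decide) h, neg_neg] at h1
  rw [B.1.wedge_smul, (Box.thetaAt _ _ _).map_smul, h1, smul_eq_mul]

/-- The orientation of a box is determined by its trilinear form. -/
theorem PrimBoxOver.θ_eq (B : PrimBoxOver α) (c : Coords α)
    {ι : ∀ i, B.1.M i →ₗ[S] Total (R := R) K S} {z : Total (R := R) K S}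
    (hι : ∀ i, IsIdealMap c (ι i)) (hβ : ∀ x, (B.1.β x : K) = volK α 1 (z * ∏ i, ι i (x i)))
    (x y : ∀ i, B.1.M i) : (B.1.θ (⨂ₜ[R] i, wedge R (x i) (y i)) : K) =
      c.nrm z * ∏ i, volK α (ι i (x i)) (ι i (y i)) := by
  -- In its place 0, θ is a functional on a module of rank one, so its value at one nonzero element
  -- suffices. At ω ∧ σω = α(1 ∧ σ) φ₀(ω) the value is prescribed by the form at place 0.
  obtain ⟨ω, hω⟩ : ∃ ω : B.1.M 0, c.nrm (ι 0 ω) ≠ 0 :=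
    FormOver.exists_nrm_ne c (F := B.1.formOver 0) (B.2 0) (hι 0)
  obtain ⟨σ, hσ⟩ := c.exists_vol_ne
  obtain ⟨f, hf1, hf2⟩ := B.1.exists_θ_linear 0 x y
  obtain ⟨X, hX, hX'⟩ : ∃ X : ∀ i, B.1.M i, X 0 = ω ∧ ∀ k, k ≠ 0 → X k = x k :=
    ⟨Function.update x 0 ω, Function.update_self _ _ _, fun k hk => Function.update_of_ne hk _ _⟩
  obtain ⟨Y, hY, hY'⟩ : ∃ Y : ∀ i, B.1.M i, Y 0 = ω ∧ ∀ k, k ≠ 0 → Y k = y k :=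
    ⟨Function.update y 0 ω, Function.update_self _ _ _, fun k hk => Function.update_of_ne hk _ _⟩
  have h1 := B.thetaAt_wedge c hβ X Y (hX.trans hY.symm) σ
  rw [← hf2 X Y (fun k hk => ⟨hX' k hk, hY' k hk⟩), hX] at h1
  have he : Finset.univ.erase (0 : Fin 3) = {1, 2} := by decide
  rw [he, Finset.prod_pair (by decide), hX' 1 (by decide), hX' 2 (by decide), hY' 1 (by decide),
    hY' 2 (by decide)] at h1
  have h3 := map_mul_det2 (hι 0).planeMap_injective (hι 0).isLat_range f ω (σ • ω)
    (wedge R (x 0) (y 0))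
  rw [det2_planeMap, (ι 0).map_smul, c.volK_smul_right, hf1 x y fun _ _ => ⟨rfl, rfl⟩, h1,
    detMap_wedge, det2_planeMap] at h3
  refine mul_right_cancel₀ (mul_ne_zero hσ hω) (h3.trans ?_)
  rw [Fin.prod_univ_three]
  ring

/-- If N(z) = 0 the orientation would vanish on all pure wedges; so z is a unit of S_K and may be
absorbed into the embedding at place 0. The extra factor N(z) in θ disappears at the same time. -/
theorem PrimBoxOver.exists_isEmb (B : PrimBoxOver α) (c : Coords α) : ∃ ι, B.1.IsEmb c ι := by
  obtain ⟨ι, z, hι, hβ⟩ := B.exists_β_eq c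
  have hθ := B.θ_eq c hι hβ
  have hz : IsUnit z := by
    rw [c.isUnit_iff]
    intro h
    obtain ⟨x, y, hxy⟩ := B.1.exists_θ_ne_zero
    rw [hθ, h, zero_mul] at hxy
    exact hxy rfl
  let t : Fin 3 → Total (R := R) K S := ![z, 1, 1]
  have ht : ∏ i, t i = z := by simp [t, Fin.prod_univ_three]
  have htu : ∀ i, IsUnit (t i) := by
    intro i; fin_cases i
    · exact hz
    · exact isUnit_one
    · exact isUnit_one
  have htn : ∏ i, c.nrm (t i) = c.nrm z := by simp [t, Fin.prod_univ_three, c.nrm_one]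
  refine ⟨fun i => (LinearMap.mulLeft S (t i)).comp (ι i), fun i => (hι i).mul_left (htu i),
    fun x => ?_, fun x y => ?_⟩
  · rw [hβ]
    simp only [LinearMap.comp_apply, LinearMap.mulLeft_apply]
    rw [Finset.prod_mul_distrib, ht]
  · rw [hθ]
    simp only [LinearMap.comp_apply, LinearMap.mulLeft_apply, c.volK_mul_left]
    rw [Finset.prod_mul_distrib, htn]

end Boxes

/-! ### The ideals of a primitive box are invertible with product S. -/

section BoxIdeals

variable {R K : Type u} [CommRing R] [IsDedekindDomain R] [Field K] [Algebra R K]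
  [IsFractionRing R K] {𝔞 : (FractionalIdeal R⁰ K)ˣ}
  {S : Type u} [CommRing S] [Algebra R S] {α : ⋀[R]^2 S ≃ₗ[R] idealModule 𝔞}

/-- A tensor product of projective modules is a retract of a tensor product of free modules. -/
theorem isTorsionFree_piTensorProduct {N : Fin 3 → Type u} [∀ i, AddCommGroup (N i)]
    [∀ i, Module R (N i)] [∀ i, Module.Projective R (N i)] :
    Module.IsTorsionFree R (⨂[R] i, N i) := by
  have h : ∀ i, ∃ s : N i →ₗ[R] (N i →₀ R),
      (Finsupp.linearCombination R (id : N i → N i)).comp s = LinearMap.id := fun i =>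
    Module.projective_lifting_property _ _ (Finsupp.linearCombination_id_surjective R (N i))
  choose s hs using h
  have h1 : Function.Injective (PiTensorProduct.map s) := by
    refine Function.LeftInverse.injective
      (g := PiTensorProduct.map fun i => Finsupp.linearCombination R (id : N i → N i)) fun t => ?_
    rw [← LinearMap.comp_apply, ← PiTensorProduct.map_comp]
    simp only [hs]
    rw [PiTensorProduct.map_id, LinearMap.id_apply]
  have := Module.Free.of_basis
    (Basis.piTensorProduct fun i => (Finsupp.basisSingleOne : Module.Basis (N i) R (N i →₀ R)))
  exact h1.moduleIsTorsionFree _ (map_smul _)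

theorem span_tprod_wedge (M : Fin 3 → Type u) [∀ i, AddCommGroup (M i)] [∀ i, Module R (M i)] :
    Submodule.span R {t : ⨂[R] i, ⋀[R]^2 (M i) | ∃ x y : ∀ i, M i,
      t = ⨂ₜ[R] i, wedge R (x i) (y i)} = ⊤ := by
  have h := PiTensorProduct.submodule_span_eq_top (R := R) (γ := fun i => M i × M i)
    (g := fun i p => wedge R p.1 p.2) fun i => by
      rw [← span_wedge]
      congr 1
      ext w
      exact ⟨fun ⟨p, hp⟩ => ⟨p.1, p.2, hp.symm⟩, fun ⟨x, y, h⟩ => ⟨(x, y), h.symm⟩⟩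
  rw [← h]
  congr 1
  ext t
  exact ⟨fun ⟨x, y, h⟩ => ⟨fun i => (x i, y i), h.symm⟩,
    fun ⟨p, h⟩ => ⟨fun i => (p i).1, fun i => (p i).2, h.symm⟩⟩

theorem projective_exterior {M : Type u} [AddCommGroup M] [Module R M] {j : M →ₗ[R] K × K}
    (hj : Function.Injective j) (h : IsLat (LinearMap.range j)) :
    Module.Projective R (⋀[R]^2 M) := by
  have : Module.Projective R (LinearMap.range (detMap j)) := by
    rw [range_detMap]
    exact Submodule.projective_of_isUnit h.isUnit_volN
  exact Module.Projective.of_equiv (LinearEquiv.ofInjective _ (detMap_injective hj h)).symm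

/-- The product of the determinants of three lattices in the plane. -/
noncomputable def detTensor {M : Fin 3 → Type u} [∀ i, AddCommGroup (M i)] [∀ i, Module R (M i)]
    (j : ∀ i, M i →ₗ[R] K × K) : (⨂[R] i, ⋀[R]^2 (M i)) →ₗ[R] K :=
  PiTensorProduct.lift
    ((MultilinearMap.mkPiAlgebra R (Fin 3) K).compLinearMap fun i => detMap (j i))

section Plane

variable {M : Fin 3 → Type u} [∀ i, AddCommGroup (M i)] [∀ i, Module R (M i)]
  {j : ∀ i, M i →ₗ[R] K × K}

theorem detTensor_tprod (w : ∀ i, ⋀[R]^2 (M i)) :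
    detTensor j (⨂ₜ[R] i, w i) = ∏ i, detMap (j i) (w i) := by
  rw [detTensor, PiTensorProduct.lift.tprod]
  rfl

theorem rankOneAt_tprod (hj : ∀ i, Function.Injective (j i))
    (h : ∀ i, IsLat (LinearMap.range (j i))) {x y : ∀ i, M i}
    (hxy : ∀ i, det2 (j i (x i)) (j i (y i)) ≠ 0) :
    RankOneAt R (⨂ₜ[R] i, wedge R (x i) (y i)) := by
  refine .of_span (span_tprod_wedge M) ?_
  rintro _ ⟨x', y', rfl⟩
  have h3 := fun i => rankOneAt_wedge (hj i) (h i) (hxy i) (wedge R (x' i) (y' i))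
  choose r hr a ha using h3
  refine ⟨∏ i, r i, Finset.prod_ne_zero_iff.2 fun i _ => hr i, ∏ i, a i, ?_⟩
  rw [← MultilinearMap.map_smul_univ, ← MultilinearMap.map_smul_univ]
  simp only [ha]

theorem detTensor_injective (hj : ∀ i, Function.Injective (j i))
    (h : ∀ i, IsLat (LinearMap.range (j i))) : Function.Injective (detTensor j) := by
  have := fun i => projective_exterior (hj i) (h i)
  have := isTorsionFree_piTensorProduct (R := R) (N := fun i => ⋀[R]^2 (M i))
  have h1 := fun i => smul_det2_ne (h i)
  choose x y hxy using h1
  refine (rankOneAt_tprod hj h hxy).injective _ ?_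
  rw [detTensor_tprod]
  refine Finset.prod_ne_zero_iff.2 fun i _ => ?_
  rw [detMap_wedge]
  exact hxy i

theorem range_detTensor : LinearMap.range (detTensor j) =
    Submodule.span R {k | ∃ x y : ∀ i, M i, k = ∏ i, det2 (j i (x i)) (j i (y i))} := by
  rw [LinearMap.range_eq_map, ← span_tprod_wedge, Submodule.map_span]
  congr 1
  ext k
  have h : ∀ x y : ∀ i, M i, detTensor j (⨂ₜ[R] i, wedge R (x i) (y i)) =
      ∏ i, det2 (j i (x i)) (j i (y i)) := fun x y => by
    simp only [detTensor_tprod, detMap_wedge]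
  constructor
  · rintro ⟨_, ⟨x, y, rfl⟩, rfl⟩; exact ⟨x, y, h x y⟩
  · rintro ⟨x, y, rfl⟩; exact ⟨_, ⟨x, y, rfl⟩, h x y⟩

end Plane

theorem Box.thetaAt_eq_mul (B : Box 𝔞) {j : ∀ i, B.M i →ₗ[R] K × K} {d : K}
    (hθ : ∀ w : ∀ i, ⋀[R]^2 (B.M i), (B.θ (⨂ₜ[R] i, w i) : K) = d * ∏ i, detMap (j i) (w i))
    (i : Fin 3) (w : ∀ i, ⋀[R]^2 (B.M i)) (v : K ⊗[R] ⋀[R]^2 (B.M i)) :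
    B.thetaAt i w v =
      d * (detMapK (j i) v * ∏ k ∈ Finset.univ.erase i, detMap (j k) (w k)) := by
  induction v using TensorProduct.induction_on with
  | zero => rw [map_zero, map_zero, zero_mul, mul_zero]
  | add v v' h h' => rw [map_add, map_add, h, h', add_mul, mul_add]
  | tmul k v =>
    rw [Box.thetaAt_tmul, hθ, detMapK_tmul, ← Finset.mul_prod_erase _ _ (Finset.mem_univ i),
      Function.update_self, mul_assoc, mul_left_comm]
    congr 3
    refine Finset.prod_congr rfl fun l hl => ?_
    rw [Function.update_of_ne (Finset.ne_of_mem_erase hl)]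

theorem Box.thetaAt_eq (B : Box 𝔞) {j : ∀ i, B.M i →ₗ[R] K × K}
    (hθ : ∀ w : ∀ i, ⋀[R]^2 (B.M i), (B.θ (⨂ₜ[R] i, w i) : K) = ∏ i, detMap (j i) (w i))
    (i : Fin 3) (w : ∀ i, ⋀[R]^2 (B.M i)) (v : K ⊗[R] ⋀[R]^2 (B.M i)) :
    B.thetaAt i w v = detMapK (j i) v * ∏ k ∈ Finset.univ.erase i, detMap (j k) (w k) := by
  rw [B.thetaAt_eq_mul (d := 1) fun w => by rw [one_mul, hθ], one_mul]

namespace Coords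

variable (c : Coords α)

/-- S is its own dual for the 𝔞-valued pairing (s, z) ↦ α(1 ∧ sz): s = 1 controls the ω-coordinate
of z, and s = aω gives a(re z + q im z) ∈ 𝔞, whence a re z ∈ 𝔞 for all a ∈ 𝔞. -/
theorem mem_one_of_forall_im_mem {z : Total (R := R) K S}
    (h : ∀ s : S, (c.ψ (s • z)).im ∈ idealModule 𝔞) :
    z ∈ (1 : Submodule S (Total (R := R) K S)) := by
  have him := h 1
  rw [one_smul] at him
  refine c.mem_one_iff.2 ⟨mem_one_of_forall_mul (𝔟 := idealUnit 𝔞) fun a ha => ?_, him⟩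
  obtain ⟨s, hs⟩ := c.exists_ω ha
  obtain ⟨r, hr⟩ := Submodule.mem_one.1 (c.q_mul_mem ha)
  have h1 := sub_mem (h s) ((idealModule 𝔞).smul_mem r him)
  rw [smul_eq, map_mul, hs, Algebra.smul_def (A := K), hr] at h1
  change _ ∈ idealModule 𝔞
  convert h1 using 1
  simp; ring

end Coords

variable [IsRankTwoLattice R S]

/-- Primitivity makes each image invertible. That β takes values in 𝔞 gives I₁I₂I₃ ⊆ S by
self-duality of S, and that θ maps onto 𝔞³ gives the condition on volumes. -/
theorem BoxOver.IsEmb.exists_ideal {B : BoxOver α} (hB : ∀ i, IsPrimitive (B.form i)) {c : Coords α}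
    {ι : ∀ i, B.M i →ₗ[S] Total (R := R) K S} (h : B.IsEmb c ι) :
    ∃ I : Fin 3 → InvIdeal R K S, (∀ i, (I i).val = LinearMap.range (ι i)) ∧ ∏ i, I i = 1 := by
  have h1 := fun i => (B.formOver i).isUnit_range c (hB i) (h.isIdealMap i)
  choose I hI using h1
  replace hI : ∀ i, (I i).val = LinearMap.range (ι i) := hI
  refine ⟨I, hI, (c.isBalanced_iff I).1 ⟨fun z hz => ?_, ?_⟩⟩
  · have hz' : z ∈ ∏ i, (I i).val := hz
    simp only [hI] at hz'
    clear hz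
    rename' hz' => hz
    refine c.mem_one_of_forall_im_mem fun s => ?_
    replace hz := Submodule.smul_mem _ s hz
    generalize s • z = z at hz ⊢
    rw [Fin.prod_univ_three] at hz
    have key : ∀ x y z, (c.ψ (ι 0 x * ι 1 y * ι 2 z)).im ∈ idealModule 𝔞 := by
      intro x y z
      obtain ⟨u, hu⟩ : ∃ u : ∀ i, B.M i, ∏ i, ι i (u i) = ι 0 x * ι 1 y * ι 2 z :=
        ⟨Fin.cons x (Fin.cons y (Fin.cons z finZeroElim)), by rw [Fin.prod_univ_three]; rfl⟩
      rw [← hu, ← c.volK_one, ← h.β_eq]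
      exact (B.β u).2
    induction hz using Submodule.mul_induction_on' with
    | add a _ b _ ha hb => rw [map_add]; exact add_mem ha hb
    | mem_mul_mem a ha b hb =>
      obtain ⟨w, rfl⟩ := hb
      induction ha using Submodule.mul_induction_on' with
      | add a _ b _ ha hb => rw [add_mul, map_add]; exact add_mem ha hb
      | mem_mul_mem a ha b hb =>
        obtain ⟨x, rfl⟩ := ha
        obtain ⟨y, rfl⟩ := hb
        exact key x y w
  · rw [c.span_prod_volK_one, c.span_prod_volK]
    have h2 : LinearMap.range (detTensor fun i => planeMap c (ι i)) =
        ∏ i, volN (c.lat (I i).val) := by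
      rw [range_detTensor, ← c.span_prod_volK]
      congr 1
      ext k
      simp only [det2_planeMap]
      constructor
      · rintro ⟨x, y, rfl⟩
        exact ⟨fun i => ⟨ι i (x i), hI i ▸ ⟨_, rfl⟩⟩, fun i => ⟨ι i (y i), hI i ▸ ⟨_, rfl⟩⟩, rfl⟩
      · rintro ⟨x, y, rfl⟩
        have hx : ∀ i, ∃ m, ι i m = x i := fun i =>
          LinearMap.mem_range.1 ((hI i).le (x i).2)
        have hy : ∀ i, ∃ m, ι i m = y i := fun i =>
          LinearMap.mem_range.1 ((hI i).le (y i).2)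
        choose u hu using hx
        choose v hv using hy
        exact ⟨u, v, by simp only [hu, hv]⟩
    have h3 : (idealModule (𝔞 ^ 3)).subtype.comp
        (B.θ : (⨂[R] i, ⋀[R]^2 (B.M i)) →ₗ[R] idealModule (𝔞 ^ 3)) =
          detTensor fun i => planeMap c (ι i) := by
      refine tprod_wedge_ext fun x y => ?_
      simp only [detTensor_tprod, detMap_wedge, det2_planeMap]
      exact h.θ_eq x y
    rw [← h2, ← h3, LinearMap.range_comp, LinearEquiv.range, Submodule.map_top,
      Submodule.range_subtype, ← val_idealUnit, idealUnit, map_pow]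
    rfl

theorem BoxOver.IsEmb.isBoxOf {B : BoxOver α} {c : Coords α}
    {ι : ∀ i, B.M i →ₗ[S] Total (R := R) K S} (h : B.IsEmb c ι)
    {I : Fin 3 → Submodule S (Total (R := R) K S)} (hI : ∀ i, I i = LinearMap.range (ι i)) :
    B.IsBoxOf I :=
  ⟨fun i => (LinearEquiv.ofInjective (ι i) (h.isIdealMap i).injective).trans
    (LinearEquiv.ofEq _ _ (hI i).symm), h.β_eq, h.θ_eq⟩

end BoxIdeals

/-! ### The box of a balanced triple of invertible ideals. -/

section IdealBoxes

variable {R K : Type u} [CommRing R] [IsDedekindDomain R] [Field K] [Algebra R K]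
  [IsFractionRing R K] {𝔞 : (FractionalIdeal R⁰ K)ˣ}
  {S : Type u} [CommRing S] [Algebra R S] {α : ⋀[R]^2 S ≃ₗ[R] idealModule 𝔞}

/-- The values of a functional at two vectors. -/
def evalPair {M : Type u} [AddCommGroup M] [Module R M] (a b : M) (P : Submodule R K)
    (Q : Submodule R (M →ₗ[R] P)) : Q →ₗ[R] K × K where
  toFun f := ((f.1 a : K), (f.1 b : K))
  map_add' _ _ := rfl
  map_smul' _ _ := rfl

theorem evalPair_injective {M : Type u} [AddCommGroup M] [Module R M] {j : M →ₗ[R] K × K}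
    (hj : Function.Injective j) (hL : IsLat (LinearMap.range j)) {a b : M}
    (hab : det2 (j a) (j b) ≠ 0) (P : Submodule R K) (Q : Submodule R (M →ₗ[R] P)) :
    Function.Injective (evalPair a b P Q) := by
  rintro ⟨f, hf⟩ ⟨g, hg⟩ hfg
  have ha : f a = g a := Subtype.ext (congrArg Prod.fst hfg)
  have hb : f b = g b := Subtype.ext (congrArg Prod.snd hfg)
  refine Subtype.ext (LinearMap.ext fun x => ?_)
  obtain ⟨r, hr, s, t, h⟩ := exists_smul_eq_add hj hL hab x
  have h2 : r • f x = r • g x := by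
    rw [← map_smul, ← map_smul, h, map_add, map_add, map_smul, map_smul, map_smul, map_smul,
      ha, hb]
  have h3 : r • (f x : K) = r • (g x : K) := congrArg Subtype.val h2
  exact Subtype.ext (smul_right_injective K hr h3)

/-- Evaluation at a and b embeds Q in 𝔞 × 𝔞, so the image is finitely generated; the images of f and
g are independent, so it is a plane lattice. -/
theorem finrank_eq_two_of_det_ne {M : Type u} [AddCommGroup M] [Module R M] {j : M →ₗ[R] K × K}
    (hj : Function.Injective j) (hL : IsLat (LinearMap.range j)) {a b : M}
    (hab : det2 (j a) (j b) ≠ 0) (Q : Submodule R (M →ₗ[R] idealModule 𝔞))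
    {f g : M →ₗ[R] idealModule 𝔞} (hf : f ∈ Q) (hg : g ∈ Q)
    (h : (f a : K) * (g b : K) - (f b : K) * (g a : K) ≠ 0) : Module.finrank R Q = 2 := by
  have hj' := evalPair_injective hj hL hab (idealModule 𝔞) Q
  have hfg : (LinearMap.range (evalPair a b (idealModule 𝔞) Q)).FG := by
    have h2 : (idealModule 𝔞).FG := Submodule.fg_unit (idealUnit 𝔞)
    have hQ : LinearMap.range (evalPair a b (idealModule 𝔞) Q) ≤
        (idealModule 𝔞).prod (idealModule 𝔞) := by
      rintro _ ⟨f, rfl⟩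
      exact ⟨(f.1 a).2, (f.1 b).2⟩
    have := isNoetherian_of_fg_of_noetherian _ (h2.prod h2)
    exact Submodule.FG.of_le_of_isNoetherian hQ
  have hL' : IsLat (LinearMap.range (evalPair a b (idealModule 𝔞) Q)) :=
    ⟨hfg, _, ⟨⟨f, hf⟩, rfl⟩, _, ⟨⟨g, hg⟩, rfl⟩, h⟩
  rw [(LinearEquiv.ofInjective _ hj').finrank_eq]
  generalize LinearMap.range (evalPair a b (idealModule 𝔞) Q) = N at hL'
  rw [← N.range_subtype] at hL'
  exact (isRankTwoLattice_of_isLat N.injective_subtype hL').finrank_eq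

section Construction

variable {c : Coords α} {M : Fin 3 → Type u} [∀ i, AddCommGroup (M i)] [∀ i, Module R (M i)]
  [∀ i, Module S (M i)] [∀ i, IsScalarTower R S (M i)]

theorem exists_trilinear (c : Coords α) (ι : ∀ i, M i →ₗ[S] Total (R := R) K S)
    (h : ∏ i, LinearMap.range (ι i) ≤ 1) :
    ∃ β : MultilinearMap R M (idealModule 𝔞), ∀ x, (β x : K) = volK α 1 (∏ i, ι i (x i)) := by
  let f : MultilinearMap R M K := (volK α 1).compMultilinearMap
    ((MultilinearMap.mkPiAlgebra R (Fin 3) (Total (R := R) K S)).compLinearMap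
      fun i => (ι i).restrictScalars R)
  have hf : ∀ x, f x = volK α 1 (∏ i, ι i (x i)) := fun x => rfl
  refine ⟨f.codRestrict _ fun x => ?_, hf⟩
  have h1 : ∏ i, ι i (x i) ∈ (1 : Submodule S (Total (R := R) K S)) := by
    refine h ?_
    rw [Fin.prod_univ_three, Fin.prod_univ_three]
    exact Submodule.mul_mem_mul (Submodule.mul_mem_mul ⟨_, rfl⟩ ⟨_, rfl⟩) ⟨_, rfl⟩
  rw [hf, c.volK_one]
  exact (c.mem_one_iff.1 h1).2

theorem exists_orientation {ι : ∀ i, M i →ₗ[S] Total (R := R) K S}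
    (hι : ∀ i, IsIdealMap c (ι i))
    (h : LinearMap.range (detTensor fun i => planeMap c (ι i)) = idealModule (𝔞 ^ 3)) :
    ∃ θ : (⨂[R] i, ⋀[R]^2 (M i)) ≃ₗ[R] idealModule (𝔞 ^ 3), ∀ t,
      (θ t : K) = detTensor (fun i => planeMap c (ι i)) t :=
  ⟨(LinearEquiv.ofInjective _ (detTensor_injective (fun i => (hι i).planeMap_injective)
    fun i => (hι i).isLat_range)).trans (LinearEquiv.ofEq _ _ h), fun _ => rfl⟩

variable [IsRankTwoLattice R S]

/-- Two independent functionals on M_i come from the factored minors: a vector of nonzero norm is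
put at one other place k, and two independent vectors at the remaining place. -/
theorem finrank_partial_dual {ι : ∀ i, M i →ₗ[S] Total (R := R) K S}
    (hι : ∀ i, IsIdealMap c (ι i)) (hn : ∀ i, ∃ m, c.nrm (ι i m) ≠ 0)
    {β : MultilinearMap R M (idealModule 𝔞)}
    (hβ : ∀ x, (β x : K) = volK α 1 (∏ i, ι i (x i))) (i : Fin 3) :
    Module.finrank R (Submodule.span R (Set.range fun x : ∀ j, M j => β.toLinearMap x i)) = 2 := by
  have h1 : ∀ i, ∃ a b, volK α (ι i a) (ι i b) ≠ 0 := fun i => by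
    obtain ⟨_, ⟨x, rfl⟩, _, ⟨y, rfl⟩, h⟩ := (hι i).isLat_range.exists_det_ne
    rw [det2_planeMap] at h
    exact ⟨x, y, h⟩
  choose a b hab using h1
  choose m hm using hn
  obtain ⟨k, hk⟩ : ∃ k, i ≠ k := by
    fin_cases i
    exacts [⟨1, by decide⟩, ⟨0, by decide⟩, ⟨0, by decide⟩]
  obtain ⟨X, hXk, hX⟩ : ∃ X : ∀ i, M i, X k = m k ∧ ∀ l, l ≠ k → X l = a l :=
    ⟨Function.update a k (m k), Function.update_self _ _ _,
      fun l hl => Function.update_of_ne hl _ _⟩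
  obtain ⟨Y, hYk, hY⟩ : ∃ Y : ∀ i, M i, Y k = m k ∧ ∀ l, l ≠ k → Y l = b l :=
    ⟨Function.update b k (m k), Function.update_self _ _ _,
      fun l hl => Function.update_of_ne hl _ _⟩
  have h2 := c.trilinear_sub (z := 1) ι (β := fun x => (β x : K))
    (fun x => by rw [one_mul]; exact hβ x) X Y hk (hXk.trans hYk.symm)
  refine finrank_eq_two_of_det_ne (hι i).planeMap_injective (hι i).isLat_range
    (a := a i) (b := b i) (by rw [det2_planeMap]; exact hab i) _
    (Submodule.subset_span ⟨X, rfl⟩) (Submodule.subset_span ⟨Y, rfl⟩) ?_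
  change (β (Function.update X i (a i)) : K) * β (Function.update Y i (b i)) -
    β (Function.update X i (b i)) * β (Function.update Y i (a i)) ≠ 0
  have hXa : Function.update X i (a i) = X := by rw [← hX i hk, Function.update_eq_self]
  have hYb : Function.update Y i (b i) = Y := by rw [← hY i hk, Function.update_eq_self]
  rw [hXa, hYb]
  rw [hX i hk, hY i hk] at h2
  refine ne_of_eq_of_ne h2 (neg_ne_zero.2 (mul_ne_zero (by rw [c.nrm_one]; exact one_ne_zero)
    (mul_ne_zero (by rw [hXk]; exact hm k) (Finset.prod_ne_zero_iff.2 fun l hl => ?_))))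
  rw [hX l (Finset.ne_of_mem_erase hl), hY l (Finset.ne_of_mem_erase hl)]
  exact hab l

/-- Product 1 makes β land in 𝔞 and gives the image of the volumes as 𝔞³, so that θ exists. The
forms are the norm forms, and these are primitive because the ideals are invertible. -/
theorem exists_primBoxOver_of_isIdealMap {ι : ∀ i, M i →ₗ[S] Total (R := R) K S}
    (hι : ∀ i, IsIdealMap c (ι i)) {I : Fin 3 → InvIdeal R K S}
    (hI : ∀ i, (I i).val = LinearMap.range (ι i)) (h1 : ∏ i, I i = 1) :
    ∃ (B : PrimBoxOver α) (ι' : _), B.1.IsEmb c ι' ∧ ∀ i, (I i).val = LinearMap.range (ι' i) := by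
  obtain ⟨β, hβ⟩ := exists_trilinear c ι (by
    simp only [← hI]
    rw [← Units.coe_prod, h1, Units.val_one])
  obtain ⟨θ, hθ⟩ := exists_orientation hι (by
    rw [range_detTensor]
    simp only [det2_planeMap]
    have h2 := ((c.isBalanced_iff I).2 h1).2
    rw [c.span_prod_volK_one, idealUnit, ← map_pow] at h2
    refine Eq.trans ?_ h2
    congr 1
    ext k
    constructor
    · rintro ⟨x, y, rfl⟩
      exact ⟨fun i => ⟨ι i (x i), (hI i).ge ⟨_, rfl⟩⟩, fun i => ⟨ι i (y i), (hI i).ge ⟨_, rfl⟩⟩, rfl⟩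
    · rintro ⟨x, y, rfl⟩
      have hx : ∀ i, ∃ m, ι i m = x i := fun i => LinearMap.mem_range.1 ((hI i).le (x i).2)
      have hy : ∀ i, ∃ m, ι i m = y i := fun i => LinearMap.mem_range.1 ((hI i).le (y i).2)
      choose u hu using hx
      choose v hv using hy
      exact ⟨u, v, by simp only [hu, hv]⟩)
  have hφ := fun i => exists_norm_form (hι i)
  choose φ hφ using hφ
  have hn : ∀ i, ∃ m, c.nrm (ι i m) ≠ 0 := by
    intro i
    obtain ⟨r, hr, h⟩ := Coords.exists_algebraMap_mem (I i)
    rw [hI] at h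
    obtain ⟨m, hm⟩ := h
    refine ⟨m, ?_⟩
    rw [hm, ← c.isUnit_iff, c.isUnit_iff, c.nrm_eq, c.ψ_algebraMap]
    simpa using hr
  have hlat : ∀ i, IsRankTwoLattice R (M i) := fun i => isRankTwoLattice_of_isIdealMap (hι i)
  let B₀ : Box 𝔞 :=
    { M := M
      θ := θ
      β := β
      nondegenerate := finrank_partial_dual hι hn hβ }
  have hform : ∀ i, B₀.HasForm i (φ i) := by
    intro i x y hxy j hij
    rw [B₀.thetaAt_eq (j := fun i => planeMap c (ι i))
      (fun w => (hθ _).trans (detTensor_tprod w))]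
    simp only [detMap_wedge, det2_planeMap]
    refine (congrArg (· * _) (hφ i (x i))).trans ?_
    have h2 := c.trilinear_sub (z := 1) ι (β := fun x => (β x : K))
      (fun x => by rw [one_mul]; exact hβ x) x y hij hxy
    rw [c.nrm_one, one_mul] at h2
    exact (neg_eq_iff_eq_neg.2 h2).symm
  let B : BoxOver α :=
    { B₀ with
      smul_balanced := by
        intro s x i j
        have h2 : ∀ i, (β (Function.update x i (s • x i)) : K) = volK α 1 (s • ∏ i, ι i (x i)) := by
          intro i
          rw [hβ, ← Finset.mul_prod_erase _ _ (Finset.mem_univ i),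
            ← Finset.mul_prod_erase _ (fun i => ι i (x i)) (Finset.mem_univ i),
            Function.update_self, map_smul, smul_mul_assoc]
          congr 3
          refine Finset.prod_congr rfl fun k hk => ?_
          rw [Function.update_of_ne (Finset.ne_of_mem_erase hk)]
        exact Subtype.ext ((h2 i).trans (h2 j).symm)
      form := φ
      hasForm := hform
      wedge_smul := fun i s ω => wedge_smul_of_norm_form (hι i) (hφ i) s ω }
  refine ⟨⟨B, fun i => ?_⟩, ι, ⟨hι, hβ, fun x y => ?_⟩, hI⟩
  · change IsPrimitive (φ i)
    rw [isPrimitive_iff (hι i).planeMap_injective (hι i).isLat_range]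
    refine (span_detMapK_φ c (B.formOver i) (ι i)).trans ?_
    rw [range_planeMap]
    change c.nI (LinearMap.range (ι i)) = c.vI (LinearMap.range (ι i))
    rw [← hI, c.nI_eq_vI]
  · refine (hθ _).trans ((detTensor_tprod _).trans ?_)
    simp only [detMap_wedge, det2_planeMap]

end Construction

end IdealBoxes

/-! ### Classes of boxes and pairs of ideal classes. -/

section BoxClasses

variable {R K : Type u} [CommRing R] [IsDedekindDomain R] [Field K] [Algebra R K]
  [IsFractionRing R K] {𝔞 : (FractionalIdeal R⁰ K)ˣ}
  {S : Type u} [CommRing S] [Algebra R S] [IsRankTwoLattice R S]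
  {α : ⋀[R]^2 S ≃ₗ[R] idealModule 𝔞}

theorem exists_primBoxOver_isEmb (c : Coords α) {I : Fin 3 → InvIdeal R K S} (h1 : ∏ i, I i = 1) :
    ∃ (B : PrimBoxOver α) (ι : _), B.1.IsEmb c ι ∧ ∀ i, (I i).val = LinearMap.range (ι i) :=
  exists_primBoxOver_of_isIdealMap (fun i => isIdealMap_subtype c (I i))
    (fun i => (Submodule.range_subtype _).symm) h1

/-- Every balanced triple of invertible ideals gives a primitive box belonging to `S`. -/
theorem exists_primBoxOver_isBoxOf (c : Coords α) {I : Fin 3 → InvIdeal R K S}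
    (h : IsBalanced α fun i => (I i : Submodule S (Total (R := R) K S))) :
    ∃ B : PrimBoxOver α, B.1.IsBoxOf fun i => (I i : Submodule S (Total (R := R) K S)) := by
  obtain ⟨B, ι, hι, hI⟩ := exists_primBoxOver_isEmb c ((c.isBalanced_iff I).1 h)
  exact ⟨B, hι.isBoxOf hI⟩

/-- Every primitive box belonging to `S` is the box of a balanced triple of invertible ideals. -/
theorem PrimBoxOver.exists_isBoxOf (c : Coords α) (B : PrimBoxOver α) :
    ∃ I : Fin 3 → InvIdeal R K S,
      (IsBalanced α fun i => (I i : Submodule S (Total (R := R) K S))) ∧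
        B.1.IsBoxOf fun i => (I i : Submodule S (Total (R := R) K S)) := by
  obtain ⟨ι, hι⟩ := B.exists_isEmb c
  obtain ⟨I, hI, h1⟩ := hι.exists_ideal B.2
  exact ⟨I, (c.isBalanced_iff I).2 h1, hι.isBoxOf hI⟩

theorem exists_map_of_linearEquiv (c : Coords α) {M : Type u} [AddCommGroup M] [Module R M]
    [Module S M] [IsScalarTower R S M] (I : InvIdeal R K S)
    {N : Submodule S (Total (R := R) K S)} (hN : N = I.val) (f : M ≃ₗ[S] N) :
    ∃ ι : M →ₗ[S] Total (R := R) K S, IsIdealMap c ι ∧ I.val = LinearMap.range ι ∧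
      ∀ x, ι x = f x := by
  have hr : LinearMap.range (N.subtype.comp f.toLinearMap) = N := by
    rw [LinearMap.range_comp, LinearEquiv.range, Submodule.map_top, Submodule.range_subtype]
  refine ⟨N.subtype.comp f.toLinearMap, ⟨Subtype.val_injective.comp f.injective, ?_⟩,
    (hr.trans hN).symm, fun _ => rfl⟩
  rw [hr, hN]
  exact c.isLat I

theorem BoxOver.IsBoxOf.exists_isEmb (c : Coords α) {B : BoxOver α} {I : Fin 3 → InvIdeal R K S}
    (h : B.IsBoxOf fun i => (I i : Submodule S (Total (R := R) K S))) :
    ∃ ι, B.IsEmb c ι ∧ ∀ i, (I i).val = LinearMap.range (ι i) := by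
  obtain ⟨f, hβ, hθ⟩ := h
  have h1 := fun i => exists_map_of_linearEquiv c (I i) rfl (f i)
  choose ι hι hr hf using h1
  refine ⟨ι, ⟨hι, fun x => ?_, fun x y => ?_⟩, hr⟩
  · rw [hβ]; simp only [hf]
  · rw [hθ]; simp only [hf]

theorem IsIdealMap.exists_linearEquiv {c : Coords α} {M N : Type u} [AddCommGroup M] [Module R M]
    [Module S M] [IsScalarTower R S M] [AddCommGroup N] [Module R N] [Module S N]
    [IsScalarTower R S N] {ι : M →ₗ[S] Total (R := R) K S} {ι' : N →ₗ[S] Total (R := R) K S}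
    (hι : IsIdealMap c ι) (hι' : IsIdealMap c ι') {I J : InvIdeal R K S}
    (hI : I.val = LinearMap.range ι) (hJ : J.val = LinearMap.range ι')
    {z : Total (R := R) K S} (hz : IsUnit z) (h : ∀ x, x ∈ J.val ↔ ∃ y ∈ I.val, z * y = x) :
    ∃ f : M ≃ₗ[S] N, ∀ x, ι' (f x) = z * ι x := by
  have hr : LinearMap.range ((LinearMap.mulLeft S z).comp ι) = LinearMap.range ι' := by
    rw [← hJ]
    ext x
    rw [h, hI]
    exact ⟨fun ⟨m, hm⟩ => ⟨_, ⟨m, rfl⟩, hm⟩, fun ⟨_, ⟨m, hm⟩, e⟩ => ⟨m, by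
      rw [← e, ← hm]; rfl⟩⟩
  let f : M ≃ₗ[S] N := (LinearEquiv.ofInjective _ (hι.mul_left hz).injective).trans
    ((LinearEquiv.ofEq _ _ hr).trans (LinearEquiv.ofInjective ι' hι'.injective).symm)
  refine ⟨f, fun x => ?_⟩
  have h1 : LinearEquiv.ofInjective ι' hι'.injective (f x) = LinearEquiv.ofEq _ _ hr
      (LinearEquiv.ofInjective _ (hι.mul_left hz).injective x) := LinearEquiv.apply_symm_apply _ _
  exact congrArg Subtype.val h1

/-- Scalars with product 1 leave the product in β unchanged, and multiply the volumes in θ by norms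
whose product is 1. -/
theorem BoxOver.IsEmb.isomorphic {c : Coords α} {B C : BoxOver α}
    {ι : ∀ i, B.M i →ₗ[S] Total (R := R) K S} {ι' : ∀ i, C.M i →ₗ[S] Total (R := R) K S}
    (hι : B.IsEmb c ι) (hι' : C.IsEmb c ι') (z : Fin 3 → Total (R := R) K S)
    (hz : ∏ i, z i = 1) (h : ∀ i, ∃ f : B.M i ≃ₗ[S] C.M i, ∀ x, ι' i (f x) = z i * ι i x) :
    B.Isomorphic C := by
  choose f hf using h
  have hn : ∏ i, c.nrm (z i) = 1 := by
    rw [Fin.prod_univ_three] at hz ⊢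
    rw [← c.nrm_mul, ← c.nrm_mul, hz, c.nrm_one]
  refine ⟨f, fun x => Subtype.ext ?_, ?_⟩
  · refine (hι'.β_eq _).trans (Eq.trans ?_ (hι.β_eq x).symm)
    have e : ∀ i, ι' i ((f i).restrictScalars R (x i)) = z i * ι i (x i) := fun i => hf i _
    simp only [e]
    rw [Finset.prod_mul_distrib, hz, one_mul]
  · have h1 : (C.θ : (⨂[R] i, ⋀[R]^2 (C.M i)) →ₗ[R] idealModule (𝔞 ^ 3)) ∘ₗ
        PiTensorProduct.map (fun i => exteriorPower.map 2
          (((f i).restrictScalars R : B.M i ≃ₗ[R] C.M i) : B.M i →ₗ[R] C.M i)) =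
        (B.θ : (⨂[R] i, ⋀[R]^2 (B.M i)) →ₗ[R] idealModule (𝔞 ^ 3)) := by
      refine tprod_wedge_ext fun x y => Subtype.ext ?_
      rw [LinearMap.comp_apply, PiTensorProduct.map_tprod]
      simp only [map_wedge]
      refine (hι'.θ_eq _ _).trans (Eq.trans ?_ (hι.θ_eq x y).symm)
      have e : ∀ i x, ι' i ((f i).restrictScalars R x) = z i * ι i x := fun i => hf i
      simp only [LinearEquiv.coe_coe, e, c.volK_mul_left]
      rw [Finset.prod_mul_distrib, hn, one_mul]
    intro w
    have h2 := LinearMap.congr_fun h1 (⨂ₜ[R] i, w i)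
    rwa [LinearMap.comp_apply, PiTensorProduct.map_tprod] at h2

/-- The third ideal is the inverse of the product of the other two, so scalars z and w for the first
two places leave (zw)⁻¹ for the third, as required for a product equal to 1. -/
theorem PrimBoxOver.isomorphic_of_mk_eq (c : Coords α) {B C : PrimBoxOver α}
    {ι : ∀ i, B.1.M i →ₗ[S] Total (R := R) K S} {ι' : ∀ i, C.1.M i →ₗ[S] Total (R := R) K S}
    (hι : B.1.IsEmb c ι) (hι' : C.1.IsEmb c ι') {I J : Fin 3 → InvIdeal R K S}
    (hI : ∀ i, (I i).val = LinearMap.range (ι i)) (hJ : ∀ i, (J i).val = LinearMap.range (ι' i))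
    (hI1 : ∏ i, I i = 1) (hJ1 : ∏ i, J i = 1) (h0 : Pic.mk (I 0) = Pic.mk (J 0))
    (h1 : Pic.mk (I 1) = Pic.mk (J 1)) : B.1.Isomorphic C.1 := by
  rw [Coords.mk_eq_mk_iff_principal] at h0 h1
  obtain ⟨z, hz⟩ := h0
  obtain ⟨w, hw⟩ := h1
  have h2 : Coords.principal R K S (z * w)⁻¹ * I 2 = J 2 := by
    rw [Fin.prod_univ_three] at hI1 hJ1
    rw [eq_inv_of_mul_eq_one_right hI1, eq_inv_of_mul_eq_one_right hJ1, ← hz, ← hw, map_inv,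
      map_mul, ← mul_inv, mul_mul_mul_comm]
  let t : Fin 3 → (Total (R := R) K S)ˣ := ![z, w, (z * w)⁻¹]
  have ht : ∀ i, Coords.principal R K S (t i) * I i = J i := by
    intro i; fin_cases i
    exacts [hz, hw, h2]
  refine hι.isomorphic hι' (fun i => (t i : Total (R := R) K S)) ?_ fun i => ?_
  · rw [Fin.prod_univ_three, ← Units.val_mul, ← Units.val_mul, ← Units.val_one]
    exact congrArg _ (mul_inv_cancel _)
  · exact (hι.isIdealMap i).exists_linearEquiv (hι'.isIdealMap i) (hI i) (hJ i) (t i).isUnit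
      ((Coords.principal_mul_eq_iff _ _ _).1 (ht i))

theorem mk_eq_mk_of_linearEquiv (c : Coords α) {M N : Type u} [AddCommGroup M]
    [Module S M] [AddCommGroup N] [Module S N] {ι : M →ₗ[S] Total (R := R) K S}
    {ι' : N →ₗ[S] Total (R := R) K S} (hι : Function.Injective ι) (hι' : Function.Injective ι')
    {I J : InvIdeal R K S} (hI : I.val = LinearMap.range ι) (hJ : J.val = LinearMap.range ι')
    (f : M ≃ₗ[S] N) : Pic.mk I = Pic.mk J :=
  (c.linearEquiv_iff I J).1 ⟨(LinearEquiv.ofEq _ _ hI).trans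
    ((LinearEquiv.ofInjective ι hι).symm.trans (f.trans ((LinearEquiv.ofInjective ι' hι').trans
      (LinearEquiv.ofEq _ _ hJ.symm))))⟩

theorem exists_boxClass_equiv (c : Coords α) :
    ∃ e : BoxClass α ≃ Pic R K S × Pic R K S, ∀ (B : PrimBoxOver α) (I : Fin 3 → InvIdeal R K S),
      (B.1.IsBoxOf fun i => (I i : Submodule S (Total (R := R) K S))) →
        e B.cls = (Pic.mk (I 0), Pic.mk (I 1)) := by
  have h : ∀ B : PrimBoxOver α, ∃ (I : Fin 3 → InvIdeal R K S) (ι : _), B.1.IsEmb c ι ∧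
      (∀ i, (I i).val = LinearMap.range (ι i)) ∧ ∏ i, I i = 1 := fun B => by
    obtain ⟨ι, hι⟩ := B.exists_isEmb c
    obtain ⟨I, hI, h1⟩ := hι.exists_ideal B.2
    exact ⟨I, ι, hι, hI, h1⟩
  choose I ι hι hI h1 using h
  have hmk : ∀ (B C : PrimBoxOver α) {J : Fin 3 → InvIdeal R K S} {ι' : _}, C.1.IsEmb c ι' →
      (∀ i, (J i).val = LinearMap.range (ι' i)) → B.1.Isomorphic C.1 →
      ∀ i, Pic.mk (I B i) = Pic.mk (J i) := by
    rintro B C J ι' hι' hJ ⟨f, -⟩ i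
    exact mk_eq_mk_of_linearEquiv c ((hι B).isIdealMap i).injective (hι'.isIdealMap i).injective
      (hI B i) (hJ i) (f i)
  let e : BoxClass α → Pic R K S × Pic R K S :=
    Quotient.lift (fun B => (Pic.mk (I B 0), Pic.mk (I B 1))) fun B C hBC =>
      Prod.ext (hmk B C (hι C) (hI C) hBC 0) (hmk B C (hι C) (hI C) hBC 1)
  refine ⟨Equiv.ofBijective e ⟨?_, ?_⟩, fun B J hB => ?_⟩
  · rintro ⟨B⟩ ⟨C⟩ hBC
    exact Quotient.sound (PrimBoxOver.isomorphic_of_mk_eq c (hι B) (hι C) (hI B) (hI C) (h1 B)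
      (h1 C) (congrArg Prod.fst hBC) (congrArg Prod.snd hBC))
  · rintro ⟨x, y⟩
    obtain ⟨J, rfl⟩ := QuotientGroup.mk_surjective x
    obtain ⟨J', rfl⟩ := QuotientGroup.mk_surjective y
    obtain ⟨B, ι', hι', hJ⟩ := exists_primBoxOver_isEmb c (I := ![J, J', (J * J')⁻¹])
      (by rw [Fin.prod_univ_three]; exact mul_inv_cancel _)
    -- B is compared with itself in two embeddings: the ideals chosen for B agree with the
    -- prescribed ones up to scaling.
    have h2 := hmk B B hι' hJ ((boxSetoid (α := α)).refl B)
    exact ⟨B.cls, Prod.ext (h2 0) (h2 1)⟩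
  · obtain ⟨ι', hι', hJ⟩ := hB.exists_isEmb c
    have h2 := hmk B B hι' hJ ((boxSetoid (α := α)).refl B)
    exact Prod.ext (h2 0) (h2 1)

/-- The forms of a box have the classes of the ideals of the box. -/
theorem form_cls_eq (c : Coords α) {e : FormClass α ≃ Pic R K S}
    (he : ∀ (F : PrimFormOver α) (I : InvIdeal R K S),
      Nonempty (F.1.M ≃ₗ[S] I.val) → e F.cls = Pic.mk I) (B : PrimBoxOver α)
    {ι : ∀ i, B.1.M i →ₗ[S] Total (R := R) K S} (hι : B.1.IsEmb c ι) {I : Fin 3 → InvIdeal R K S}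
    (hI : ∀ i, (I i).val = LinearMap.range (ι i)) (i : Fin 3) : e (B.form i).cls = Pic.mk (I i) :=
  he (B.form i) (I i) ⟨(LinearEquiv.ofInjective (ι i) (hι.isIdealMap i).injective).trans
    (LinearEquiv.ofEq _ _ (hI i).symm)⟩

/-- The forms of a box have the classes of its ideals, whose product is 1. Conversely, two of the
ideals and the inverse of their product define a box, and the third form has the right class. -/
theorem exists_box_of_forms_iff (c : Coords α) {e : FormClass α ≃ Pic R K S}
    (he : ∀ (F : PrimFormOver α) (I : InvIdeal R K S),
      Nonempty (F.1.M ≃ₗ[S] I.val) → e F.cls = Pic.mk I) (F : Fin 3 → PrimFormOver α) :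
    e (F 0).cls * e (F 1).cls * e (F 2).cls = 1 ↔
      ∃ B : PrimBoxOver α, ∀ i, (B.form i).cls = (F i).cls := by
  constructor
  · intro h
    have h1 := fun i => (F i).exists_ideal c
    choose I hI using h1
    rw [he _ _ (hI 0), he _ _ (hI 1), he _ _ (hI 2)] at h
    have h2 : Pic.mk (I 2) = Pic.mk (I 0 * I 1)⁻¹ := eq_inv_of_mul_eq_one_right h
    obtain ⟨B, ι, hι, hJ⟩ := exists_primBoxOver_isEmb c (I := ![I 0, I 1, (I 0 * I 1)⁻¹])
      (by rw [Fin.prod_univ_three]; exact mul_inv_cancel _)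
    refine ⟨B, fun i => e.injective ?_⟩
    rw [form_cls_eq c he B hι hJ, he _ _ (hI i)]
    fin_cases i
    exacts [rfl, rfl, h2.symm]
  · rintro ⟨B, hB⟩
    obtain ⟨ι, hι⟩ := B.exists_isEmb c
    obtain ⟨I, hI, h1⟩ := hι.exists_ideal B.2
    rw [← hB, ← hB, ← hB, form_cls_eq c he B hι hI, form_cls_eq c he B hι hI,
      form_cls_eq c he B hι hI]
    rw [Fin.prod_univ_three] at h1
    exact congrArg Pic.mk h1

end BoxClasses

/-! ### Isomorphisms of underlying forms and boxes are semilinear. -/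

section Semilinear

variable {R K : Type u} [CommRing R] [IsDedekindDomain R] [Field K] [Algebra R K]
  [IsFractionRing R K] {𝔞 : (FractionalIdeal R⁰ K)ˣ}

/-- An endomorphism of a lattice all of whose vectors are eigenvectors is a scalar. -/
theorem exists_eq_smul_of_det_eq_zero {M : Type u} [AddCommGroup M] [Module R M]
    {j : M →ₗ[R] K × K} (hj : Function.Injective j) (hL : IsLat (LinearMap.range j))
    {g : M →ₗ[R] M} (h : ∀ m, det2 (j m) (j (g m)) = 0) : ∃ k : R, ∀ m, g m = k • m := by
  obtain ⟨x, y, hxy⟩ := smul_det2_ne hL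
  obtain ⟨j', hj', hL', hx, hy⟩ := exists_embedding_basis hj hL hxy
  have h' : ∀ m, det2 (j' m) (j' (g m)) = 0 := by
    intro m
    have h1 := map_mul_det2 hj hL (detMap j') x y (wedge R m (g m))
    rw [detMap_wedge, detMap_wedge, detMap_wedge, h, mul_zero] at h1
    exact (mul_eq_zero.1 h1).resolve_right hxy
  have hx2 := h' x
  have hy2 := h' y
  have hxy2 := h' (x + y)
  rw [map_add, map_add, map_add] at hxy2
  simp only [det2, hx, hy, Prod.fst_add, Prod.snd_add] at hx2 hy2 hxy2
  -- That x, y and x + y are all eigenvectors forces a common eigenvalue.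
  have e1 : (j' (g x)).2 = 0 := by linear_combination hx2
  have e2 : (j' (g y)).1 = 0 := by linear_combination -hy2
  have e3 : (j' (g y)).2 = (j' (g x)).1 := by linear_combination hxy2 - e1 + e2
  obtain ⟨a, ha⟩ : ∃ a, (j' (g x)).1 = a := ⟨_, rfl⟩
  have hg : ∀ m, j' (g m) = a • j' m := by
    intro m
    obtain ⟨r, hr, s, t, hm⟩ := exists_smul_eq_add hj' hL' (x := x) (y := y)
      (by rw [hx, hy]; simp [det2]) m
    refine smul_right_injective (K × K) hr ?_
    change r • j' (g m) = r • (a • j' m)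
    rw [smul_comm r a, ← map_smul, ← map_smul, ← map_smul, hm, map_add, map_add, map_add, map_smul,
      map_smul, map_smul, map_smul, map_smul, map_smul, hx, hy]
    ext
    · simp [e2, ha, Algebra.smul_def, mul_comm]
    · simp [e1, e3, ha, Algebra.smul_def, mul_comm]
  -- The eigenvalue lies a priori in K, but multiplication by it preserves the lattice.
  have h1 : a ∈ (1 : Submodule R K) := hL'.mem_one_of_smul (by
    rintro _ ⟨m, rfl⟩
    exact ⟨g m, hg m⟩)
  obtain ⟨k, hk⟩ := Submodule.mem_one.1 h1
  refine ⟨k, fun m => hj' ?_⟩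
  rw [hg, map_smul, ← hk, algebraMap_smul]

variable {S : Type u} [CommRing S] [Algebra R S] {α : ⋀[R]^2 S ≃ₗ[R] idealModule 𝔞}

/-- In S_K this is the rule that multiplication by m scales volumes by N(m). It recovers the whole
orientation of S from a nonzero value of the form. -/
theorem FormOver.wedge_smul_smul (c : Coords α) {F : FormOver α} (hF : IsPrimitive F.φ) (s t : S)
    (m : F.M) : (1 : K) ⊗ₜ[R] wedge R (s • m) (t • m) =
      vol α s t • (F.φ m : K ⊗[R] ⋀[R]^2 F.M) := by
  obtain ⟨ω, hω⟩ := exists_φ_ne_zero F.toForm hF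
  obtain ⟨ι, hι, -⟩ := F.exists_isIdealMap c hω
  apply detMapK_injective hι.planeMap_injective hι.isLat_range
  rw [detMapK_tmul, detMap_wedge, det2_planeMap, one_mul, ι.map_smul, ι.map_smul,
    (detMapK _).map_smul, F.detMapK_φ, Coords.smul_eq, Coords.smul_eq, mul_comm (s ⊗ₜ[R] (1 : K)),
    mul_comm (t ⊗ₜ[R] (1 : K)), c.volK_mul_left, volK_tmul, mul_one, mul_one, smul_eq_mul, mul_comm]

section Transport

variable [IsRankTwoLattice R S] {S' : Type u} [CommRing S'] [Algebra R S'] [IsRankTwoLattice R S']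
  {α' : ⋀[R]^2 S' ≃ₗ[R] idealModule 𝔞} (c : Coords α) (c' : Coords α')

theorem FormOver.ext_of_forall_smul (c : Coords α) {F : FormOver α} (hF : IsPrimitive F.φ) {s t : S}
    (h : ∀ m : F.M, s • m = t • m) : s = t := by
  obtain ⟨ω, hω⟩ := exists_φ_ne_zero F.toForm hF
  exact sub_eq_zero.1 (F.smul_injective c hω (by rw [sub_smul, h, sub_self]))

theorem Form.IsIso.tmul_wedge {F : FormOver α} {G : FormOver α'} {f : F.M ≃ₗ[R] G.M}
    (hf : Form.IsIso F.toForm G.toForm f) {m m' : F.M} {k : K}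
    (h : (1 : K) ⊗ₜ[R] wedge R m m' = k • (F.φ m : K ⊗[R] ⋀[R]^2 F.M)) :
    (1 : K) ⊗ₜ[R] wedge R (f m) (f m') = k • (G.φ (f m) : K ⊗[R] ⋀[R]^2 G.M) := by
  rw [hf m, ← LinearMap.baseChange_eq_ltensor, ← (LinearMap.baseChange K _).map_smul, ← h,
    LinearMap.baseChange_tmul, map_wedge]
  rfl

/-- Choose t ∈ S' with α'(1 ∧ t) = α(1 ∧ s). Since f respects the forms, f s f⁻¹ and t have the same
wedge n ∧ (·)n for every vector n, so their difference has every vector as eigenvector and is a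
scalar k ∈ R. Then s' = t + k. -/
theorem FormOver.exists_smul_eq_map {F : FormOver α} {G : FormOver α'} {f : F.M ≃ₗ[R] G.M}
    (hf : Form.IsIso F.toForm G.toForm f) (s : S) : ∃ s' : S', ∀ m, f (s • m) = s' • f m := by
  obtain ⟨c⟩ := exists_coords (K := K) α
  obtain ⟨c'⟩ := exists_coords (K := K) α'
  obtain ⟨t, ht⟩ := c'.exists_ω (a := vol α 1 s) (SetLike.coe_mem _)
  have ht' : vol α' 1 t = vol α 1 s := by rw [c'.vol_one, ht]
  obtain ⟨j, hj, hL⟩ := exists_embedding R K G.M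
  let g : G.M →ₗ[R] G.M := (f : F.M →ₗ[R] G.M) ∘ₗ (Algebra.lsmul R R F.M s) ∘ₗ
    (f.symm : G.M →ₗ[R] F.M) - Algebra.lsmul R R G.M t
  have hg : ∀ m, g (f m) = f (s • m) - t • f m := fun m => by
    change f (s • f.symm (f m)) - t • f m = _
    rw [f.symm_apply_apply]
  have h0 : ∀ n, det2 (j n) (j (g n)) = 0 := by
    intro n
    obtain ⟨m, rfl⟩ := f.surjective n
    have h1 := congrArg (detMapK j) (hf.tmul_wedge (F.wedge_smul s m))
    have h2 := congrArg (detMapK j) (G.wedge_smul t (f m))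
    rw [detMapK_tmul, one_mul, detMap_wedge] at h1 h2
    rw [ht', ← h1] at h2
    rw [hg, map_sub, sub_eq_add_neg, det2_add_right, ← neg_one_smul R, det2_smul_right, h2]
    simp
  obtain ⟨k, hk⟩ := exists_eq_smul_of_det_eq_zero hj hL h0
  refine ⟨t + algebraMap R S' k, fun m => ?_⟩
  rw [add_smul, algebraMap_smul, ← hk, hg]
  abel

/-- An isomorphism of the underlying forms of primitive forms is semilinear. -/
theorem exists_semilinear {F : PrimFormOver α} {G : PrimFormOver α'} {f : F.1.M ≃ₗ[R] G.1.M}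
    (hf : Form.IsIso F.1.toForm G.1.toForm f) : ∃ σ : S ≃ₐ[R] S', PreservesOrientation α α' σ ∧
      ∀ (s : S) (m : F.1.M), f (s • m) = σ s • f m := by
  obtain ⟨c⟩ := exists_coords (K := K) α
  obtain ⟨c'⟩ := exists_coords (K := K) α'
  have h1 := FormOver.exists_smul_eq_map hf
  have h2 := FormOver.exists_smul_eq_map hf.symm
  choose σ hσ using h1
  choose τ hτ using h2
  -- S' acts faithfully on the lattice of G, so every property of σ can be checked on vectors f m.
  have ext' : ∀ s t : S', (∀ m, s • f m = t • f m) → s = t := fun s t h =>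
    FormOver.ext_of_forall_smul c' G.2 fun n => by
      obtain ⟨m, rfl⟩ := f.surjective n
      exact h m
  let σ' : S ≃ₐ[R] S' :=
    { toFun := σ
      invFun := τ
      left_inv := fun s => FormOver.ext_of_forall_smul c F.2 fun m => by
        rw [← f.symm_apply_apply m, ← hτ, ← hσ, f.symm_apply_apply, f.symm_apply_apply]
      right_inv := fun s => ext' _ _ fun m => by
        rw [← hσ, ← f.symm_apply_apply m, ← hτ, f.apply_symm_apply, f.symm_apply_apply]
      map_mul' := fun s t => ext' _ _ fun m => by
        rw [← hσ, mul_smul, hσ, hσ, mul_smul]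
      map_add' := fun s t => ext' _ _ fun m => by
        rw [← hσ, add_smul, map_add, hσ, hσ, add_smul]
      commutes' := fun r => ext' _ _ fun m => by
        rw [← hσ, algebraMap_smul, algebraMap_smul, map_smul] }
  refine ⟨σ', fun s t => ?_, hσ⟩
  obtain ⟨ω, hω⟩ := exists_φ_ne_zero G.1.toForm G.2
  obtain ⟨m, rfl⟩ := f.surjective ω
  have e1 := congrArg (LinearMap.baseChange K (exteriorPower.map 2 (f : F.1.M →ₗ[R] G.1.M)))
    (FormOver.wedge_smul_smul c F.2 s t m)
  rw [LinearMap.baseChange_tmul, map_wedge, (LinearMap.baseChange K _).map_smul,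
    LinearMap.baseChange_eq_ltensor, ← hf m] at e1
  have e2 := FormOver.wedge_smul_smul c' G.2 (σ s) (σ t) (f m)
  rw [← hσ, ← hσ] at e2
  exact smul_left_injective K (fun h => hω (Subtype.ext h)) (e2.symm.trans e1)

end Transport

variable [IsRankTwoLattice R S]

/-- Orientation preserving automorphisms are trivial if `2 ≠ 0`. -/
theorem PreservesOrientation.eq_id (h2 : (2 : R) ≠ 0) {σ : S ≃ₐ[R] S}
    (hσ : PreservesOrientation α α σ) (s : S) : σ s = s := by
  obtain ⟨c⟩ := exists_coords (K := K) α
  have h2' : (2 : K) ≠ 0 := by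
    rw [← map_ofNat (algebraMap R K) 2, Ne, map_eq_zero_iff _ (IsFractionRing.injective R K)]
    exact h2
  have him : ∀ s, (c.ψ (σ s ⊗ₜ[R] (1 : K))).im = (c.ψ (s ⊗ₜ[R] (1 : K))).im := fun s => by
    have := hσ 1 s
    rwa [map_one, c.vol_one, c.vol_one] at this
  have hm : ∀ s : S, (s * s) ⊗ₜ[R] (1 : K) = (s ⊗ₜ[R] (1 : K)) * (s ⊗ₜ[R] (1 : K)) := fun s => by
    rw [Algebra.TensorProduct.tmul_mul_tmul, one_mul]
  -- The ω-coordinate of s² is 2 re(s) im(s) + q im(s)². Since σ preserves ω-coordinates, it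
  -- preserves 2 re(s) im(s), hence re(s) when im(s) ≠ 0.
  have key : ∀ s, (c.ψ (s ⊗ₜ[R] (1 : K))).im ≠ 0 → σ s = s := by
    intro s hs
    have h := him (s * s)
    rw [map_mul, hm, hm, map_mul, map_mul, QuadraticAlgebra.im_mul, QuadraticAlgebra.im_mul,
      him] at h
    refine c.tmul_one_injective (c.ψ.injective (QuadraticAlgebra.ext ?_ (him s)))
    refine mul_right_cancel₀ (mul_ne_zero h2' hs) ?_
    linear_combination h
  by_cases hs : (c.ψ (s ⊗ₜ[R] (1 : K))).im = 0
  · obtain ⟨t, ht⟩ := c.exists_vol_ne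
    rw [c.vol_one] at ht
    -- An s without ω-coordinate is treated by adding an element that has one.
    have h1 := key (s + t) (by
      rw [TensorProduct.add_tmul, map_add, QuadraticAlgebra.im_add, hs, zero_add]; exact ht)
    rw [map_add, key t ht] at h1
    exact add_right_cancel h1
  · exact key s hs

theorem form_cls_eq_of_isIso (h2 : (2 : R) ≠ 0) {F G : PrimFormOver α} {f : F.1.M ≃ₗ[R] G.1.M}
    (hf : Form.IsIso F.1.toForm G.1.toForm f) : F.cls = G.cls := by
  obtain ⟨σ, hσ, h⟩ := exists_semilinear hf
  refine Quotient.sound ⟨{ f with map_smul' := fun s m => ?_ }, hf⟩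
  have := h s m
  rwa [hσ.eq_id h2] at this

theorem BoxOver.IsEmb.θ_tprod {B : BoxOver α} {c : Coords α}
    {ι : ∀ i, B.M i →ₗ[S] Total (R := R) K S} (h : B.IsEmb c ι) (w : ∀ i, ⋀[R]^2 (B.M i)) :
    (B.θ (⨂ₜ[R] i, w i) : K) = ∏ i, detMap (planeMap c (ι i)) (w i) := by
  have h3 : (idealModule (𝔞 ^ 3)).subtype.comp
      (B.θ : (⨂[R] i, ⋀[R]^2 (B.M i)) →ₗ[R] idealModule (𝔞 ^ 3)) =
        detTensor fun i => planeMap c (ι i) := by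
    refine tprod_wedge_ext fun x y => ?_
    simp only [detTensor_tprod, detMap_wedge, det2_planeMap]
    exact h.θ_eq x y
  exact (LinearMap.congr_fun h3 _).trans (detTensor_tprod w)

theorem thetaAt_map {B C : Box 𝔞} {f : ∀ i, B.M i ≃ₗ[R] C.M i} (hf : B.IsIso C f) (i : Fin 3)
    (w : ∀ i, ⋀[R]^2 (B.M i)) (v : K ⊗[R] ⋀[R]^2 (B.M i)) :
    C.thetaAt i (fun k => exteriorPower.map 2 (f k : B.M k →ₗ[R] C.M k) (w k))
      ((exteriorPower.map 2 (f i : B.M i →ₗ[R] C.M i)).lTensor K v) = B.thetaAt i w v := by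
  induction v using TensorProduct.induction_on with
  | zero => rw [map_zero, map_zero, map_zero]
  | add v v' h h' => rw [map_add, map_add, h, h', map_add]
  | tmul k v =>
    rw [LinearMap.lTensor_tmul, Box.thetaAt_tmul, Box.thetaAt_tmul, ← hf.2]
    congr 4
    funext l
    exact (Function.apply_update (fun l => exteriorPower.map 2 (f l : B.M l →ₗ[R] C.M l)) w i v
      l).symm

theorem thetaAt_hasForm {B C : Box 𝔞} {f : ∀ i, B.M i ≃ₗ[R] C.M i} (hf : B.IsIso C f) {i : Fin 3}
    {φ : QuadraticMap R (B.M i) (twist 𝔞 (B.M i))} (hφ : B.HasForm i φ)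
    {φ' : QuadraticMap R (C.M i) (twist 𝔞 (C.M i))} (hφ' : C.HasForm i φ')
    (x y : ∀ i, B.M i) (hxy : x i = y i) :
    C.thetaAt i (fun k => wedge R (f k (x k)) (f k (y k)))
        (φ' (f i (x i)) : K ⊗[R] ⋀[R]^2 (C.M i)) =
      C.thetaAt i (fun k => wedge R (f k (x k)) (f k (y k)))
        ((exteriorPower.map 2 (f i : B.M i →ₗ[R] C.M i)).lTensor K
          (φ (x i) : K ⊗[R] ⋀[R]^2 (B.M i))) := by
  obtain ⟨j, hj⟩ : ∃ j, j ≠ i := ⟨i + 1, by fin_cases i <;> decide⟩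
  have hB := hφ x y hxy j hj
  have hC := hφ' (fun k => f k (x k)) (fun k => f k (y k)) (by rw [hxy]) j hj
  have hu : ∀ (u v : ∀ i, B.M i), Function.update (fun k => f k (u k)) j (f j (v j)) =
      fun k => f k (Function.update u j (v j) k) := fun u v =>
    funext fun k => (Function.apply_update (fun k => f k) u j (v j) k).symm
  rw [hu, hu, hf.1, hf.1, hf.1, hf.1, ← hB, ← thetaAt_map hf] at hC
  simp only [map_wedge, LinearEquiv.coe_coe] at hC
  exact hC

/-- In coordinates `thetaAt` is the determinant times the volumes at the other two places; when
these are nonzero it is injective, so the equation defining the form determines it. -/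
theorem BoxOver.IsEmb.eq_of_thetaAt_eq {C : BoxOver α} {c : Coords α}
    {ι : ∀ i, C.M i →ₗ[S] Total (R := R) K S} (hι : C.IsEmb c ι) {i : Fin 3} {x y : ∀ i, C.M i}
    (hxy : ∀ k, k ≠ i → volK α (ι k (x k)) (ι k (y k)) ≠ 0) {v w : K ⊗[R] ⋀[R]^2 (C.M i)}
    (h : C.thetaAt i (fun k => wedge R (x k) (y k)) v =
      C.thetaAt i (fun k => wedge R (x k) (y k)) w) : v = w := by
  rw [C.toBox.thetaAt_eq hι.θ_tprod, C.toBox.thetaAt_eq hι.θ_tprod] at h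
  have h0 : ∏ k ∈ Finset.univ.erase i, detMap (planeMap c (ι k))
      (wedge R (x k) (y k)) ≠ 0 := Finset.prod_ne_zero_iff.2 fun k hk => by
    rw [detMap_wedge, det2_planeMap]
    exact hxy k (Finset.ne_of_mem_erase hk)
  exact detMapK_injective (hι.isIdealMap i).planeMap_injective (hι.isIdealMap i).isLat_range
    (mul_right_cancel₀ h0 h)

/-- An isomorphism of boxes induces isomorphisms of their forms. -/
theorem form_map_eq {B C : PrimBoxOver α} {f : ∀ i, B.1.M i ≃ₗ[R] C.1.M i}
    (hf : Box.IsIso B.1.toBox C.1.toBox f) (i : Fin 3) (m : B.1.M i) :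
    (C.1.form i (f i m) : K ⊗[R] ⋀[R]^2 (C.1.M i)) =
      (exteriorPower.map 2 (f i : B.1.M i →ₗ[R] C.1.M i)).lTensor K
        (B.1.form i m : K ⊗[R] ⋀[R]^2 (B.1.M i)) := by
  obtain ⟨c⟩ := exists_coords (K := K) α
  obtain ⟨ι, hι⟩ := C.exists_isEmb c
  have h1 : ∀ i, ∃ a b, volK α (ι i (f i a)) (ι i (f i b)) ≠ 0 := fun i => by
    obtain ⟨_, ⟨x, rfl⟩, _, ⟨y, rfl⟩, h⟩ := (hι.isIdealMap i).isLat_range.exists_det_ne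
    rw [det2_planeMap] at h
    exact ⟨(f i).symm x, (f i).symm y, by
      rwa [LinearEquiv.apply_symm_apply, LinearEquiv.apply_symm_apply]⟩
  choose a b hab using h1
  obtain ⟨x, hxi, hx⟩ : ∃ x : ∀ i, B.1.M i, x i = m ∧ ∀ l, l ≠ i → x l = a l :=
    ⟨Function.update a i m, Function.update_self _ _ _, fun l hl => Function.update_of_ne hl _ _⟩
  obtain ⟨y, hyi, hy⟩ : ∃ y : ∀ i, B.1.M i, y i = m ∧ ∀ l, l ≠ i → y l = b l :=
    ⟨Function.update b i m, Function.update_self _ _ _, fun l hl => Function.update_of_ne hl _ _⟩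
  have h2 := thetaAt_hasForm hf (B.1.hasForm i) (C.1.hasForm i) x y (hxi.trans hyi.symm)
  rw [hxi] at h2
  refine hι.eq_of_thetaAt_eq (x := fun k => f k (x k)) (y := fun k => f k (y k)) (fun k hk => ?_) h2
  rw [hx k hk, hy k hk]
  exact hab k

theorem Coords.eq_zero_of_forall_im (c : Coords α) {z : Total (R := R) K S}
    (h : ∀ s : S, (c.ψ (s • z)).im = 0) : z = 0 := by
  have him := h 1
  rw [one_smul] at him
  obtain ⟨t, ht⟩ := c.exists_vol_ne
  rw [c.vol_one] at ht
  have h1 := h t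
  rw [Coords.smul_eq, map_mul, QuadraticAlgebra.im_mul, him] at h1
  apply c.ψ.injective
  rw [map_zero]
  refine QuadraticAlgebra.ext ?_ him
  have h2 : (c.ψ (t ⊗ₜ[R] (1 : K))).im * (c.ψ z).re = 0 := by linear_combination h1
  exact (mul_eq_zero.1 h2).resolve_left ht

/-- At vectors of nonzero norm the product u of the three embedded entries is a unit of S_K. The
hypothesis makes (s − t)u orthogonal to S in the nondegenerate pairing, so s = t. -/
theorem smul_eq_of_forall_β (c : Coords α) (C : PrimBoxOver α) {i : Fin 3} {s t : S}
    (h : ∀ y : ∀ i, C.1.M i, C.1.β (Function.update y i (s • y i)) =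
      C.1.β (Function.update y i (t • y i))) : s = t := by
  obtain ⟨ι, hι⟩ := C.exists_isEmb c
  have h1 : ∀ i, ∃ m, c.nrm (ι i m) ≠ 0 := fun i =>
    FormOver.exists_nrm_ne c (F := C.1.formOver i) (C.2 i) (hι.isIdealMap i)
  choose m hm using h1
  have hupd : ∀ (s : S) (y : ∀ i, C.1.M i),
      ∏ k, ι k (Function.update y i (s • y i) k) = s • ∏ k, ι k (y k) := by
    intro s y
    rw [← Finset.mul_prod_erase _ _ (Finset.mem_univ i),
      ← Finset.mul_prod_erase _ (fun i => ι i (y i)) (Finset.mem_univ i),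
      Function.update_self, map_smul, smul_mul_assoc]
    congr 2
    refine Finset.prod_congr rfl fun k hk => ?_
    rw [Function.update_of_ne (Finset.ne_of_mem_erase hk)]
  have hu : IsUnit (∏ k, ι k (m k)) := by
    rw [Fin.prod_univ_three, c.isUnit_iff, c.nrm_mul, c.nrm_mul]
    exact mul_ne_zero (mul_ne_zero (hm 0) (hm 1)) (hm 2)
  have h0 : (s - t) • ∏ k, ι k (m k) = 0 := by
    refine c.eq_zero_of_forall_im fun r => ?_
    have e := congrArg Subtype.val (h (Function.update m i (r • m i)))
    rw [hι.β_eq, hι.β_eq, hupd s, hupd t, hupd r, c.volK_one, c.volK_one] at e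
    rw [smul_comm, sub_smul, map_sub, QuadraticAlgebra.im_sub, e, sub_self]
  rw [Coords.smul_eq, hu.mul_left_eq_zero] at h0
  exact sub_eq_zero.1 (c.tmul_one_injective (by simpa using h0))

/-- An isomorphism of the underlying boxes of primitive boxes is semilinear. -/
theorem exists_semilinear_box {B C : PrimBoxOver α} {f : ∀ i, B.1.M i ≃ₗ[R] C.1.M i}
    (hf : Box.IsIso B.1.toBox C.1.toBox f) : ∃ σ : S ≃ₐ[R] S, PreservesOrientation α α σ ∧
      ∀ (i : Fin 3) (s : S) (m : B.1.M i), f i (s • m) = σ s • f i m := by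
  obtain ⟨c⟩ := exists_coords (K := K) α
  have h1 : ∀ i, ∃ σ : S ≃ₐ[R] S, PreservesOrientation α α σ ∧
      ∀ (s : S) (m : B.1.M i), f i (s • m) = σ s • f i m := fun i =>
    exists_semilinear (F := B.form i) (G := C.form i) (form_map_eq hf i)
  choose σ hσ h using h1
  refine ⟨σ 0, hσ 0, fun i s m => ?_⟩
  have h2 : σ i s = σ 0 s := by
    refine smul_eq_of_forall_β c C (i := i) fun y => ?_
    -- The three forms give a priori three automorphisms. Moving s between places is allowed in both
    -- boxes, so `σ i s` and `σ 0 s` have the same effect on the trilinear form.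
    have h3 : ∀ i, C.1.β (Function.update y i (σ i s • y i)) =
        B.1.β (Function.update (fun k => (f k).symm (y k)) i (s • (f i).symm (y i))) := by
      intro i
      rw [← hf.1]
      congr 1
      funext k
      by_cases hk : k = i
      · subst hk
        rw [Function.update_self, Function.update_self, h, LinearEquiv.apply_symm_apply]
      · rw [Function.update_of_ne hk, Function.update_of_ne hk, LinearEquiv.apply_symm_apply]
    rw [h3, C.1.smul_balanced _ y i 0, h3]
    exact B.1.smul_balanced s (fun k => (f k).symm (y k)) i 0
  rw [h, h2]

theorem box_cls_eq_of_isIso (h2 : (2 : R) ≠ 0) {B C : PrimBoxOver α}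
    {f : ∀ i, B.1.M i ≃ₗ[R] C.1.M i} (hf : Box.IsIso B.1.toBox C.1.toBox f) : B.cls = C.cls := by
  obtain ⟨σ, hσ, h⟩ := exists_semilinear_box hf
  refine Quotient.sound ⟨fun i => { f i with map_smul' := fun s m => ?_ }, hf⟩
  have := h i s m
  rwa [hσ.eq_id h2] at this

end Semilinear

/-! ### The quadratic algebra of a form. -/

section FormAlgebra

variable {R K : Type u} [CommRing R] [IsDedekindDomain R] [Field K] [Algebra R K]
  [IsFractionRing R K] {𝔞 : (FractionalIdeal R⁰ K)ˣ}

/-- A ring action on the plane that preserves a lattice makes the lattice a module. -/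
theorem exists_module_of_action {S : Type u} [CommRing S] [Algebra R S] {M : Type u}
    [AddCommGroup M] [Module R M] {j : M →ₗ[R] K × K} (hj : Function.Injective j)
    (A : S →+* Module.End K (K × K)) (hA : ∀ (r : R) v, A (algebraMap R S r) v = r • v)
    (h : ∀ s m, ∃ m', j m' = A s (j m)) :
    ∃ (_ : Module S M) (_ : IsScalarTower R S M), ∀ (s : S) (m : M), j (s • m) = A s (j m) := by
  choose f hf using h
  let inst : Module S M :=
    { smul := f
      one_smul := fun m => hj (by
        change j (f 1 m) = _
        rw [hf, map_one]; rfl)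
      mul_smul := fun s t m => hj (by
        change j (f (s * t) m) = j (f s (f t m))
        rw [hf, hf, hf, map_mul]; rfl)
      smul_zero := fun s => hj (by
        change j (f s 0) = _
        rw [hf, map_zero, map_zero])
      smul_add := fun s m m' => hj (by
        change j (f s (m + m')) = j (f s m + f s m')
        rw [map_add, hf, hf, hf, map_add, map_add])
      add_smul := fun s t m => hj (by
        change j (f (s + t) m) = j (f s m + f t m)
        rw [map_add, hf, hf, hf, map_add]; rfl)
      zero_smul := fun m => hj (by
        change j (f 0 m) = _
        rw [hf, map_zero, map_zero]; rfl) }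
  refine ⟨inst, ⟨fun r s m => hj ?_⟩, hf⟩
  change j (f (r • s) m) = j (r • f s m)
  rw [hf, j.map_smul, hf, Algebra.smul_def, map_mul]
  exact hA r _

/-- The quadratic maps of a plane lattice in coordinates. -/
theorem exists_coefficients {M : Type u} [AddCommGroup M] [Module R M]
    (φ : QuadraticMap R M (twist 𝔞 M)) {j : M →ₗ[R] K × K} (hj : Function.Injective j)
    (hL : IsLat (LinearMap.range j)) {𝔟 𝔠 : (Submodule R K)ˣ}
    (h : ∀ v : K × K, v ∈ LinearMap.range j ↔ v.1 ∈ 𝔟.val ∧ v.2 ∈ 𝔠.val) :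
    ∃ P Q T : K, ∀ m, detMapK j (φ m : K ⊗[R] ⋀[R]^2 M) =
      P * (j m).1 ^ 2 + Q * (j m).1 * (j m).2 + T * (j m).2 ^ 2 := by
  obtain ⟨b, hb, hb0⟩ := exists_ne_zero_mem 𝔟
  obtain ⟨d, hd, hd0⟩ := exists_ne_zero_mem 𝔠
  obtain ⟨x, hx⟩ := (h (b, 0)).2 ⟨hb, zero_mem _⟩
  obtain ⟨y, hy⟩ := (h (0, d)).2 ⟨zero_mem _, hd⟩
  have hxy : det2 (j x) (j y) ≠ 0 := by
    rw [hx, hy]; simp [det2, hb0, hd0]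
  let D : twist 𝔞 M →ₗ[R] K := ((detMapK j).restrictScalars R).comp (twist 𝔞 M).subtype
  change ∃ P Q T : K, ∀ m, D (φ m) = _
  refine ⟨D (φ x) / b ^ 2, D (QuadraticMap.polar φ x y) / (b * d), D (φ y) / d ^ 2, fun m => ?_⟩
  obtain ⟨r, hr, s, t, hm⟩ := exists_smul_eq_add hj hL hxy m
  have hr' : algebraMap R K r ≠ 0 := by simpa using hr
  have h1 := congrArg (fun m => D (φ m)) hm
  have h2 := congrArg j hm
  rw [map_smul, map_add, map_smul, map_smul, hx, hy] at h2
  have h3 := congrArg Prod.fst h2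
  have h4 := congrArg Prod.snd h2
  simp only [fst_smul_prod, snd_smul_prod, Prod.fst_add, Prod.snd_add, mul_zero, add_zero,
    zero_add] at h3 h4
  have h5 : φ (s • x + t • y) = (s * s) • φ x + (t * t) • φ y +
      (s * t) • QuadraticMap.polar φ x y := by
    rw [QuadraticMap.map_add φ, QuadraticMap.map_smul, QuadraticMap.map_smul,
      QuadraticMap.polar_smul_left, QuadraticMap.polar_smul_right, smul_smul]
  simp only [h5, QuadraticMap.map_smul, map_add, map_smul, Algebra.smul_def, map_mul] at h1
  refine mul_left_cancel₀ (mul_ne_zero hr' hr') ?_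
  have h6 : (j m).1 = algebraMap R K s * b / algebraMap R K r := by
    rw [eq_div_iff hr', mul_comm]; exact h3
  have h7 : (j m).2 = algebraMap R K t * d / algebraMap R K r := by
    rw [eq_div_iff hr', mul_comm]; exact h4
  rw [h1, h6, h7]
  field_simp
  ring

/-- The order `R + 𝔞 ω` in the quadratic algebra `K[ω]`, where `ω² = p + q ω`. -/
def quadraticOrder (𝔞 : (FractionalIdeal R⁰ K)ˣ) (p q : K)
    (hp : ∀ a ∈ idealModule 𝔞, ∀ b ∈ idealModule 𝔞, p * (a * b) ∈ (1 : Submodule R K))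
    (hq : ∀ a ∈ idealModule 𝔞, q * a ∈ (1 : Submodule R K)) :
    Subalgebra R (QuadraticAlgebra K p q) where
  carrier := {z | z.re ∈ (1 : Submodule R K) ∧ z.im ∈ idealModule 𝔞}
  mul_mem' := by
    have h1 : ∀ {x : K} {N : Submodule R K} {y : K}, x ∈ (1 : Submodule R K) → y ∈ N → x * y ∈ N := by
      intro x N y hx hy
      obtain ⟨r, rfl⟩ := Submodule.mem_one.1 hx
      rw [← Algebra.smul_def]
      exact N.smul_mem r hy
    rintro x y ⟨hx, hx'⟩ ⟨hy, hy'⟩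
    constructor
    · rw [QuadraticAlgebra.re_mul, mul_assoc]
      exact add_mem (h1 hx hy) (hp _ hx' _ hy')
    · rw [QuadraticAlgebra.im_mul]
      refine add_mem (add_mem (h1 hx hy') ?_) (h1 (hq _ hx') hy')
      rw [mul_comm]
      exact h1 hy hx'
  add_mem' := fun hx hy => ⟨add_mem hx.1 hy.1, add_mem hx.2 hy.2⟩
  algebraMap_mem' := fun r => ⟨Submodule.mem_one.2 ⟨r, rfl⟩, zero_mem _⟩

section Order

variable {p q : K} {hp : ∀ a ∈ idealModule 𝔞, ∀ b ∈ idealModule 𝔞, p * (a * b) ∈ (1 : Submodule R K)}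
  {hq : ∀ a ∈ idealModule 𝔞, q * a ∈ (1 : Submodule R K)}

/-- The coordinates of the elements of `R + 𝔞 ω`. -/
def orderMap (𝔞 : (FractionalIdeal R⁰ K)ˣ) (p q : K)
    (hp : ∀ a ∈ idealModule 𝔞, ∀ b ∈ idealModule 𝔞, p * (a * b) ∈ (1 : Submodule R K))
    (hq : ∀ a ∈ idealModule 𝔞, q * a ∈ (1 : Submodule R K)) : quadraticOrder 𝔞 p q hp hq →ₗ[R] K × K where
  toFun z := (z.1.re, z.1.im)
  map_add' _ _ := rfl
  map_smul' _ _ := rfl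

theorem orderMap_injective : Function.Injective (orderMap 𝔞 p q hp hq) := by
  intro x y h
  exact Subtype.ext (QuadraticAlgebra.ext (congrArg Prod.fst h) (congrArg Prod.snd h))

theorem mem_range_orderMap (v : K × K) : v ∈ LinearMap.range (orderMap 𝔞 p q hp hq) ↔
    v.1 - 0 * v.2 ∈ ((1 : (Submodule R K)ˣ) : Submodule R K) ∧ v.2 ∈ (idealUnit 𝔞).val := by
  rw [zero_mul, sub_zero]
  exact ⟨fun ⟨z, hz⟩ => hz ▸ z.2, fun h => ⟨⟨⟨v.1, v.2⟩, h⟩, rfl⟩⟩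

theorem isLat_orderMap : IsLat (LinearMap.range (orderMap 𝔞 p q hp hq)) := by
  constructor
  · have h : LinearMap.range (orderMap 𝔞 p q hp hq) = (1 : Submodule R K).prod (idealModule 𝔞) := by
      ext v
      rw [mem_range_orderMap, zero_mul, sub_zero]
      rfl
    rw [h]
    exact (Submodule.fg_unit (1 : (Submodule R K)ˣ)).prod (Submodule.fg_unit (idealUnit 𝔞))
  · obtain ⟨a, ha, ha0⟩ := exists_ne_zero_mem (idealUnit 𝔞)
    have h1 : (1 : K) ∈ (1 : Submodule R K) := Submodule.mem_one.2 ⟨1, map_one _⟩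
    exact ⟨(1, 0), (mem_range_orderMap _).2 ⟨by simpa using h1, zero_mem _⟩, (0, a),
      (mem_range_orderMap _).2 ⟨by simp, ha⟩, by simpa [det2] using ha0⟩

theorem isRankTwoLattice_quadraticOrder : IsRankTwoLattice R (quadraticOrder 𝔞 p q hp hq) :=
  isRankTwoLattice_of_isLat orderMap_injective isLat_orderMap

theorem exists_orientation_quadraticOrder : ∃ α : ⋀[R]^2 (quadraticOrder 𝔞 p q hp hq) ≃ₗ[R] idealModule 𝔞,
    ∀ s t, vol α s t = s.1.re * t.1.im - s.1.im * t.1.re := by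
  have hr : LinearMap.range (detMap (orderMap 𝔞 p q hp hq)) = idealModule 𝔞 := by
    rw [range_detMap, volN_eq mem_range_orderMap, one_mul, val_idealUnit]
  refine ⟨(LinearEquiv.ofInjective _ (detMap_injective orderMap_injective isLat_orderMap)).trans
    (LinearEquiv.ofEq _ _ hr), fun s t => ?_⟩
  exact detMap_wedge (orderMap 𝔞 p q hp hq) s t

end Order

theorem exists_plane_coordinates (M : Type u) [AddCommGroup M] [Module R M] [IsRankTwoLattice R M] :
    ∃ (j : M →ₗ[R] K × K) (𝔟 𝔠 : (Submodule R K)ˣ), Function.Injective j ∧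
      IsLat (LinearMap.range j) ∧
      ∀ v : K × K, v ∈ LinearMap.range j ↔ v.1 ∈ 𝔟.val ∧ v.2 ∈ 𝔠.val := by
  obtain ⟨j, hj, hL⟩ := exists_embedding R K M
  obtain ⟨k, 𝔟, 𝔠, h⟩ := hL.decomp
  let e : K × K →ₗ[R] K × K :=
    { toFun := fun v => (v.1 - k * v.2, v.2)
      map_add' := fun v w => by ext <;> simp; ring
      map_smul' := fun r v => by ext <;> simp [Algebra.smul_def]; ring }
  have he : Function.Injective e := by
    intro v w hvw
    have h1 : (e v).2 = (e w).2 := congrArg Prod.snd hvw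
    have h2 : (e v).1 = (e w).1 := congrArg Prod.fst hvw
    change v.2 = w.2 at h1
    change v.1 - k * v.2 = w.1 - k * w.2 at h2
    rw [h1] at h2
    exact Prod.ext (sub_left_injective h2) h1
  have hr : ∀ v : K × K, v ∈ LinearMap.range (e.comp j) ↔ v.1 ∈ 𝔟.val ∧ v.2 ∈ 𝔠.val := by
    intro v
    have h1 := h (v.1 + k * v.2, v.2)
    rw [add_sub_cancel_right] at h1
    rw [← h1]
    constructor
    · rintro ⟨m, rfl⟩
      refine ⟨m, ?_⟩
      change j m = ((j m).1 - k * (j m).2 + k * (j m).2, (j m).2)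
      rw [sub_add_cancel]
    · rintro ⟨m, hm⟩
      refine ⟨m, ?_⟩
      change ((j m).1 - k * (j m).2, (j m).2) = v
      rw [hm]
      exact Prod.ext (add_sub_cancel_right _ _) rfl
  refine ⟨e.comp j, 𝔟, 𝔠, he.comp hj, ⟨?_, ?_⟩, hr⟩
  · have := IsRankTwoLattice.finite (R := R) (M := M)
    exact Module.Finite.iff_fg.1 inferInstance
  · obtain ⟨b, hb, hb0⟩ := exists_ne_zero_mem 𝔟
    obtain ⟨d, hd, hd0⟩ := exists_ne_zero_mem 𝔠
    exact ⟨(b, 0), (hr _).2 ⟨hb, zero_mem _⟩, (0, d), (hr _).2 ⟨zero_mem _, hd⟩, by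
      simp [det2, hb0, hd0]⟩

theorem mem_of_forall_mul_mem {𝔟 𝔠 : (Submodule R K)ˣ} {x : K}
    (h : ∀ u ∈ 𝔟.val, u * x ∈ (𝔟 * 𝔠).val) : x ∈ 𝔠.val := by
  have h1 := mem_inv_mul h
  rwa [← Units.val_mul, inv_mul_cancel_left] at h1

/-- Every form belongs to a quadratic algebra. -/
theorem exists_formOver (F : Form 𝔞) :
    ∃ (S' : Type u) (_ : CommRing S') (_ : Algebra R S') (_ : IsRankTwoLattice R S')
      (α' : ⋀[R]^2 S' ≃ₗ[R] idealModule 𝔞) (G : FormOver α'), G.toForm = F := by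
  obtain ⟨j, 𝔟, 𝔠, hj, hL, hr⟩ := exists_plane_coordinates (R := R) (K := K) F.M
  obtain ⟨P, Q, T, hφ⟩ := exists_coefficients F.φ hj hL hr
  have hvol : volN (LinearMap.range j) = (𝔟 * 𝔠).val :=
    volN_eq (k := 0) fun v => by rw [zero_mul, sub_zero]; exact hr v
  have hV : ∀ a ∈ idealModule 𝔞, ∀ u ∈ 𝔟.val, ∀ v ∈ 𝔠.val,
      a * (P * u ^ 2 + Q * u * v + T * v ^ 2) ∈ (𝔟 * 𝔠).val := by
    intro a ha u hu v hv
    obtain ⟨m, hm⟩ := (hr (u, v)).2 ⟨hu, hv⟩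
    have h1 : detMapK j (F.φ m : K ⊗[R] ⋀[R]^2 F.M) ∈
        ((idealUnit 𝔞)⁻¹ * (𝔟 * 𝔠) : (Submodule R K)ˣ).val := by
      rw [Units.val_mul, val_inv_idealUnit, ← hvol, ← map_twist]
      exact ⟨_, (F.φ m).2, rfl⟩
    rw [hφ, hm] at h1
    have h2 := mul_mem_units (𝔟 := idealUnit 𝔞) ha h1
    rwa [mul_inv_cancel_left] at h2
  -- The values of Pu² + Quv + Tv² lie in 𝔞⁻¹𝔟𝔠. Separated into coefficients, this gives 𝔞P𝔟 ⊆ 𝔠,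
  -- 𝔞T𝔠 ⊆ 𝔟 and 𝔞Q ⊆ R, which is what makes R + 𝔞ω a ring that preserves the lattice.
  have hP : ∀ a ∈ idealModule 𝔞, ∀ u ∈ 𝔟.val, a * P * u ∈ 𝔠.val := fun a ha u hu =>
    mem_of_forall_mul_mem (𝔟 := 𝔟) fun u' hu' => by
      convert mul_mem_of_forall_sq (t := a * P) (fun u hu => by
        convert hV a ha u hu 0 (zero_mem _) using 1; ring) hu' hu using 1
      ring
  have hT : ∀ a ∈ idealModule 𝔞, ∀ v ∈ 𝔠.val, a * T * v ∈ 𝔟.val := fun a ha v hv =>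
    mem_of_forall_mul_mem (𝔟 := 𝔠) fun v' hv' => by
      rw [mul_comm 𝔠 𝔟]
      convert mul_mem_of_forall_sq (t := a * T) (fun v hv => by
        convert hV a ha 0 (zero_mem _) v hv using 1; ring) hv' hv using 1
      ring
  have hQ : ∀ a ∈ idealModule 𝔞, Q * a ∈ (1 : Submodule R K) := fun a ha => by
    refine mem_one_of_forall_mul (𝔟 := 𝔟 * 𝔠) fun w hw => ?_
    induction hw using Submodule.mul_induction_on' with
    | add x _ y _ hx hy => rw [mul_add]; exact add_mem hx hy
    | mem_mul_mem u hu v hv =>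
      convert sub_mem (sub_mem (hV a ha u hu v hv) (hV a ha u hu 0 (zero_mem _)))
        (hV a ha 0 (zero_mem _) v hv) using 1
      ring
  have hPT : ∀ a ∈ idealModule 𝔞, ∀ b ∈ idealModule 𝔞, -(P * T) * (a * b) ∈ (1 : Submodule R K) :=
    fun a ha b hb => mem_one_of_forall_mul (𝔟 := 𝔟) fun u hu => by
      convert neg_mem (hT b hb _ (hP a ha u hu)) using 1
      ring
  -- The action of ω, chosen so that v ∧ Wv is the value of the form at v. Its trace is Q and its
  -- determinant PT, so W² = QW − PT.
  let W : Module.End K (K × K) :=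
    { toFun := fun v => (-T * v.2, P * v.1 + Q * v.2)
      map_add' := fun v w => by ext <;> simp <;> ring
      map_smul' := fun k v => by ext <;> simp <;> ring }
  have hW : W * W = (-(P * T)) • 1 + Q • W := by
    refine LinearMap.ext fun v => ?_
    change (-T * (P * v.1 + Q * v.2), P * (-T * v.2) + Q * (P * v.1 + Q * v.2)) =
      ((-(P * T)) * v.1 + Q * (-T * v.2), (-(P * T)) * v.2 + Q * (P * v.1 + Q * v.2))
    ext
    · ring
    · ring
  let A : quadraticOrder 𝔞 (-(P * T)) Q hPT hQ →+* Module.End K (K × K) :=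
    (QuadraticAlgebra.lift ⟨W, hW⟩).toRingHom.comp
      (quadraticOrder 𝔞 (-(P * T)) Q hPT hQ).val.toRingHom
  have hA : ∀ z v, A z v = (z.1.re * v.1 + z.1.im * (-T * v.2),
      z.1.re * v.2 + z.1.im * (P * v.1 + Q * v.2)) := fun z v => rfl
  obtain ⟨α', hα⟩ := exists_orientation_quadraticOrder (𝔞 := 𝔞) (hp := hPT) (hq := hQ)
  obtain ⟨hmod, htower, hsmul⟩ := exists_module_of_action hj A (fun r v => by
    rw [hA]
    ext
    · change algebraMap R K r * v.1 + 0 * _ = (r • v).1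
      rw [fst_smul_prod]; ring
    · change algebraMap R K r * v.2 + 0 * _ = (r • v).2
      rw [snd_smul_prod]; ring) (fun s m => by
    obtain ⟨r, hr1⟩ := Submodule.mem_one.1 s.2.1
    have hm := (hr _).1 ⟨m, rfl⟩
    have h2 : s.1.im * (-T * (j m).2) ∈ 𝔟.val ∧ s.1.im * (P * (j m).1 + Q * (j m).2) ∈ 𝔠.val := by
      constructor
      · convert neg_mem (hT _ s.2.2 _ hm.2) using 1
        ring
      · obtain ⟨t, ht⟩ := Submodule.mem_one.1 (hQ _ s.2.2)
        have h3 := 𝔠.val.smul_mem t hm.2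
        rw [Algebra.smul_def, ht] at h3
        convert add_mem (hP _ s.2.2 _ hm.1) h3 using 1
        ring
    rw [hA]
    refine (hr _).2 ⟨add_mem ?_ h2.1, add_mem ?_ h2.2⟩
    · rw [← hr1, ← Algebra.smul_def]; exact 𝔟.val.smul_mem r hm.1
    · rw [← hr1, ← Algebra.smul_def]; exact 𝔠.val.smul_mem r hm.2)
  refine ⟨quadraticOrder 𝔞 (-(P * T)) Q hPT hQ, inferInstance, inferInstance,
    isRankTwoLattice_quadraticOrder, α',
    { F with moduleS := hmod, tower := htower, wedge_smul := fun s m => ?_ }, rfl⟩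
  apply detMapK_injective hj hL
  rw [detMapK_tmul, detMap_wedge, hsmul, hA, (detMapK j).map_smul, hφ, hα, smul_eq_mul]
  change _ = (1 * s.1.im - 0 * _) * _
  simp only [det2]
  ring

end FormAlgebra

/-! ### The ring of a box, and the action of S on a single lattice. -/

section BoxAlgebra

variable {R K : Type u} [CommRing R] [IsDedekindDomain R] [Field K] [Algebra R K]
  [IsFractionRing R K] {𝔞 : (FractionalIdeal R⁰ K)ˣ}
  {S : Type u} [CommRing S] [Algebra R S] [IsRankTwoLattice R S]
  {α : ⋀[R]^2 S ≃ₗ[R] idealModule 𝔞}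

/-- The ring of a primitive box belonging to `S` is `S`. -/
theorem PrimBoxOver.belongsTo (c : Coords α) (C : PrimBoxOver α) : C.1.toBox.BelongsTo α := by
  obtain ⟨ι, hι⟩ := C.exists_isEmb c
  obtain ⟨I, hI, -⟩ := hι.exists_ideal C.2
  obtain ⟨a, ha, ha0⟩ := exists_ne_zero_mem (idealUnit 𝔞)
  obtain ⟨s, hs⟩ := c.exists_ω ha
  -- Each ideal meets R, so the rational bases rᵢ and rᵢaω are available, and up to scalars the
  -- coefficients of the box are the ω-coordinates of 1, ω, ω² and ω³.
  have h1 : ∀ i, ∃ (r : K) (m : C.1.M i), r ≠ 0 ∧ c.ψ (ι i m) = ⟨r, 0⟩ := by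
    intro i
    obtain ⟨r, hr, h⟩ := Coords.exists_algebraMap_mem (I i)
    rw [hI] at h
    obtain ⟨m, hm⟩ := h
    exact ⟨algebraMap R K r, m, by simpa using hr, by rw [hm, c.ψ_algebraMap]⟩
  choose r m hr hm using h1
  have hsm : ∀ i, c.ψ (ι i (s • m i)) = ⟨0, r i * a⟩ := by
    intro i
    rw [map_smul, Coords.smul_eq, map_mul, hs, hm]
    ext <;> simp [mul_comm]
  let η : ∀ i, Fin 2 → C.1.M i := fun i => ![m i, s • m i]
  have hη0 : ∀ i, c.ψ (ι i (η i 0)) = ⟨r i, 0⟩ := hm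
  have hη1 : ∀ i, c.ψ (ι i (η i 1)) = ⟨0, r i * a⟩ := hsm
  have hθ : (C.1.θ (⨂ₜ[R] i, wedge R (η i 0) (η i 1)) : K) = (r 0 * r 1 * r 2) ^ 2 * a ^ 3 := by
    rw [hι.θ_eq, Fin.prod_univ_three]
    simp only [c.volK_eq, hη0, hη1]
    ring
  have hβ : ∀ i j k : Fin 2, (C.1.β (fun t => η t (![i, j, k] t)) : K) =
      (c.ψ (ι 0 (η 0 i)) * c.ψ (ι 1 (η 1 j)) * c.ψ (ι 2 (η 2 k))).im := by
    intro i j k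
    rw [hι.β_eq, c.volK_one, Fin.prod_univ_three, map_mul, map_mul]
    rfl
  -- Put D = (r₀r₁r₂)²a³, the value of θ. The condition α(1 ∧ ζ) = D fixes the ω-coordinate of ζ.
  -- The trace of the box is 3Dq, while Dω has trace Dq, so ζ = D(q + ω) has the correct trace.
  refine ⟨η, ?_, c.ψ.symm ⟨(r 0 * r 1 * r 2) ^ 2 * a ^ 3 * c.q, (r 0 * r 1 * r 2) ^ 2 * a ^ 3⟩,
    ?_, ?_⟩
  · rw [hθ]
    exact mul_ne_zero (pow_ne_zero _ (mul_ne_zero (mul_ne_zero (hr 0) (hr 1)) (hr 2)))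
      (pow_ne_zero _ ha0)
  · rw [hθ, c.volK_one, RingEquiv.apply_symm_apply]
  · simp only [hβ, hη0, hη1]
    apply c.ψ.injective
    rw [map_zero, map_add, map_sub, map_pow, map_mul, c.ψ_one_tmul, c.ψ_one_tmul,
      RingEquiv.apply_symm_apply, pow_two]
    ext
    · simp only [QuadraticAlgebra.re_add, QuadraticAlgebra.re_sub, QuadraticAlgebra.re_mul,
        QuadraticAlgebra.im_mul, QuadraticAlgebra.re_zero]
      ring
    · simp only [QuadraticAlgebra.im_add, QuadraticAlgebra.im_sub, QuadraticAlgebra.re_mul,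
        QuadraticAlgebra.im_mul, QuadraticAlgebra.im_zero]
      ring

/-- The operator of a binary quadratic form with coefficients `P, Q, T`, up to a scalar `u`. -/
def planeOperator (u P Q T : K) : Module.End K (K × K) where
  toFun v := (u * v.1 - T * v.2, P * v.1 + (u + Q) * v.2)
  map_add' v w := by ext <;> simp <;> ring
  map_smul' k v := by ext <;> simp <;> ring

theorem Coords.trace_mem (c : Coords α) (s : S) :
    2 * (c.ψ (s ⊗ₜ[R] (1 : K))).re + c.q * (c.ψ (s ⊗ₜ[R] (1 : K))).im ∈ (1 : Submodule R K) := by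
  have h := c.mem_one_iff.1 (Submodule.mem_one.2 ⟨s, rfl⟩)
  rw [two_mul]
  exact add_mem (add_mem h.1 h.1) (c.q_mul_mem h.2)

theorem Coords.nrm_mem_one (c : Coords α) (s : S) :
    c.nrm (s ⊗ₜ[R] (1 : K)) ∈ (1 : Submodule R K) := by
  have h : s ⊗ₜ[R] (1 : K) ∈ (1 : Submodule S (Total (R := R) K S)) := Submodule.mem_one.2 ⟨s, rfl⟩
  have h1 := Submodule.mul_mem_mul h (c.conj_mem_one h)
  rw [c.mul_conj, mul_one, c.mem_one_iff, c.ψ_one_tmul] at h1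
  exact h1.1

/-- If `D φ` has coefficients `P, Q, T` and the operator of the form satisfies the equation of
`ζ ∈ S_K`, where `α(1 ∧ ζ) = D`, then `S` acts on the lattice. -/
theorem Coords.exists_action (c : Coords α) {M : Type u} [AddCommGroup M] [Module R M]
    (φ : QuadraticMap R M (twist 𝔞 M)) {j : M →ₗ[R] K × K} (hj : Function.Injective j)
    (hL : IsLat (LinearMap.range j)) {D u P Q T t n k : K} (hD : D ≠ 0)
    (hφ : ∀ m, D * detMapK j (φ m : K ⊗[R] ⋀[R]^2 M) =
      P * (j m).1 ^ 2 + Q * (j m).1 * (j m).2 + T * (j m).2 ^ 2)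
    (ht : 2 * u + Q = t) (hn : u * (u + Q) + P * T = n)
    (h1 : 2 * k + D * c.q = t) (h2 : k ^ 2 + D ^ 2 * c.p = t * k - n) :
    ∃ (_ : Module S M) (_ : IsScalarTower R S M), ∀ (s : S) (m : M), j (s • m) =
      (c.ψ (s ⊗ₜ[R] (1 : K))).re • j m +
        ((c.ψ (s ⊗ₜ[R] (1 : K))).im / D) • (planeOperator u P Q T (j m) - k • j m) := by
  -- Since ζ = k + Dω is to act as the plane operator, ω acts as W.
  let W : Module.End K (K × K) := D⁻¹ • (planeOperator u P Q T - k • 1)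
  have hW' : ∀ v : K × K, W v =
      (D⁻¹ * (u * v.1 - T * v.2 - k * v.1), D⁻¹ * (P * v.1 + (u + Q) * v.2 - k * v.2)) := fun v => rfl
  have hW : W * W = c.p • 1 + c.q • W := by
    refine LinearMap.ext fun v => ?_
    have hp : c.p = (t * k - n - k ^ 2) / D ^ 2 := by field_simp; linear_combination h2
    have hq : c.q = (t - 2 * k) / D := by field_simp; linear_combination h1
    change W (W v) = c.p • v + c.q • W v
    rw [hW', hW', hp, hq, ← ht, ← hn]
    ext
    · simp only [Prod.fst_add, Prod.smul_fst, smul_eq_mul]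
      field_simp
      ring
    · simp only [Prod.snd_add, Prod.smul_snd, smul_eq_mul]
      field_simp
      ring
  let A : S →+* Module.End K (K × K) := (QuadraticAlgebra.lift ⟨W, hW⟩).toRingHom.comp
    ((c.ψ : Total (R := R) K S →+* QuadraticAlgebra K c.p c.q).comp
      (Algebra.TensorProduct.includeLeftRingHom))
  have hA : ∀ s v, A s v = (c.ψ (s ⊗ₜ[R] (1 : K))).re • v + (c.ψ (s ⊗ₜ[R] (1 : K))).im • W v :=
    fun s v => rfl
  have hA' : ∀ s v, A s v = (c.ψ (s ⊗ₜ[R] (1 : K))).re • v +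
      ((c.ψ (s ⊗ₜ[R] (1 : K))).im / D) • (planeOperator u P Q T v - k • v) := by
    intro s v
    rw [hA, div_eq_mul_inv, mul_smul]
    rfl
  have hmem : ∀ s, ∀ v ∈ LinearMap.range j, A s v ∈ LinearMap.range j := by
    intro s
    -- The given basis need not be adapted to a splitting of the lattice. Stability follows because
    -- s has integral trace and norm and m ∧ sm = α(1 ∧ s) φ(m) has volume in 𝔞 · 𝔞⁻¹ Λ² M.
    refine hL.mem_of_quadratic (A s) (c.trace_mem s) (c.nrm_mem_one s) (fun v => ?_) ?_
    · have h3 : c.ψ (s ⊗ₜ[R] (1 : K)) * c.ψ (s ⊗ₜ[R] (1 : K)) =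
          (2 * (c.ψ (s ⊗ₜ[R] (1 : K))).re + c.q * (c.ψ (s ⊗ₜ[R] (1 : K))).im) •
            c.ψ (s ⊗ₜ[R] (1 : K)) - algebraMap K _ (c.nrm (s ⊗ₜ[R] (1 : K))) := by
        rw [c.nrm_eq, QuadraticAlgebra.algebraMap_eq]
        ext <;> simp <;> ring
      have h4 := congrArg (QuadraticAlgebra.lift ⟨W, hW⟩) h3
      rw [map_mul, map_sub, map_smul, AlgHom.commutes] at h4
      exact LinearMap.congr_fun h4 v
    · rintro _ ⟨m, rfl⟩
      have h3 : det2 (j m) (A s (j m)) = (c.ψ (s ⊗ₜ[R] (1 : K))).im *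
          detMapK j (φ m : K ⊗[R] ⋀[R]^2 M) := by
        refine mul_left_cancel₀ hD ?_
        rw [mul_left_comm, hφ, hA', planeOperator]
        simp only [det2, LinearMap.coe_mk, AddHom.coe_mk, Prod.fst_add, Prod.snd_add,
          Prod.smul_fst, Prod.smul_snd, Prod.fst_sub, Prod.snd_sub, smul_eq_mul]
        field_simp
        ring
      rw [h3]
      have h4 : detMapK j (φ m : K ⊗[R] ⋀[R]^2 M) ∈
          idealModule 𝔞⁻¹ * volN (LinearMap.range j) := by
        rw [← map_twist]
        exact ⟨_, (φ m).2, rfl⟩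
      have h5 := Submodule.mul_mem_mul (c.mem_one_iff.1 (Submodule.mem_one.2 ⟨s, rfl⟩)).2 h4
      rw [← mul_assoc, Coords.idealModule_mul_inv, one_mul] at h5
      exact h5
  obtain ⟨hmod, htower, h⟩ := exists_module_of_action hj A (fun r v => by
    have h3 : (algebraMap R S r) ⊗ₜ[R] (1 : K) = algebraMap R (Total (R := R) K S) r := rfl
    rw [hA, h3, c.ψ_algebraMap, zero_smul, add_zero, algebraMap_smul]) fun s m => hmem s _ ⟨m, rfl⟩
  exact ⟨hmod, htower, fun s m => by rw [h, hA']⟩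

end BoxAlgebra

/-! ### The three operators of a box in coordinates. -/

section BoxActions

variable {R K : Type u} [CommRing R] [IsDedekindDomain R] [Field K] [Algebra R K]
  [IsFractionRing R K] {𝔞 : (FractionalIdeal R⁰ K)ˣ}

/-- The trilinear form on three planes with the coefficients `A`. -/
def triEval (A : Fin 2 → Fin 2 → Fin 2 → K) (x y z : K × K) : K :=
  x.1 * (y.1 * (z.1 * A 0 0 0 + z.2 * A 0 0 1) + y.2 * (z.1 * A 0 1 0 + z.2 * A 0 1 1)) +
    x.2 * (y.1 * (z.1 * A 1 0 0 + z.2 * A 1 0 1) + y.2 * (z.1 * A 1 1 0 + z.2 * A 1 1 1))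

/-- The scalars that complete the operators of the three forms of a box to operators with the
same characteristic polynomial. -/
def shiftCoeff (A : Fin 2 → Fin 2 → Fin 2 → K) : Fin 3 → K :=
  ![A 0 0 0 * A 1 1 1 + A 0 1 1 * A 1 0 0, A 0 0 0 * A 1 1 1 + A 0 1 0 * A 1 0 1,
    A 0 0 0 * A 1 1 1 + A 0 0 1 * A 1 1 0]

/-- The leading coefficients of the three forms of a box. -/
def leadCoeff (A : Fin 2 → Fin 2 → Fin 2 → K) : Fin 3 → K :=
  ![-(A 0 0 0 * A 0 1 1 - A 0 0 1 * A 0 1 0), -(A 0 0 0 * A 1 0 1 - A 0 0 1 * A 1 0 0),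
    -(A 0 0 0 * A 1 1 0 - A 0 1 0 * A 1 0 0)]

/-- The middle coefficients of the three forms of a box. -/
def midCoeff (A : Fin 2 → Fin 2 → Fin 2 → K) : Fin 3 → K :=
  ![-(A 0 0 0 * A 1 1 1 + A 0 1 1 * A 1 0 0 - A 0 0 1 * A 1 1 0 - A 0 1 0 * A 1 0 1),
    -(A 0 0 0 * A 1 1 1 + A 0 1 0 * A 1 0 1 - A 0 0 1 * A 1 1 0 - A 0 1 1 * A 1 0 0),
    -(A 0 0 0 * A 1 1 1 + A 0 0 1 * A 1 1 0 - A 0 1 0 * A 1 0 1 - A 0 1 1 * A 1 0 0)]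

/-- The constant coefficients of the three forms of a box. -/
def constCoeff (A : Fin 2 → Fin 2 → Fin 2 → K) : Fin 3 → K :=
  ![-(A 1 0 0 * A 1 1 1 - A 1 0 1 * A 1 1 0), -(A 0 1 0 * A 1 1 1 - A 0 1 1 * A 1 1 0),
    -(A 0 0 1 * A 1 1 1 - A 0 1 1 * A 1 0 1)]

/-- The trace of the quadratic algebra of a box. -/
def boxTrace (A : Fin 2 → Fin 2 → Fin 2 → K) : K :=
  A 0 0 0 * A 1 1 1 + A 0 0 1 * A 1 1 0 + A 0 1 0 * A 1 0 1 + A 0 1 1 * A 1 0 0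

/-- The norm of the quadratic algebra of a box. -/
def boxNorm (A : Fin 2 → Fin 2 → Fin 2 → K) : K :=
  A 0 0 0 * A 0 0 1 * A 1 1 0 * A 1 1 1 + A 0 0 0 * A 0 1 0 * A 1 0 1 * A 1 1 1 +
    A 0 0 0 * A 0 1 1 * A 1 0 0 * A 1 1 1 + A 0 0 1 * A 0 1 0 * A 1 0 1 * A 1 1 0 +
    A 0 0 1 * A 0 1 1 * A 1 0 0 * A 1 1 0 + A 0 1 0 * A 0 1 1 * A 1 0 0 * A 1 0 1 -
    A 0 0 0 * A 0 1 1 * A 1 0 1 * A 1 1 0 - A 0 0 1 * A 0 1 0 * A 1 0 0 * A 1 1 1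

/-- The three forms of a box share a discriminant but not their middle coefficients; the shifts
equalize the traces. Together with `boxNorm_eq`, which does the same for determinants, this lets one
element ζ act on all three lattices. -/
theorem boxTrace_eq (A : Fin 2 → Fin 2 → Fin 2 → K) (i : Fin 3) :
    2 * shiftCoeff A i + midCoeff A i = boxTrace A := by
  fin_cases i <;> simp [shiftCoeff, midCoeff, boxTrace] <;> ring

theorem boxNorm_eq (A : Fin 2 → Fin 2 → Fin 2 → K) (i : Fin 3) :
    shiftCoeff A i * (shiftCoeff A i + midCoeff A i) + leadCoeff A i * constCoeff A i =
      boxNorm A := by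
  fin_cases i <;> simp [shiftCoeff, midCoeff, leadCoeff, constCoeff, boxNorm] <;> ring

/-- Coordinates on the lattices of a box with respect to vectors `η`. -/
structure Box.Frame (B : Box 𝔞) (η : ∀ i, Fin 2 → B.M i) (j : ∀ i, B.M i →ₗ[R] K × K) : Prop where
  injective : ∀ i, Function.Injective (j i)
  isLat : ∀ i, IsLat (LinearMap.range (j i))
  map_zero : ∀ i, j i (η i 0) = (1, 0)
  map_one : ∀ i, j i (η i 1) = (0, 1)

/-- The values of the trilinear form of a box on the vectors `η`. -/
def Box.coeff (B : Box 𝔞) (η : ∀ i, Fin 2 → B.M i) (i j k : Fin 2) : K :=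
  B.β fun t => η t (![i, j, k] t)

theorem Box.exists_frame (B : Box 𝔞) {η : ∀ i, Fin 2 → B.M i}
    (h : (B.θ (⨂ₜ[R] i, wedge R (η i 0) (η i 1)) : K) ≠ 0) : ∃ j, B.Frame η j := by
  have h1 : ∀ i, ∃ j : B.M i →ₗ[R] K × K, Function.Injective j ∧ IsLat (LinearMap.range j) ∧
      j (η i 0) = (1, 0) ∧ j (η i 1) = (0, 1) := by
    intro i
    obtain ⟨j, hj, hL⟩ := exists_embedding R K (B.M i)
    refine exists_embedding_basis hj hL fun h0 => h ?_
    rw [← detMap_wedge, map_eq_zero_iff _ (detMap_injective hj hL)] at h0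
    rw [(PiTensorProduct.tprod R).map_coord_zero i h0, map_zero, ZeroMemClass.coe_zero]
  choose j h1 h2 h3 h4 using h1
  exact ⟨j, h1, h2, h3, h4⟩

namespace Box.Frame

variable {B : Box 𝔞} {η : ∀ i, Fin 2 → B.M i} {j : ∀ i, B.M i →ₗ[R] K × K}

theorem θ_eq (h : B.Frame η j) (w : ∀ i, ⋀[R]^2 (B.M i)) : (B.θ (⨂ₜ[R] i, w i) : K) =
    B.θ (⨂ₜ[R] i, wedge R (η i 0) (η i 1)) * ∏ i, detMap (j i) (w i) := by
  have h1 : ∀ i, det2 (j i (η i 0)) (j i (η i 1)) = 1 := fun i => by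
    rw [h.map_zero, h.map_one]; simp [det2]
  have h2 := (rankOneAt_tprod h.injective h.isLat (x := fun i => η i 0) (y := fun i => η i 1)
    fun i => by rw [h1]; exact one_ne_zero).map_mul_map ((idealModule (𝔞 ^ 3)).subtype.comp
      (B.θ : (⨂[R] i, ⋀[R]^2 (B.M i)) →ₗ[R] idealModule (𝔞 ^ 3))) (detTensor j) (⨂ₜ[R] i, w i)
  simp only [detTensor_tprod, detMap_wedge, h1, Finset.prod_const_one, mul_one] at h2
  rw [mul_comm]
  exact h2

theorem β_expand (h : B.Frame η j) (x : ∀ i, B.M i) (i : Fin 3) :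
    (B.β x : K) = (j i (x i)).1 * B.β (Function.update x i (η i 0)) +
      (j i (x i)).2 * B.β (Function.update x i (η i 1)) := by
  obtain ⟨r, hr, s, t, hm⟩ := exists_smul_eq_add (h.injective i) (h.isLat i) (x := η i 0)
    (y := η i 1) (by rw [h.map_zero, h.map_one]; simp [det2]) (x i)
  have hr' : algebraMap R K r ≠ 0 := by simpa using hr
  have h2 := congrArg (j i) hm
  rw [map_smul, map_add, map_smul, map_smul, h.map_zero, h.map_one] at h2
  have h3 := congrArg Prod.fst h2
  have h4 := congrArg Prod.snd h2
  simp only [fst_smul_prod, snd_smul_prod, Prod.fst_add, Prod.snd_add, mul_zero, mul_one, add_zero,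
    zero_add] at h3 h4
  have h5 : r • B.β x = s • B.β (Function.update x i (η i 0)) +
      t • B.β (Function.update x i (η i 1)) := by
    rw [← MultilinearMap.map_update_smul, ← MultilinearMap.map_update_smul,
      ← MultilinearMap.map_update_add, ← hm, MultilinearMap.map_update_smul,
      Function.update_eq_self]
  have h6 := congrArg Subtype.val h5
  simp only [Submodule.coe_add, Submodule.coe_smul, Algebra.smul_def] at h6
  refine mul_left_cancel₀ hr' (h6.trans ?_)
  rw [mul_add, ← mul_assoc, ← mul_assoc, h3, h4]

theorem β_eq (h : B.Frame η j) (x : ∀ i, B.M i) :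
    (B.β x : K) = triEval (B.coeff η) (j 0 (x 0)) (j 1 (x 1)) (j 2 (x 2)) := by
  have h3 : ∀ l m n : Fin 2, Function.update (Function.update (Function.update x 0 (η 0 l)) 1
      (η 1 m)) 2 (η 2 n) = fun t => η t (![l, m, n] t) := by
    intro l m n
    funext t
    fin_cases t <;> simp [Function.update]
  rw [h.β_expand x 0, h.β_expand (Function.update x 0 (η 0 0)) 1,
    h.β_expand (Function.update x 0 (η 0 1)) 1,
    h.β_expand (Function.update (Function.update x 0 (η 0 0)) 1 (η 1 0)) 2,
    h.β_expand (Function.update (Function.update x 0 (η 0 0)) 1 (η 1 1)) 2,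
    h.β_expand (Function.update (Function.update x 0 (η 0 1)) 1 (η 1 0)) 2,
    h.β_expand (Function.update (Function.update x 0 (η 0 1)) 1 (η 1 1)) 2]
  simp only [h3]
  rw [Function.update_of_ne (by decide), Function.update_of_ne (by decide),
    Function.update_of_ne (by decide), Function.update_of_ne (by decide),
    Function.update_of_ne (by decide), Function.update_of_ne (by decide),
    Function.update_of_ne (by decide), Function.update_of_ne (by decide),
    Function.update_of_ne (by decide), Function.update_of_ne (by decide)]
  rfl

end Box.Frame

end BoxActions

/-! ### The S-structure of a primitive box with ring S. -/

section BoxStructure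

variable {R K : Type u} [CommRing R] [IsDedekindDomain R] [Field K] [Algebra R K]
  [IsFractionRing R K] {𝔞 : (FractionalIdeal R⁰ K)ˣ}

namespace Box.Frame

variable {B : Box 𝔞} {η : ∀ i, Fin 2 → B.M i} {j : ∀ i, B.M i →ₗ[R] K × K}

theorem detMap_eq_one (h : B.Frame η j) (i : Fin 3) : detMap (j i) (wedge R (η i 0) (η i 1)) = 1 := by
  rw [detMap_wedge, h.map_zero, h.map_one]
  simp [det2]

/-- With the first basis vectors on one side and the second on the other, the wedge factors at the
places other than i have determinant 1, so the defining equation gives the form directly. -/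
theorem form_eq_of_ne (h : B.Frame η j) {i l : Fin 3} (hl : l ≠ i)
    {φ : QuadraticMap R (B.M i) (twist 𝔞 (B.M i))} (hφ : B.HasForm i φ) (m : B.M i) :
    (B.θ (⨂ₜ[R] i, wedge R (η i 0) (η i 1)) : K) * detMapK (j i) (φ m : K ⊗[R] ⋀[R]^2 (B.M i)) =
      -((B.β (Function.update (fun k => η k 0) i m) : K) *
          B.β (Function.update (fun k => η k 1) i m) -
        B.β (Function.update (Function.update (fun k => η k 0) i m) l (η l 1)) *
          B.β (Function.update (Function.update (fun k => η k 1) i m) l (η l 0))) := by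
  have h1 := hφ (Function.update (fun k => η k 0) i m) (Function.update (fun k => η k 1) i m)
    (by rw [Function.update_self, Function.update_self]) l hl
  rw [B.thetaAt_eq_mul h.θ_eq, Function.update_self, Function.update_of_ne hl,
    Function.update_of_ne hl, Finset.prod_eq_one, mul_one] at h1
  · exact h1
  · intro k hk
    rw [Function.update_of_ne (Finset.ne_of_mem_erase hk),
      Function.update_of_ne (Finset.ne_of_mem_erase hk), h.detMap_eq_one]

theorem form_eq (h : B.Frame η j) {i : Fin 3}
    {φ : QuadraticMap R (B.M i) (twist 𝔞 (B.M i))} (hφ : B.HasForm i φ) (m : B.M i) :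
    (B.θ (⨂ₜ[R] i, wedge R (η i 0) (η i 1)) : K) * detMapK (j i) (φ m : K ⊗[R] ⋀[R]^2 (B.M i)) =
      leadCoeff (B.coeff η) i * (j i m).1 ^ 2 + midCoeff (B.coeff η) i * (j i m).1 * (j i m).2 +
        constCoeff (B.coeff η) i * (j i m).2 ^ 2 := by
  fin_cases i
  · refine (h.form_eq_of_ne (l := 1) (by decide) hφ m).trans ?_
    simp [h.β_eq, h.map_zero, h.map_one, Function.update, triEval, leadCoeff, midCoeff, constCoeff]
    ring
  · refine (h.form_eq_of_ne (l := 0) (by decide) hφ m).trans ?_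
    simp [h.β_eq, h.map_zero, h.map_one, Function.update, triEval, leadCoeff, midCoeff, constCoeff]
    ring
  · refine (h.form_eq_of_ne (l := 0) (by decide) hφ m).trans ?_
    simp [h.β_eq, h.map_zero, h.map_one, Function.update, triEval, leadCoeff, midCoeff, constCoeff]
    ring

end Box.Frame

/-- The operators of the three forms of a box act in the same way on the trilinear form. -/
theorem triEval_planeOperator (A : Fin 2 → Fin 2 → Fin 2 → K) (a b k : K) (v : Fin 3 → K × K)
    (w : ∀ i : Fin 3, K × K)
    (hw : ∀ i, w i = a • v i + b • (planeOperator (shiftCoeff A i) (leadCoeff A i) (midCoeff A i)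
      (constCoeff A i) (v i) - k • v i)) :
    triEval A (w 0) (v 1) (v 2) = triEval A (v 0) (w 1) (v 2) ∧
      triEval A (w 0) (v 1) (v 2) = triEval A (v 0) (v 1) (w 2) := by
  rw [hw 0, hw 1, hw 2]
  constructor <;>
  · simp [triEval, planeOperator, shiftCoeff, leadCoeff, midCoeff, constCoeff]
    ring

variable {S : Type u} [CommRing S] [Algebra R S] [IsRankTwoLattice R S]
  {α : ⋀[R]^2 S ≃ₗ[R] idealModule 𝔞}

/-- A primitive box whose ring is `S` carries `S`-module structures making it a box over `S`. -/
theorem exists_primBoxOver_toBox (c : Coords α) (B : Box 𝔞) (hB : B.Primitive)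
    (h : B.BelongsTo α) : ∃ C : PrimBoxOver α, C.1.toBox = B := by
  obtain ⟨η, hD, ζ, hζ, hpoly⟩ := h
  obtain ⟨j, hj⟩ := B.exists_frame hD
  choose φ hφ hprim using hB
  have hform := fun i => hj.form_eq (hφ i)
  obtain ⟨D, hDD⟩ : ∃ D : K, D = B.θ (⨂ₜ[R] i, wedge R (η i 0) (η i 1)) := ⟨_, rfl⟩
  simp only [← hDD] at hD hζ hform
  obtain ⟨k, hk⟩ : ∃ k, k = (c.ψ ζ).re := ⟨_, rfl⟩
  rw [c.volK_one] at hζ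
  have hp : ζ ^ 2 - ((1 : S) ⊗ₜ[R] boxTrace (B.coeff η)) * ζ +
      (1 : S) ⊗ₜ[R] boxNorm (B.coeff η) = 0 := by
    refine Eq.trans ?_ hpoly
    simp only [boxTrace, boxNorm, Box.coeff]
  have hp' := congrArg c.ψ hp
  rw [map_zero, map_add, map_sub, map_pow, map_mul, c.ψ_one_tmul, c.ψ_one_tmul, pow_two] at hp'
  have hre := congrArg QuadraticAlgebra.re hp'
  have him := congrArg QuadraticAlgebra.im hp'
  simp only [QuadraticAlgebra.re_add, QuadraticAlgebra.re_sub, QuadraticAlgebra.re_mul,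
    QuadraticAlgebra.im_mul, QuadraticAlgebra.re_zero, QuadraticAlgebra.im_add,
    QuadraticAlgebra.im_sub, QuadraticAlgebra.im_zero, hζ, ← hk] at hre him
  -- With ζ = k + Dω the equation of the ring of the box is compared in the coordinates 1 and ω; the
  -- ω-part carries a factor D, which is cancelled.
  have h1 : 2 * k + D * c.q = boxTrace (B.coeff η) :=
    mul_left_cancel₀ hD (by linear_combination him)
  have h2 : k ^ 2 + D ^ 2 * c.p = boxTrace (B.coeff η) * k - boxNorm (B.coeff η) := by
    linear_combination hre
  have hact := fun i => c.exists_action (φ i) (hj.injective i) (hj.isLat i) hD (hform i)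
    (boxTrace_eq _ i) (boxNorm_eq _ i) h1 h2
  choose hmod htower hact using hact
  -- At all three places s acts by the same linear polynomial in the respective operators, and these
  -- act identically on the trilinear form.
  have hsmul : ∀ (s : S) (x : ∀ i, B.M i) (i : Fin 3),
      B.β (Function.update x i (s • x i)) = B.β (Function.update x 0 (s • x 0)) := by
    intro s x i
    have h3 := triEval_planeOperator (B.coeff η) _ _ k (fun i => j i (x i))
      (fun i => j i (s • x i)) fun i => hact i s (x i)
    refine Subtype.ext ?_
    rw [hj.β_eq, hj.β_eq]
    fin_cases i
    · rfl
    · simpa [Function.update] using h3.1.symm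
    · simpa [Function.update] using h3.2.symm
  have hwedge : ∀ (i : Fin 3) (s : S) (m : B.M i),
      (1 : K) ⊗ₜ[R] wedge R m (s • m) = vol α 1 s • (φ i m : K ⊗[R] ⋀[R]^2 (B.M i)) := by
    intro i s m
    apply detMapK_injective (hj.injective i) (hj.isLat i)
    rw [detMapK_tmul, one_mul, detMap_wedge, (detMapK (j i)).map_smul, smul_eq_mul, c.vol_one]
    refine mul_left_cancel₀ hD ?_
    rw [mul_left_comm, hform, hact, planeOperator]
    simp only [det2, LinearMap.coe_mk, AddHom.coe_mk, Prod.fst_add, Prod.snd_add,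
      Prod.smul_fst, Prod.smul_snd, Prod.fst_sub, Prod.snd_sub, smul_eq_mul]
    field_simp
    ring
  exact ⟨⟨{ B with
    moduleS := hmod
    tower := htower
    smul_balanced := fun s x i l => (hsmul s x i).trans (hsmul s x l).symm
    form := φ
    hasForm := hφ
    wedge_smul := hwedge }, hprim⟩, rfl⟩

end BoxStructure

end BhargavaBox

open BhargavaBox in
theorem corollary5p6 {R K : Type u} [CommRing R] [IsDedekindDomain R]
    [Field K] [Algebra R K] [IsFractionRing R K]
    (𝔞 : (FractionalIdeal R⁰ K)ˣ) (S : Type u) [CommRing S] [Algebra R S] [IsRankTwoLattice R S]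
    (α : ⋀[R]^2 S ≃ₗ[R] idealModule 𝔞) :
    (∃ (_ : CommGroup (BoxClass α)) (e : BoxClass α ≃* Pic R K S × Pic R K S)
       (_ : CommGroup (FormClass α)) (e' : FormClass α ≃* Pic R K S),
      (∀ (B : PrimBoxOver α) (I : Fin 3 → InvIdeal R K S),
        B.1.IsBoxOf (fun i => (I i : Submodule S (Total (R := R) K S))) →
          e B.cls = (Pic.mk (I 0), Pic.mk (I 1))) ∧
      (∀ (F : PrimFormOver α) (I : InvIdeal R K S),
        Nonempty (F.1.M ≃ₗ[S] (I : Submodule S (Total (R := R) K S))) → e' F.cls = Pic.mk I) ∧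
      (∀ F : Fin 3 → PrimFormOver α,
        (F 0).cls * (F 1).cls * (F 2).cls = 1 ↔
          ∃ B : PrimBoxOver α, ∀ i, (B.form i).cls = (F i).cls) ∧
      (∀ F : PrimFormOver α, F.cls = 1 ↔ ∃ x, Submodule.span R {F.1.φ x} = ⊤)) ∧
    (∀ I : Fin 3 → InvIdeal R K S,
      (IsBalanced α fun i => (I i : Submodule S (Total (R := R) K S))) →
        ∃ B : PrimBoxOver α, B.1.IsBoxOf fun i => (I i : Submodule S (Total (R := R) K S))) ∧
    (∀ B : PrimBoxOver α, ∃ I : Fin 3 → InvIdeal R K S,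
      (IsBalanced α fun i => (I i : Submodule S (Total (R := R) K S))) ∧
        B.1.IsBoxOf fun i => (I i : Submodule S (Total (R := R) K S))) ∧
    (∀ I : InvIdeal R K S,
      ∃ F : PrimFormOver α, Nonempty (F.1.M ≃ₗ[S] (I : Submodule S (Total (R := R) K S)))) ∧
    (∀ B : Box 𝔞, B.Primitive →
      (B.BelongsTo α ↔ ∃ C : PrimBoxOver α, C.1.toBox = B)) ∧
    (∀ (B C : PrimBoxOver α) (f : ∀ i, B.1.M i ≃ₗ[R] C.1.M i),
      Box.IsIso B.1.toBox C.1.toBox f →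
        ∃ σ : S ≃ₐ[R] S, PreservesOrientation α α σ ∧
          ∀ (i : Fin 3) (s : S) (m : B.1.M i), f i (s • m) = σ s • f i m) ∧
    ((2 : R) ≠ 0 → ∀ B C : PrimBoxOver α,
      (∃ f, Box.IsIso B.1.toBox C.1.toBox f) → B.cls = C.cls) ∧
    (∀ F : Form 𝔞, IsPrimitive F.φ →
      ∃ (S' : Type u) (_ : CommRing S') (_ : Algebra R S') (_ : IsRankTwoLattice R S')
        (α' : ⋀[R]^2 S' ≃ₗ[R] idealModule 𝔞) (G : PrimFormOver α'), G.1.toForm = F) ∧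
    (∀ (S' : Type u) [CommRing S'] [Algebra R S'] [IsRankTwoLattice R S']
        (α' : ⋀[R]^2 S' ≃ₗ[R] idealModule 𝔞) (F : PrimFormOver α) (G : PrimFormOver α')
        (f : F.1.M ≃ₗ[R] G.1.M), Form.IsIso F.1.toForm G.1.toForm f →
      ∃ σ : S ≃ₐ[R] S', PreservesOrientation α α' σ ∧
        ∀ (s : S) (m : F.1.M), f (s • m) = σ s • f m) ∧
    ((2 : R) ≠ 0 → ∀ F G : PrimFormOver α,
      (∃ f, Form.IsIso F.1.toForm G.1.toForm f) → F.cls = G.cls) := by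
  obtain ⟨c⟩ := exists_coords (K := K) α
  obtain ⟨e, he⟩ := exists_boxClass_equiv c
  obtain ⟨e', he'⟩ := exists_formClass_equiv c
  -- The group structures are transported along the bijections with (Pic S)² and Pic S, so only the
  -- two descriptions of the group law on forms need an argument.
  refine ⟨⟨e.commGroup, e.mulEquiv, e'.commGroup, e'.mulEquiv, he, he', fun F => ?_, fun F => ?_⟩,
    fun _ => exists_primBoxOver_isBoxOf c, PrimBoxOver.exists_isBoxOf c, exists_primFormOver c,
    fun B hB => ?_, fun B C f => exists_semilinear_box,
    fun h2 B C ⟨f, hf⟩ => box_cls_eq_of_isIso h2 hf, fun F hF => ?_,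
    fun S' _ _ _ α' F G f => exists_semilinear, fun h2 F G ⟨f, hf⟩ => form_cls_eq_of_isIso h2 hf⟩
  · rw [← exists_box_of_forms_iff c he' F]
    letI := e'.commGroup
    rw [← e'.mulEquiv.map_eq_one_iff, map_mul, map_mul]
    rfl
  · rw [← linearEquiv_one_iff c F]
    letI := e'.commGroup
    rw [← e'.mulEquiv.map_eq_one_iff]
    change e' F.cls = 1 ↔ _
    obtain ⟨I, ⟨f⟩⟩ := F.exists_ideal c
    rw [he' F I ⟨f⟩]
    constructor
    · intro h
      obtain ⟨g⟩ := (c.linearEquiv_iff I 1).2 h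
      exact ⟨f.trans g⟩
    · rintro ⟨g⟩
      exact (c.linearEquiv_iff I 1).1 ⟨f.symm.trans g⟩
  · exact ⟨exists_primBoxOver_toBox c B hB, fun ⟨C, hC⟩ => hC ▸ C.belongsTo c⟩
  · obtain ⟨S', h1, h2, h3, α', G, rfl⟩ := exists_formOver F
    exact ⟨S', h1, h2, h3, α', ⟨G, hF⟩, rfl⟩
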